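/- **Setting.** Let $n,p\ge 1$. Node $0$ is a leader with a $\mathcal C^2$ trajectory $q_0(t)\in\mathbb R^p$ such that $\sqrt n\,\|\dot q_0(t)\|_2\le k_p$ and $\sqrt n\,\|\ddot q_0(t)\|_2\le k_q$ for $t\ge 0$. Followers $i=1,\dots,n$ are Euler–Lagrange agents $M_i(q_i)\ddot q_i+C_i(q_i,\dot q_i)\dot q_i+g_i(q_i)+\zeta_i(t)=\tau_i$, $q_i\in\mathbb R^p$, with $M_i$ of class $\mathcal C^1$, $C_i,g_i$ continuous, $M_i=M_i^\top$, $k_mI\le M_i\le k_MI$, $\dot M_i=C_i+C_i^\top$, $\|C_i(q,\dot q)\|_2\le k_C\|\dot q\|_2$, $\|g_i\|_2<k_g$, $\|\zeta_i(t)\|_2\le k_\zeta$. The initial conditions satisfy $\|q_i(0)-q_0(0)\|_2\le k_a/\sqrt n$ and $\|\dot q_i(0)-\dot q_0(0)\|_2\le k_b/\sqrt n$. All these constants are known, positive ($k_\zeta\ge0$), $k_m\le k_M$, and $\delta\in(0,k_m)$ is fixed. *Topologies.* $\mathcal G_{A,1},\dots,\mathcal G_{A,m}$ ($m\ge1$)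 are weighted digraphs on $\{0,\dots,n\}$ with weights $a_{ik}\ge 0$, $a_{ii}=0$ ($a_{ik}>0$ iff there is an edge $k\to i$), each containing a directed spanning tree rooted at the leader and having no edge into the leader. Let $\mathcal L_{22,j}$ be the follower block of the Laplacian of $\mathcal G_{A,j}$. The sensing graph is $\mathcal G_A(t)=\mathcal G_{A,\sigma(t)}$ with $\sigma:[0,\infty)\to\{1,\dots,m\}$ piecewise constant and successive switching times more than $\pi_d>0$ apart. *Observer and control.* On a time-varying weighted digraph $\mathcal G_B(t)$ (weights $b_{ik}(t)$) which for every $t\ge0$ contains a directed spanning tree rooted at the leader, follower $i$ runs $\dot{\hat r}_i=\hat v_i-\omega_1\,\mathrm{sgn}\big(\sum_k b_{ik}(\hat r_i-\hat r_k)\big)$, $\dot{\hat v}_i=-\omega_2\,\mathrm{sgn}\big(\sum_k b_{ik}(\hat v_i-\hat v_k)\big)$ with $\hat r_0=q_0$, $\hat v_0=\dot q_0$, $\omega_1>0$, $\omega_2>k_q/\sqrt n$, and applies $$\tau_i=-\eta\sum_k a_{ik}(t)\big((q_i-q_k)+\mu(\dot q_i-\dot q_k)\big)-\beta\,\mathrm{sgn}\big((q_i-\hat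 r_i)+\mu(\dot q_i-\hat v_i)\big),$$ where $k$ runs over $0,\dots,n$ and $\mathrm{sgn}$ acts element-wise. Solutions are meant in the sense of Filippov (absolutely continuous, with the regularisation taken in the state). *Per-topology quantities.* For each $j$ let $\Gamma_j=\mathrm{diag}(\gamma_{j,1},\dots,\gamma_{j,n})>0$ with $\max_i\gamma_{j,i}=1$ and $\Gamma_j\mathcal L_{22,j}+\mathcal L_{22,j}^\top\Gamma_j>0$. Put $X_j=(\Gamma_j\mathcal L_{22,j}+\mathcal L_{22,j}^\top\Gamma_j)\otimes I_p$, $l_j=\lambda_{\min}(X_j)$, $u_j=\lambda_{\max}(X_j)$, $\underline\gamma_j=\min_i\gamma_{j,i}$, $\xi=k_g+k_\zeta+k_Mk_q$, $h=k_M+\delta$, $d=k_m-\delta$, and (blocks are multiples of $I_{np}$) $$L_{\mu,j}=\begin{bmatrix}\eta u_jI&\tfrac12\mu^{-1}hI\\ \tfrac12\mu^{-1}hI&\tfrac12hI\end{bmatrix},\qquad N_{\mu,j}=\tfrac12\begin{bmatrix}\tfrac12\eta l_jI&\mu^{-1}\underline\gamma_jdI\\ \mu^{-1}\underline\gamma_jdI&\underline\gamma_jdI\end{bmatrix}.$$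 Choose $\mu_{3,j}$ with $\max\{\sqrt{h/(2u_j)},\sqrt{2\underline\gamma_jd/l_j}\}<\mu_{3,j}\le\mu$; put $\rho_j=\tfrac14\eta l_j-\tfrac12\mu_{3,j}^{-2}\underline\gamma_jd$, $\rho'_j=\tfrac12\underline\gamma_jd-(\tfrac12\mu_{3,j}^{-1}\underline\gamma_jd)^2/(\tfrac14\eta l_j)$, $F_j(x,y)=\eta u_jx^2+\tfrac12hy^2+\mu_{3,j}^{-1}hxy$, $\bar V_j=F_j(k_a,k_b)$, $\hat V_j=F_j\big(\sqrt{\bar V_j/\rho_j},\sqrt{\bar V_j/\rho'_j}\big)$, $\mathcal X_j=\sqrt{\hat V_j/\rho_j}$, $\mathcal Y_j=\sqrt{\hat V_j/\rho'_j}$. Let $\varphi_j=\tfrac12\mu^2\eta l_j-\mu k_Ck_p-k_M$. A number $a_{3,j}>0$ is called *admissible* if for all $x,y\in\mathbb R^{np}$ with $\|x\|_2\le\mathcal X_j$, $\|y\|_2\le\mathcal Y_j$ $$-\mu^{-1}\Big[\varphi_j\|y\|_2^2+\tfrac12\eta l_j\|x\|_2^2-2k_Ck_p\|x\|_2\|y\|_2-k_C\|x\|_2\|y\|_2^2+(\beta\underline\gamma_j-k_Ck_p^2-\xi)\|x+\mu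 y\|_1\Big]\le-a_{3,j}\big(\|x\|_2^2+\|y\|_2^2\big).$$ Finally $\displaystyle\kappa=\frac{\max_j\lambda_{\max}(L_{\mu,j})}{\min_j\lambda_{\min}(N_{\mu,j})}$ and $\displaystyle\Lambda=\min_j\frac{a_{3,j}}{\lambda_{\max}(L_{\mu,j})}$. **Theorem.** Matrices $\Gamma_j$ as above exist. There is a threshold function $\eta^*(\mathcal G,\Gamma,\mu,\beta)$ of one topology and of $\mu,\beta$, depending otherwise only on $n,p$ and the known constants (not on the agents, the leader trajectory, the observer, $m$ or $\sigma$), such that the following holds whenever the gains satisfy $$\beta>\max_j\frac{k_Ck_p^2+\xi}{\underline\gamma_j},\qquad \mu>\max_j\sqrt{\frac{2k_M}{l_j}},\qquad \eta>1,\quad \eta\ge\max_j\eta^*(\mathcal G_{A,j},\Gamma_j,\mu,\beta).$$ Admissible $a_{3,j}$ exist for every $j$; and for every choice of admissible $a_{3,j}$ and every dwell time $\pi_d>0$ with $\pi_d>\log(\kappa)/\Lambda$, leader tracking is achieved exponentially: there is a rate $\alpha>0$ such that for all $\sigma$, agents, leader, $\mathcal G_B$, $\omega_1$, $\omega_2$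 as above and every observer solution on $[0,\infty)$ there is a $K$ such that every closed-loop solution on an interval $[0,T)$, $0<T\le\infty$, with the above initial bounds satisfies, for all $i$ and all $t\in[0,T)$, $$\|q_i(t)-q_0(t)\|_2\le Ke^{-\alpha t},\qquad\|\dot q_i(t)-\dot q_0(t)\|_2\le Ke^{-\alpha t}.$$ In particular, if $T=\infty$, both errors tend to $0$ as $t\to\infty$. -/

import Mathlib

open MeasureTheory Filter Topology

namespace LeaderTracking

noncomputable section

/-! ### Weighted directed graphs with the leader as node `0` -/

/-- A weighted digraph on the nodes `0, 1, …, n` (node `0` is the leader, the nodes `i.succ` are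
the followers), given by its adjacency matrix: `0 < a i j` iff there is an edge from `j` to `i`. -/
structure WDigraph (n : ℕ) where
  a : Fin (n + 1) → Fin (n + 1) → ℝ
  nonneg : ∀ i j, 0 ≤ a i j
  diag : ∀ i, a i i = 0

/-- The graph contains a directed spanning tree rooted at the leader: a choice of one parent for
every other node, joined to it by an edge of the graph, whose iteration leads back to the root. -/
def WDigraph.HasSpanningTree {n : ℕ} (G : WDigraph n) : Prop :=
  ∃ par : Fin (n + 1) → Fin (n + 1),
    (∀ i, i ≠ 0 → 0 < G.a i (par i)) ∧ ∀ i, ∃ k : ℕ, par^[k] i = 0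

/-- There is no edge into the leader. -/
def WDigraph.NoEdgeIntoLeader {n : ℕ} (G : WDigraph n) : Prop := ∀ j, G.a 0 j = 0

/-- The Laplacian `l i i = ∑_{k ≠ i} a i k`, `l i j = - a i j`. -/
def WDigraph.laplacian {n : ℕ} (G : WDigraph n) : Matrix (Fin (n + 1)) (Fin (n + 1)) ℝ :=
  fun i j => if i = j then ∑ k ∈ Finset.univ.erase i, G.a i k else - G.a i j

/-- The block `L₂₂` of the Laplacian that belongs to the followers. -/
def WDigraph.L22 {n : ℕ} (G : WDigraph n) : Matrix (Fin n) (Fin n) ℝ :=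
  G.laplacian.submatrix Fin.succ Fin.succ

/-- `Γ L₂₂ + L₂₂ᵀ Γ` with `Γ = diag γ`. -/
def lyapMatrix {n : ℕ} (G : WDigraph n) (γ : Fin n → ℝ) : Matrix (Fin n) (Fin n) ℝ :=
  Matrix.diagonal γ * G.L22 + G.L22.transpose * Matrix.diagonal γ

/-- `Γ = diag γ` is positive definite, scaled to `max γ = 1`, and `Γ L₂₂ + L₂₂ᵀ Γ > 0`. -/
def IsScaling {n : ℕ} (G : WDigraph n) (γ : Fin n → ℝ) : Prop :=
  (∀ i, 0 < γ i) ∧ (⨆ i, γ i) = 1 ∧ (lyapMatrix G γ).PosDef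

/-- `X = (Γ L₂₂ + L₂₂ᵀ Γ) ⊗ I_p`. -/
def matX {n : ℕ} (p : ℕ) (G : WDigraph n) (γ : Fin n → ℝ) :
    Matrix (Fin n × Fin p) (Fin n × Fin p) ℝ :=
  Matrix.kronecker (lyapMatrix G γ) (1 : Matrix (Fin p) (Fin p) ℝ)

/-- Smallest eigenvalue (of a symmetric real matrix). -/
def lamMin {ι : Type*} [Fintype ι] [DecidableEq ι] (A : Matrix ι ι ℝ) : ℝ := sInf (spectrum ℝ A)

/-- Largest eigenvalue (of a symmetric real matrix). -/
def lamMax {ι : Type*} [Fintype ι] [DecidableEq ι] (A : Matrix ι ι ℝ) : ℝ := sSup (spectrum ℝ A)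

/-! ### Known constants, Euler-Lagrange agents, the leader -/

/-- The constants known to the designer: bounds on the leader (`kp`, `kq`), on the initial
conditions (`ka`, `kb`), on the agents (`km`, `kM`, `kC`, `kg`, `kz`), and the design constant
`δ`. -/
structure Bounds where
  kp : ℝ
  kq : ℝ
  ka : ℝ
  kb : ℝ
  km : ℝ
  kM : ℝ
  kC : ℝ
  kg : ℝ
  kz : ℝ
  δ : ℝ
  kp_pos : 0 < kp
  kq_pos : 0 < kq
  ka_pos : 0 < ka
  kb_pos : 0 < kb
  km_pos : 0 < km
  km_le_kM : km ≤ kM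
  kC_pos : 0 < kC
  kg_pos : 0 < kg
  kz_nonneg : 0 ≤ kz
  δ_pos : 0 < δ
  δ_lt : δ < km

/-- The space of generalised coordinates, with the Euclidean norm. -/
abbrev Coord (p : ℕ) : Type := EuclideanSpace ℝ (Fin p)

/-- The data of `M(q) q'' + C(q, q') q' + g(q) + ζ(t) = τ`. -/
structure Agent (p : ℕ) where
  M : Coord p → (Coord p →L[ℝ] Coord p)
  C : Coord p → Coord p → (Coord p →L[ℝ] Coord p)
  g : Coord p → Coord p
  ζ : ℝ → Coord p

/-- The standing properties of an Euler-Lagrange agent, with the constants of `B`. -/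
structure Agent.IsEulerLagrange {p : ℕ} (A : Agent p) (B : Bounds) : Prop where
  contDiff_M : ContDiff ℝ 1 A.M
  continuous_C : Continuous fun z : Coord p × Coord p => A.C z.1 z.2
  continuous_g : Continuous A.g
  symm_M : ∀ q, IsSelfAdjoint (A.M q)
  lower_M : ∀ q x, B.km * ‖x‖ ^ 2 ≤ inner ℝ (A.M q x) x
  upper_M : ∀ q x, inner ℝ (A.M q x) x ≤ B.kM * ‖x‖ ^ 2
  skew : ∀ q v, fderiv ℝ A.M q v = A.C q v + ContinuousLinearMap.adjoint (A.C q v)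
  bound_C : ∀ q v, ‖A.C q v‖ ≤ B.kC * ‖v‖
  bound_g : ∀ q, ‖A.g q‖ < B.kg
  bound_ζ : ∀ t, 0 ≤ t → ‖A.ζ t‖ ≤ B.kz

/-- The leader trajectory is `C²` with `‖1_n ⊗ q₀'‖₂ ≤ kp` and `‖1_n ⊗ q₀''‖₂ ≤ kq`. -/
def IsLeaderTrajectory {p : ℕ} (n : ℕ) (B : Bounds) (q₀ : ℝ → Coord p) : Prop :=
  ContDiff ℝ 2 q₀ ∧ ∀ t, 0 ≤ t →
    √(n : ℝ) * ‖deriv q₀ t‖ ≤ B.kp ∧ √(n : ℝ) * ‖deriv (deriv q₀) t‖ ≤ B.kq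

/-! ### Filippov solutions -/

/-- Filippov's set-valued map `𝒦[f](x) = ⋂_{δ > 0} ⋂_{|N| = 0} co̅ f(B(x, δ) \ N)`. -/
def filippov {E : Type*} [NormedAddCommGroup E] [NormedSpace ℝ E] [MeasureSpace E]
    (f : E → E) (x : E) : Set E :=
  ⋂ (δ : ℝ) (_ : 0 < δ) (N : Set E) (_ : volume N = 0),
    closure (convexHull ℝ (f '' (Metric.ball x δ \ N)))

/-- `x` is a Filippov solution of `x' = f t x` on `[0, T)`, where `T ≤ ∞`: it is absolutely
continuous on compact subintervals and `x'(t) ∈ 𝒦[f t](x(t))` for almost every `t`. -/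
def IsFilippovSolution {E : Type*} [NormedAddCommGroup E] [NormedSpace ℝ E] [MeasureSpace E]
    (f : ℝ → E → E) (T : EReal) (x : ℝ → E) : Prop :=
  (∀ b : ℝ, 0 ≤ b → (b : EReal) < T → AbsolutelyContinuousOnInterval x 0 b) ∧
    ∀ᵐ t : ℝ, 0 < t → (t : EReal) < T → ∃ y ∈ filippov (f t) (x t), HasDerivAt x y t

/-! ### Observer, controller and switching -/

/-- The states (positions and velocities, or their estimates) of all followers. -/
abbrev NetState (n p : ℕ) : Type := (Fin n → Coord p) × (Fin n → Coord p)

/-- The element-wise signum function. -/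
def sgn {p : ℕ} (x : Coord p) : Coord p := WithLp.toLp 2 fun k => Real.sign (x k)

/-- Prepend the leader to the followers. -/
def withLeader {n p : ℕ} (x₀ : Coord p) (x : Fin n → Coord p) : Fin (n + 1) → Coord p :=
  Fin.cons x₀ x

/-- Right-hand side of the distributed finite-time observer, in the state `(r, v)` of estimates of
the leader's position and velocity, over the communication graph `GB t`. -/
def observerField {n p : ℕ} (GB : ℝ → WDigraph n) (ω₁ ω₂ : ℝ) (q₀ : ℝ → Coord p) (t : ℝ)
    (z : NetState n p) : NetState n p :=
  (fun i => z.2 i - ω₁ • sgn (∑ j, (GB t).a i.succ j • (z.1 i - withLeader (q₀ t) z.1 j)),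
   fun i => -(ω₂ • sgn (∑ j, (GB t).a i.succ j • (z.2 i - withLeader (deriv q₀ t) z.2 j))))

/-- The control input `τ_i` on the sensing graph `G`, when the leader is in the state `(x₀, v₀)`,
the followers in the state `z`, and the estimates are `e`. -/
def controlInput {n p : ℕ} (G : WDigraph n) (μ η β : ℝ) (x₀ v₀ : Coord p)
    (e z : NetState n p) (i : Fin n) : Coord p :=
  -(η • ∑ j, G.a i.succ j •
      ((z.1 i - withLeader x₀ z.1 j) + μ • (z.2 i - withLeader v₀ z.2 j)))
    - β • sgn ((z.1 i - e.1 i) + μ • (z.2 i - e.2 i))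

/-- Right-hand side of the closed loop of the followers, in the state `(q, q')`, with the sensing
graph `G t` at time `t` and the observer output `e`. -/
def networkField {n p : ℕ} (A : Fin n → Agent p) (G : ℝ → WDigraph n) (μ η β : ℝ)
    (q₀ : ℝ → Coord p) (e : ℝ → NetState n p) (t : ℝ) (z : NetState n p) : NetState n p :=
  (z.2, fun i => ((A i).M (z.1 i)).inverse
    (controlInput (G t) μ η β (q₀ t) (deriv q₀ t) (e t) z i
      - (A i).C (z.1 i) (z.2 i) (z.2 i) - (A i).g (z.1 i) - (A i).ζ t))

/-- `σ` is a piecewise constant (right-continuous) switching signal on `[0, ∞)` whose switching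
times, the elements of `S`, are more than `πd` apart. -/
def HasDwellTime {m : ℕ} (σ : ℝ → Fin m) (πd : ℝ) : Prop :=
  ∃ S : Set ℝ, S ⊆ Set.Ioi 0 ∧ (∀ s ∈ S, ∀ t ∈ S, s < t → πd < t - s) ∧
    ∀ a b : ℝ, 0 ≤ a → a ≤ b → (∀ s ∈ S, ¬ (a < s ∧ s ≤ b)) → σ a = σ b

/-! ### Design quantities of one topology

Here `l` and `u` stand for `λ_min(X)` and `λ_max(X)`, `c` for `min γ`, and `ν` for `μ₃*`. -/

/-- The smallest diagonal entry of `Γ`. -/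
def gamMin {n : ℕ} (γ : Fin n → ℝ) : ℝ := ⨅ i, γ i

/-- `ξ = k_g + k_ζ + k_M k_q`. -/
def Bounds.ξ (B : Bounds) : ℝ := B.kg + B.kz + B.kM * B.kq

/-- The matrix `L_μ` of the upper quadratic bound of the Lyapunov function. -/
def matL {n : ℕ} (p : ℕ) (B : Bounds) (G : WDigraph n) (γ : Fin n → ℝ) (μ η : ℝ) :
    Matrix ((Fin n × Fin p) ⊕ (Fin n × Fin p)) ((Fin n × Fin p) ⊕ (Fin n × Fin p)) ℝ :=
  Matrix.fromBlocks
    ((η * lamMax (matX p G γ)) • 1) ((1 / 2 * μ⁻¹ * (B.kM + B.δ)) • 1)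
    ((1 / 2 * μ⁻¹ * (B.kM + B.δ)) • 1) ((1 / 2 * (B.kM + B.δ)) • 1)

/-- The matrix `N_μ` of the lower quadratic bound of the Lyapunov function. -/
def matN {n : ℕ} (p : ℕ) (B : Bounds) (G : WDigraph n) (γ : Fin n → ℝ) (μ η : ℝ) :
    Matrix ((Fin n × Fin p) ⊕ (Fin n × Fin p)) ((Fin n × Fin p) ⊕ (Fin n × Fin p)) ℝ :=
  (1 / 2 : ℝ) • Matrix.fromBlocks
    ((1 / 2 * η * lamMin (matX p G γ)) • 1) ((μ⁻¹ * gamMin γ * (B.km - B.δ)) • 1)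
    ((μ⁻¹ * gamMin γ * (B.km - B.δ)) • 1) ((gamMin γ * (B.km - B.δ)) • 1)

/-- `x ↦ η u x² + ½ (k_M + δ) y² + ν⁻¹ (k_M + δ) x y`, the upper bound of `V̄_ν` for
`‖q̃‖ = x`, `‖q̃'‖ = y`. -/
def upperV (B : Bounds) (u η ν x y : ℝ) : ℝ :=
  η * u * x ^ 2 + 1 / 2 * (B.kM + B.δ) * y ^ 2 + ν⁻¹ * (B.kM + B.δ) * x * y

/-- The Schur complement bound of `N_ν` for the positions, `ρ₂(ν)`. -/
def rhoPos (B : Bounds) (l c η ν : ℝ) : ℝ :=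
  η * (1 / 4) * l - 1 / 2 * (ν ^ 2)⁻¹ * c * (B.km - B.δ)

/-- The Schur complement bound of `N_ν` for the velocities. -/
def rhoVel (B : Bounds) (l c η ν : ℝ) : ℝ :=
  1 / 2 * c * (B.km - B.δ) - (1 / 2 * ν⁻¹ * c * (B.km - B.δ)) ^ 2 / (η * (1 / 4) * l)

/-- `V̂* = upperV (𝒳₁, 𝒴₁)` with `𝒳₁ = √(V̄*/ρ₂)`, `𝒴₁` likewise, and
`V̄* = upperV (k_a, k_b)`. -/
def hatV (B : Bounds) (l u c η ν : ℝ) : ℝ :=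
  upperV B u η ν (√(upperV B u η ν B.ka B.kb / rhoPos B l c η ν))
    (√(upperV B u η ν B.ka B.kb / rhoVel B l c η ν))

/-- The bound `𝒳` on `‖q̃‖₂`. -/
def boxPos (B : Bounds) (l u c η ν : ℝ) : ℝ := √(hatV B l u c η ν / rhoPos B l c η ν)

/-- The bound `𝒴` on `‖q̃'‖₂`. -/
def boxVel (B : Bounds) (l u c η ν : ℝ) : ℝ := √(hatV B l u c η ν / rhoVel B l c η ν)

/-- `φ(μ, η) = ½ μ² η λ_min(X) - μ k_C k_p - k_M`. -/
def phi (B : Bounds) (l μ η : ℝ) : ℝ := 1 / 2 * μ ^ 2 * η * l - μ * B.kC * B.kp - B.kM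

/-- The per-topology gain `β_j`: a lower bound for `β`. -/
def betaBound {n : ℕ} (B : Bounds) (γ : Fin n → ℝ) : ℝ :=
  (B.kC * B.kp ^ 2 + B.ξ) / gamMin γ

/-- The per-topology gain `μ_j`: a lower bound for `μ`. -/
def muBound {n : ℕ} (p : ℕ) (B : Bounds) (G : WDigraph n) (γ : Fin n → ℝ) : ℝ :=
  √(2 * B.kM / lamMin (matX p G γ))

/-- An admissible `μ₃*`: above both thresholds for `L_μ > 0` and `N_μ > 0`, and at most `μ`. -/
def IsMu3 {n : ℕ} (p : ℕ) (B : Bounds) (G : WDigraph n) (γ : Fin n → ℝ) (μ ν : ℝ) : Prop :=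
  √((B.kM + B.δ) / (2 * lamMax (matX p G γ))) < ν ∧
    √(2 * gamMin γ * (B.km - B.δ) / lamMin (matX p G γ)) < ν ∧ ν ≤ μ

/-- `a₃` is a decay constant of one topology: once the observer has converged, the upper bound of
the derivative of the Lyapunov function is at most `-a₃ (‖q̃‖₂² + ‖q̃'‖₂²)` on the region
`‖q̃‖₂ ≤ 𝒳`, `‖q̃'‖₂ ≤ 𝒴`. -/
def IsDecayConstant {n : ℕ} (p : ℕ) (B : Bounds) (G : WDigraph n) (γ : Fin n → ℝ)
    (ν μ η β a₃ : ℝ) : Prop :=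
  0 < a₃ ∧ ∀ x y : EuclideanSpace ℝ (Fin n × Fin p),
    ‖x‖ ≤ boxPos B (lamMin (matX p G γ)) (lamMax (matX p G γ)) (gamMin γ) η ν →
    ‖y‖ ≤ boxVel B (lamMin (matX p G γ)) (lamMax (matX p G γ)) (gamMin γ) η ν →
    -(μ⁻¹ * (phi B (lamMin (matX p G γ)) μ η * ‖y‖ ^ 2
        + 1 / 2 * η * lamMin (matX p G γ) * ‖x‖ ^ 2
        - 2 * B.kC * B.kp * ‖x‖ * ‖y‖ - B.kC * ‖x‖ * ‖y‖ ^ 2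
        + (β * gamMin γ - B.kC * B.kp ^ 2 - B.ξ) * ∑ k, |x k + μ * y k|))
      ≤ -(a₃ * (‖x‖ ^ 2 + ‖y‖ ^ 2))

/-- `κ = max_j λ_max(L_{μ,j}) / min_j λ_min(N_{μ,j})`. -/
def kappa {n m : ℕ} (p : ℕ) (B : Bounds) (G : Fin m → WDigraph n) (γ : Fin m → Fin n → ℝ)
    (μ η : ℝ) : ℝ :=
  (⨆ j, lamMax (matL p B (G j) (γ j) μ η)) / (⨅ j, lamMin (matN p B (G j) (γ j) μ η))

/-- `Λ = min_j a_{3,j} / λ_max(L_{μ,j})`. -/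
def capLam {n m : ℕ} (p : ℕ) (B : Bounds) (G : Fin m → WDigraph n) (γ : Fin m → Fin n → ℝ)
    (μ η : ℝ) (a₃ : Fin m → ℝ) : ℝ :=
  ⨅ j, a₃ j / lamMax (matL p B (G j) (γ j) μ η)

end

end LeaderTracking

/-!
For one topology with scaling `γ`, let `x` and `y` be the stacked tracking errors of positions and
velocities and
`V = ½ η xᵀ X x + ½ ∑ γᵢ ⟪Mᵢ yᵢ, yᵢ⟫ + μ⁻¹ ∑ γᵢ ⟪xᵢ, Mᵢ yᵢ⟫`
(`lyapV`). Because `M' = C + Cᵀ`, the derivative of `V` along a Filippov solution is bounded by the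
expression in the definition of a decay constant, once the observer has reproduced the leader
exactly; before that, the sliding term `β sgn(…)` of the control only contributes a bounded multiple
of `‖x + μ y‖₁` (`lyapDeriv_le`, `exists_hasDerivAt_lyapAlong`).

The observer converges in finite time: the largest coordinate of the estimation error decreases at
a fixed rate, since a spanning tree provides a follower that attains the maximum and has a
neighbour where the error is smaller (`observer_finite_time`).

The threshold for the gain is a high power of a common bound of all parameters of a topology
(`gainScale`). So for the actual gain, `η = Q ^ 102` with `Q` at least as large as all parameters
of all topologies and their inverses (`HighGain`), and every estimate reduces to a comparison of
powers of `Q`. In this regime: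

* All `V` are comparable to `η ‖x‖² + ‖y‖²` up to factors `Q` and `Q³`, whereas `κ` is at least
  `Q ^ 100` (`pow_le_kappa`), so a dwell time above `log κ / Λ` lets a quantity that decays with
  rate `Λ` shrink by the factor `Q ^ 100`.
* A decay constant cannot exceed twice the crude decay rate of `V` (`IsDecayConstant.le_rate`).
  Hence already before the convergence of the observer, and with the bounded residual, `V` decays at
  least with rate `Λ / 4`, that is by the factor `Q ^ 25` during a dwell time.
  This outweighs the loss at a switching time; the errors stay bounded by powers of `Q`,
  independently of how long the observer takes, and after one dwell time they lie in the region to which the decay constants refer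
  (`switched_bound`).
* After that, and after the convergence of the observer, `V` of the active topology decays with rate
  `Λ` between switching times and grows at most by the factor `κ` at each of them
  (`lyapAlong_le_of_sharp`, `lyapAlong_le_kappa_mul`), and the dwell time condition gives
  exponential decay (`switched_decay`).

A dwell time allows at most one switching time in each window of that length
(`HasDwellTime.window`), so the argument runs over windows and needs no enumeration of the switching
times. Scalings exist because `L₂₂` is a nonsingular M-matrix: `γ = (L₂₂⁻ᵀ 1) / (L₂₂⁻¹ 1)`
makes the symmetric matrix `Γ L₂₂ + L₂₂ᵀ Γ` map a positive vector to a positive one, and its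
off-diagonal entries are nonpositive (`exists_isScaling`).
-/

namespace LeaderTracking

/-! ### Absolutely continuous functions and Filippov solutions -/

section AbsolutelyContinuous

variable {X Y : Type*} [PseudoMetricSpace X] [PseudoMetricSpace Y] {a b : ℝ}

theorem absolutelyContinuous_lipschitz_comp {f : ℝ → X} {g : X → Y} {K : NNReal}
    (hg : LipschitzOnWith K g (f '' Set.uIcc a b)) (hf : AbsolutelyContinuousOnInterval f a b) :
    AbsolutelyContinuousOnInterval (fun t => g (f t)) a b := by
  rw [absolutelyContinuousOnInterval_iff] at hf ⊢
  intro ε hε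
  obtain ⟨δ, hδ, h⟩ := hf (ε / (K + 1)) (by positivity)
  refine ⟨δ, hδ, fun E hE hEδ => ?_⟩
  calc ∑ i ∈ Finset.range E.1, dist (g (f (E.2 i).1)) (g (f (E.2 i).2))
      ≤ ∑ i ∈ Finset.range E.1, (K : ℝ) * dist (f (E.2 i).1) (f (E.2 i).2) :=
        Finset.sum_le_sum fun i hi => hg.dist_le_mul _ (Set.mem_image_of_mem _ (hE.1 i hi).1) _
          (Set.mem_image_of_mem _ (hE.1 i hi).2)
    _ = K * ∑ i ∈ Finset.range E.1, dist (f (E.2 i).1) (f (E.2 i).2) := by rw [Finset.mul_sum]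
    _ ≤ K * (ε / (K + 1)) := by gcongr; exact (h E hE hEδ).le
    _ < ε := by
        have hK : (0 : ℝ) ≤ K := K.2
        rw [mul_div_assoc', div_lt_iff₀ (by positivity)]
        nlinarith

theorem absolutelyContinuous_prodMk {f : ℝ → X} {g : ℝ → Y}
    (hf : AbsolutelyContinuousOnInterval f a b) (hg : AbsolutelyContinuousOnInterval g a b) :
    AbsolutelyContinuousOnInterval (fun t => (f t, g t)) a b := by
  rw [absolutelyContinuousOnInterval_iff] at hf hg ⊢
  intro ε hε
  obtain ⟨δ₁, h₁, H₁⟩ := hf (ε / 2) (by positivity)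
  obtain ⟨δ₂, h₂, H₂⟩ := hg (ε / 2) (by positivity)
  refine ⟨min δ₁ δ₂, lt_min h₁ h₂, fun E hE hEδ => ?_⟩
  have := H₁ E hE (hEδ.trans_le (min_le_left _ _))
  have := H₂ E hE (hEδ.trans_le (min_le_right _ _))
  calc ∑ i ∈ Finset.range E.1, dist (f (E.2 i).1, g (E.2 i).1) (f (E.2 i).2, g (E.2 i).2)
      ≤ ∑ i ∈ Finset.range E.1,
          (dist (f (E.2 i).1) (f (E.2 i).2) + dist (g (E.2 i).1) (g (E.2 i).2)) :=
        Finset.sum_le_sum fun i _ => max_le_add_of_nonneg dist_nonneg dist_nonneg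
    _ < ε := by rw [Finset.sum_add_distrib]; linarith

/-- A `C¹` function of time and state, evaluated along an absolutely continuous curve in a finite
dimensional space, is absolutely continuous. -/
theorem absolutelyContinuous_contDiff_comp {E F : Type*} [NormedAddCommGroup E] [NormedSpace ℝ E]
    [FiniteDimensional ℝ E] [NormedAddCommGroup F] [NormedSpace ℝ F] {W : ℝ × E → F}
    (hW : ContDiff ℝ 1 W) {z : ℝ → E} (hz : AbsolutelyContinuousOnInterval z a b) :
    AbsolutelyContinuousOnInterval (fun t => W (t, z t)) a b := by
  have hid : AbsolutelyContinuousOnInterval (fun t : ℝ => t) a b :=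
    (LipschitzWith.id.lipschitzOnWith (s := Set.uIcc a b)).absolutelyContinuousOnInterval
  have hpair := absolutelyContinuous_prodMk hid hz
  have hcomp : IsCompact ((fun t => (t, z t)) '' Set.uIcc a b) :=
    isCompact_uIcc.image_of_continuousOn hpair.continuousOn
  obtain ⟨R, hR⟩ := hcomp.isBounded.subset_closedBall 0
  obtain ⟨K, hK⟩ := hW.contDiffOn.exists_lipschitzOnWith (s := Metric.closedBall 0 R)
    (by decide) (convex_closedBall _ _) (isCompact_closedBall _ _)
  exact absolutelyContinuous_lipschitz_comp (hK.mono hR) hpair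

end AbsolutelyContinuous

/-- An absolutely continuous function whose derivative is almost everywhere nonpositive does not
increase. -/
theorem le_of_ae_hasDerivAt_nonpos {f : ℝ → ℝ} {a b : ℝ} (hab : a ≤ b)
    (hf : AbsolutelyContinuousOnInterval f a b)
    (h : ∀ᵐ t : ℝ, a < t → t < b → ∃ d ≤ 0, HasDerivAt f d t) : f b ≤ f a := by
  have hint := hf.integral_deriv_eq_sub
  have : ∫ t in a..b, deriv f t ≤ 0 := by
    rw [intervalIntegral.integral_of_le hab, integral_Ioc_eq_integral_Ioo]
    refine integral_nonpos_of_ae ((ae_restrict_iff' measurableSet_Ioo).2 ?_)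
    filter_upwards [h] with t ht hmem
    obtain ⟨d, hd, hder⟩ := ht hmem.1 hmem.2
    simpa [hder.deriv] using hd
  linarith

/-- Comparison lemma: `V' ≤ -ρ V + E` almost everywhere. -/
theorem gronwall_of_ae_hasDerivAt {V : ℝ → ℝ} {a b ρ E : ℝ} (hab : a ≤ b) (hρ : 0 < ρ)
    (hV : AbsolutelyContinuousOnInterval V a b)
    (h : ∀ᵐ t : ℝ, a < t → t < b → ∃ d ≤ -ρ * V t + E, HasDerivAt V d t) :
    V b ≤ Real.exp (-(ρ * (b - a))) * (V a - E / ρ) + E / ρ := by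
  have hU : AbsolutelyContinuousOnInterval (fun t => Real.exp (ρ * (t - a)) * (V t - E / ρ)) a b := by
    refine AbsolutelyContinuousOnInterval.mul (f := fun t => Real.exp (ρ * (t - a)))
      (g := fun t => V t - E / ρ) ?_ ?_
    · exact ContDiffOn.absolutelyContinuousOnInterval (ContDiff.contDiffOn (by fun_prop))
    · exact hV.sub (g := fun _ => E / ρ)
        (ContDiffOn.absolutelyContinuousOnInterval (ContDiff.contDiffOn (by fun_prop)))
  have hle := le_of_ae_hasDerivAt_nonpos hab hU (by
    filter_upwards [h] with t ht h1 h2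
    obtain ⟨d, hd, hder⟩ := ht h1 h2
    have hexp : HasDerivAt (fun t => Real.exp (ρ * (t - a))) (Real.exp (ρ * (t - a)) * ρ) t := by
      simpa using (((hasDerivAt_id t).sub_const a).const_mul ρ).exp
    refine ⟨_, ?_, hexp.mul (hder.sub_const (E / ρ))⟩
    have : Real.exp (ρ * (t - a)) * ρ * (V t - E / ρ) + Real.exp (ρ * (t - a)) * d
        = Real.exp (ρ * (t - a)) * (ρ * V t - E + d) := by field_simp
    rw [this]
    exact mul_nonpos_of_nonneg_of_nonpos (Real.exp_pos _).le (by linarith))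
  simp only [sub_self, mul_zero, Real.exp_zero, one_mul] at hle
  have he : Real.exp (-(ρ * (b - a))) * Real.exp (ρ * (b - a)) = 1 := by
    rw [← Real.exp_add]; simp
  have h2 := mul_le_mul_of_nonneg_left hle (Real.exp_pos (-(ρ * (b - a)))).le
  rw [← mul_assoc, he, one_mul] at h2
  linarith

/-- A continuous linear functional that is asymptotically at most `c` on the values of `f` near
`x` is at most `c` on Filippov's set, which is contained in the closed half-space `Φ ≤ c + ε` for
every `ε > 0`. -/
theorem filippov_le {E : Type*} [NormedAddCommGroup E] [NormedSpace ℝ E] [MeasureSpace E]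
    {f : E → E} {x y : E} (hy : y ∈ filippov f x) (Φ : E →L[ℝ] ℝ) {c : ℝ}
    (h : ∀ ε > 0, ∀ᶠ z in 𝓝 x, Φ (f z) ≤ c + ε) : Φ y ≤ c := by
  refine le_of_forall_pos_le_add fun ε hε => ?_
  obtain ⟨δ, hδ, hball⟩ := Metric.eventually_nhds_iff_ball.1 (h ε hε)
  have hy' : y ∈ closure (convexHull ℝ (f '' (Metric.ball x δ \ ∅))) := by
    have := hy
    simp only [filippov, Set.mem_iInter] at this
    exact this δ hδ ∅ measure_empty
  have hclosed : IsClosed {w : E | Φ w ≤ c + ε} := isClosed_le Φ.continuous continuous_const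
  have hconv : Convex ℝ {w : E | Φ w ≤ c + ε} := convex_halfSpace_le Φ.isLinear _
  refine closure_minimal (convexHull_min ?_ hconv) hclosed hy'
  rintro _ ⟨z, hz, rfl⟩
  exact hball z hz.1

theorem filippov_eq {E : Type*} [NormedAddCommGroup E] [NormedSpace ℝ E] [MeasureSpace E]
    {f : E → E} {x y : E} (hy : y ∈ filippov f x) (Φ : E →L[ℝ] ℝ) {c : ℝ}
    (h : Tendsto (fun z => Φ (f z)) (𝓝 x) (𝓝 c)) : Φ y = c := by
  refine le_antisymm (filippov_le hy Φ fun ε hε => ?_) ?_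
  · filter_upwards [h.eventually (gt_mem_nhds (show c < c + ε by linarith))] with z hz using hz.le
  · have := filippov_le (c := -c) hy (-Φ) fun ε hε => by
      filter_upwards [h.eventually (lt_mem_nhds (show c - ε < c by linarith))] with z hz
      simp only [neg_apply]; linarith
    simpa using this

/-! ### Finite-time convergence of the observer -/

/-- Maximum principle on a graph with a spanning tree rooted at the leader: if a node function that
vanishes at the leader is positive somewhere, then some follower attains its maximum and has an
in-neighbour with a strictly smaller value. -/
theorem WDigraph.HasSpanningTree.exists_max_follower {n : ℕ} {G : WDigraph n}
    (hG : G.HasSpanningTree) {h : Fin (n + 1) → ℝ} (h0 : h 0 = 0) {i₀ : Fin (n + 1)}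
    (hi₀ : 0 < h i₀) :
    ∃ i : Fin n, (∀ j, h j ≤ h i.succ) ∧ 0 < ∑ j, G.a i.succ j * (h i.succ - h j) := by
  obtain ⟨par, hpar, hroot⟩ := hG
  obtain ⟨w, -, hw⟩ := Finset.exists_max_image Finset.univ h ⟨0, Finset.mem_univ _⟩
  have hwpos : 0 < h w := hi₀.trans_le (hw i₀ (Finset.mem_univ _))
  by_contra hcon
  push Not at hcon
  have hstep : ∀ i, h i = h w → h (par i) = h w := by
    intro i hi
    have hi0 : i ≠ 0 := by rintro rfl; linarith
    obtain ⟨i', rfl⟩ := Fin.exists_succ_eq.2 hi0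
    have hmax : ∀ j, h j ≤ h i'.succ := fun j => hi ▸ hw j (Finset.mem_univ _)
    have hsum := hcon i' hmax
    have hterm : G.a i'.succ (par i'.succ) * (h i'.succ - h (par i'.succ)) ≤ 0 :=
      (Finset.single_le_sum (f := fun j => G.a i'.succ j * (h i'.succ - h j))
        (fun j _ => mul_nonneg (G.nonneg _ _) (sub_nonneg.2 (hmax j)))
        (Finset.mem_univ (par i'.succ))).trans hsum
    have hp := hpar _ hi0
    have : h i'.succ - h (par i'.succ) ≤ 0 := by
      by_contra hc
      push Not at hc
      exact absurd hterm (not_le.2 (mul_pos hp hc))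
    linarith [hmax (par i'.succ)]
  have hiter : ∀ k : ℕ, h (par^[k] w) = h w := by
    intro k
    induction k with
    | zero => rfl
    | succ k ih => rw [Function.iterate_succ_apply']; exact hstep _ ih
  obtain ⟨k, hk⟩ := hroot w
  have := hiter k
  rw [hk, h0] at this
  linarith

theorem lipschitzWith_sup' {ι : Type*} [Fintype ι] [Nonempty ι] :
    LipschitzWith 1 fun x : ι → ℝ => Finset.univ.sup' Finset.univ_nonempty x := by
  refine LipschitzWith.of_le_add fun x y => ?_
  refine Finset.sup'_le _ _ fun i _ => ?_
  have h1 : x i ≤ y i + dist x y := by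
    have := (abs_le.1 (Real.dist_eq (x i) (y i) ▸ dist_le_pi_dist x y i)).2
    linarith
  exact h1.trans (by gcongr; exact Finset.le_sup' y (Finset.mem_univ i))

/-- If, whenever the maximum of finitely many absolutely continuous functions is positive, one of
the functions that attain it decreases with rate at least `ε`, then all functions are eventually
nonpositive. -/
theorem eventually_nonpos_of_max_decreasing {ι : Type*} [Fintype ι] [Nonempty ι]
    {f : ℝ → ι → ℝ} {a ε : ℝ} (hε : 0 < ε)
    (hf : ∀ b, a ≤ b → AbsolutelyContinuousOnInterval f a b)
    (h : ∀ᵐ t : ℝ, a < t → ∃ d : ι → ℝ, (∀ i, HasDerivAt (fun s => f s i) (d i) t) ∧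
      ((∃ i, 0 < f t i) → ∃ i, (∀ j, f t j ≤ f t i) ∧ d i ≤ -ε)) :
    ∃ T, a ≤ T ∧ ∀ t, T ≤ t → ∀ i, f t i ≤ 0 := by
  set W : ℝ → ℝ := fun t => Finset.univ.sup' Finset.univ_nonempty (f t) with hW
  have hWac : ∀ b, a ≤ b → AbsolutelyContinuousOnInterval W a b := fun b hb =>
    absolutelyContinuous_lipschitz_comp (lipschitzWith_sup'.lipschitzOnWith) (hf b hb)
  have hle : ∀ t i, f t i ≤ W t := fun t i => Finset.le_sup' (f t) (Finset.mem_univ i)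
  -- While `W` is positive, its derivative is that of any of the functions attaining the maximum.
  have hdecr : ∀ a' b, a ≤ a' → a' ≤ b → (∀ t, a' < t → t < b → 0 < W t) →
      W b ≤ W a' - ε * (b - a') := by
    intro a' b ha' hb hpos
    have hsub : AbsolutelyContinuousOnInterval (fun t => W t + ε * (t - a')) a' b := by
      refine ((hWac b (ha'.trans hb)).mono ?_).add (g := fun t => ε * (t - a')) ?_
      · rw [Set.uIcc_of_le hb, Set.uIcc_of_le (ha'.trans hb)]
        exact Set.Icc_subset_Icc_left ha'
      · exact ContDiffOn.absolutelyContinuousOnInterval (ContDiff.contDiffOn (by fun_prop))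
    have := le_of_ae_hasDerivAt_nonpos hb hsub (by
      filter_upwards [h, (hWac b (ha'.trans hb)).ae_differentiableAt] with t ht hdiff h1 h2
      have hWt : DifferentiableAt ℝ W t := hdiff (by
        rw [Set.uIcc_of_le (ha'.trans hb)]; exact ⟨(ha'.trans_lt h1).le, h2.le⟩)
      obtain ⟨d, hd, hmax⟩ := ht (ha'.trans_lt h1)
      obtain ⟨w, -, hw⟩ := Finset.exists_mem_eq_sup' Finset.univ_nonempty (f t)
      obtain ⟨i, hi, hdi⟩ := hmax ⟨w, by rw [← hw]; exact hpos t h1 h2⟩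
      have hWi : W t = f t i :=
        le_antisymm (Finset.sup'_le _ _ fun j _ => hi j) (hle t i)
      have hmin : IsLocalMin (fun s => W s - f s i) t := by
        refine Eventually.of_forall fun s => ?_
        simp only [hWi, sub_self]
        linarith [hle s i]
      have hzero := hmin.hasDerivAt_eq_zero (hWt.hasDerivAt.sub (hd i))
      refine ⟨_, ?_, hWt.hasDerivAt.add (((hasDerivAt_id t).sub_const a').const_mul ε)⟩
      linarith)
    simp only [sub_self, mul_zero, add_zero] at this
    linarith
  -- Decreasing at rate `ε`, `W` cannot stay positive beyond `a + W a / ε`, and it cannot become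
  -- positive again after the last zero before `t`.
  refine ⟨max a (a + W a / ε), le_max_left _ _, fun t ht i => (hle t i).trans ?_⟩
  have hat : a ≤ t := (le_max_left _ _).trans ht
  by_contra hcon
  push Not at hcon
  have hcont : ContinuousOn W (Set.Icc a t) := by
    have := (hWac t hat).continuousOn
    rwa [Set.uIcc_of_le hat] at this
  set s : Set ℝ := Set.Icc a t ∩ W ⁻¹' Set.Iic 0 with hs
  have hscomp : IsCompact s :=
    isCompact_Icc.of_isClosed_subset
      (hcont.preimage_isClosed_of_isClosed isClosed_Icc isClosed_Iic) Set.inter_subset_left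
  rcases s.eq_empty_or_nonempty with hemp | hne
  · have := hdecr a t le_rfl hat fun r h1 h2 => by
      by_contra hc
      exact (Set.eq_empty_iff_forall_notMem.1 hemp r) ⟨⟨h1.le, h2.le⟩, not_lt.1 hc⟩
    have h3 : a + W a / ε ≤ t := (le_max_right _ _).trans ht
    have h4 : W a ≤ ε * (t - a) := by
      rw [← div_le_iff₀' hε]; linarith
    linarith
  · obtain ⟨r, hr, hrmax⟩ := hscomp.exists_isGreatest hne
    have := hdecr r t hr.1.1 hr.1.2 fun q h1 h2 => by
      by_contra hc
      exact absurd (hrmax ⟨⟨hr.1.1.trans h1.le, h2.le⟩, not_lt.1 hc⟩) (not_le.2 h1)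
    have h5 : W r ≤ 0 := hr.2
    have h6 := mul_nonneg hε.le (sub_nonneg.2 hr.1.2)
    linarith

@[simp] theorem withLeader_zero {n p : ℕ} (x₀ : Coord p) (x : Fin n → Coord p) :
    withLeader x₀ x 0 = x₀ := rfl

@[simp] theorem withLeader_succ {n p : ℕ} (x₀ : Coord p) (x : Fin n → Coord p) (i : Fin n) :
    withLeader x₀ x i.succ = x i := rfl

theorem continuous_withLeader {n p : ℕ} (x₀ : Coord p) (j : Fin (n + 1)) :
    Continuous fun x : Fin n → Coord p => withLeader x₀ x j := by
  induction j using Fin.cases with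
  | zero => simpa using continuous_const
  | succ i => simpa using continuous_apply i

theorem mul_sign_of_pos {s w : ℝ} (hs : s = 1 ∨ s = -1) (h : 0 < s * w) : s * Real.sign w = 1 := by
  rcases hs with rfl | rfl
  · rw [Real.sign_of_pos (by linarith)]; norm_num
  · rw [Real.sign_of_neg (by linarith)]; norm_num

/-- One stage of the observer. The functions `x i - x₀` of the followers are driven by the signum
of their neighbourhood disagreement with gain `ω`, and by a drift bounded by `c < ω`; then they
vanish after finite time. -/
theorem consensus_finite_time {n p : ℕ} (hn : 0 < n) {GB : ℝ → WDigraph n}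
    (hGB : ∀ t, 0 ≤ t → (GB t).HasSpanningTree) {x : ℝ → Fin n → Coord p} {x₀ x₀' : ℝ → Coord p}
    {a ω c : ℝ} (ha : 0 ≤ a) (hω : c < ω)
    (hx : ∀ b, a ≤ b → AbsolutelyContinuousOnInterval x a b)
    (hx₀ : ContDiff ℝ 1 x₀) (hx₀' : ∀ t, HasDerivAt x₀ (x₀' t) t)
    (h : ∀ᵐ t : ℝ, a < t → ∃ d : Fin n → Coord p, HasDerivAt x d t ∧
      ∀ (s : ℝ) (i : Fin n) (k : Fin p), s = 1 ∨ s = -1 →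
        0 < s * (∑ j, (GB t).a i.succ j • (x t i - withLeader (x₀ t) (x t) j)) k →
        s * (d i k - x₀' t k) ≤ c - ω) :
    ∃ T, a ≤ T ∧ ∀ t, T ≤ t → ∀ i, x t i = x₀ t := by
  have : Nonempty (Fin n) := ⟨⟨0, hn⟩⟩
  -- one coordinate and one sign at a time: the largest value of `s (x i k - x₀ k)` decreases
  have key : ∀ (s : ℝ) (k : Fin p), s = 1 ∨ s = -1 →
      ∃ T, a ≤ T ∧ ∀ t, T ≤ t → ∀ i, s * (x t i k - x₀ t k) ≤ 0 := by
    intro s k hs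
    refine eventually_nonpos_of_max_decreasing (f := fun t i => s * (x t i k - x₀ t k))
      (sub_pos.2 hω) (fun b hb => ?_) ?_
    · refine absolutelyContinuous_contDiff_comp
        (W := fun q : ℝ × (Fin n → Coord p) => fun i => s * (q.2 i k - x₀ q.1 k)) ?_ (hx b hb)
      rw [contDiff_pi]
      intro i
      have h0 : ContDiff ℝ 1 fun t => x₀ t k := (contDiff_euclidean.1 hx₀) k
      have h1 : ContDiff ℝ 1 fun q : ℝ × (Fin n → Coord p) => q.2 i k :=
        (contDiff_euclidean.1 ((contDiff_pi.1 (contDiff_snd (𝕜 := ℝ) (E := ℝ)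
          (F := Fin n → Coord p) (n := 1))) i)) k
      exact contDiff_const.mul (h1.sub (h0.comp contDiff_fst))
    · filter_upwards [h] with t ht hat
      obtain ⟨d, hd, hsgn⟩ := ht hat
      refine ⟨fun i => s * (d i k - x₀' t k), fun i => ?_, ?_⟩
      · have h1 : HasDerivAt (fun t => x t i k) (d i k) t :=
          (EuclideanSpace.proj (𝕜 := ℝ) k).hasFDerivAt.comp_hasDerivAt t ((hasDerivAt_pi.1 hd) i)
        have h0 : HasDerivAt (fun t => x₀ t k) (x₀' t k) t :=
          (EuclideanSpace.proj (𝕜 := ℝ) k).hasFDerivAt.comp_hasDerivAt t (hx₀' t)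
        exact (h1.sub h0).const_mul s
      · rintro ⟨i₀, hi₀⟩
        obtain ⟨i, hmax, hpos⟩ := (hGB t (ha.trans hat.le)).exists_max_follower
          (h := fun j => s * (withLeader (x₀ t) (x t) j k - x₀ t k)) (by simp)
          (i₀ := i₀.succ) (by simpa using hi₀)
        refine ⟨i, fun j => by simpa using hmax j.succ, ?_⟩
        have := hsgn s i k hs (by
          refine hpos.trans_eq ?_
          simp only [withLeader_succ, WithLp.ofLp_sum, Finset.sum_apply, PiLp.smul_apply,
            PiLp.sub_apply, smul_eq_mul, Finset.mul_sum]
          exact Finset.sum_congr rfl fun j _ => by ring)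
        linarith
  have key2 : ∀ k : Fin p, ∃ T, a ≤ T ∧ ∀ t, T ≤ t → ∀ i, x t i k = x₀ t k := by
    intro k
    obtain ⟨T₁, h₁, H₁⟩ := key 1 k (Or.inl rfl)
    obtain ⟨T₂, h₂, H₂⟩ := key (-1) k (Or.inr rfl)
    refine ⟨max T₁ T₂, h₁.trans (le_max_left _ _), fun t ht i => ?_⟩
    have := H₁ t ((le_max_left _ _).trans ht) i
    have := H₂ t ((le_max_right _ _).trans ht) i
    linarith
  choose T hT1 hT2 using key2
  refine ⟨a + ∑ k, (T k - a), ?_, fun t ht i => ?_⟩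
  · have := Finset.sum_nonneg fun k (_ : k ∈ Finset.univ) => sub_nonneg.2 (hT1 k)
    linarith
  · ext k
    refine hT2 k t ?_ i
    have := Finset.single_le_sum (f := fun k => T k - a) (fun k _ => sub_nonneg.2 (hT1 k))
      (Finset.mem_univ k)
    linarith

/-- Coordinate `k` of the velocity of agent `i`. -/
noncomputable def velCoord {n p : ℕ} (i : Fin n) (k : Fin p) : NetState n p →L[ℝ] ℝ :=
  (EuclideanSpace.proj k).comp ((ContinuousLinearMap.proj i).comp
    (ContinuousLinearMap.snd ℝ (Fin n → Coord p) (Fin n → Coord p)))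

/-- Coordinate `k` of the position of agent `i`. -/
noncomputable def posCoord {n p : ℕ} (i : Fin n) (k : Fin p) : NetState n p →L[ℝ] ℝ :=
  (EuclideanSpace.proj k).comp ((ContinuousLinearMap.proj i).comp
    (ContinuousLinearMap.fst ℝ (Fin n → Coord p) (Fin n → Coord p)))

@[simp] theorem velCoord_apply {n p : ℕ} (i : Fin n) (k : Fin p) (z : NetState n p) :
    velCoord i k z = z.2 i k := rfl

@[simp] theorem posCoord_apply {n p : ℕ} (i : Fin n) (k : Fin p) (z : NetState n p) :
    posCoord i k z = z.1 i k := rfl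

theorem continuous_disagreement {n p : ℕ} (G : WDigraph n) (x₀ : Coord p) (i : Fin n) (k : Fin p) :
    Continuous fun x : Fin n → Coord p => (∑ j, G.a i.succ j • (x i - withLeader x₀ x j)) k := by
  have : Continuous fun x : Fin n → Coord p => ∑ j, G.a i.succ j • (x i - withLeader x₀ x j) :=
    continuous_finsetSum _ fun j _ => by
      have := continuous_withLeader (n := n) x₀ j
      fun_prop
  exact (EuclideanSpace.proj (𝕜 := ℝ) k).continuous.comp this

/-- The observer reconstructs the leader trajectory exactly after finite time: first the velocities
converge, and from then on the positions obey the same kind of dynamics without drift. Where the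
disagreement in a coordinate is nonzero, the signum of that coordinate is locally constant, so
Filippov's set has the value of the vector field there. -/
theorem observer_finite_time {n p : ℕ} (hn : 0 < n) {B : Bounds} {q₀ : ℝ → Coord p}
    (hq₀ : IsLeaderTrajectory n B q₀) {GB : ℝ → WDigraph n}
    (hGB : ∀ t, 0 ≤ t → (GB t).HasSpanningTree) {ω₁ ω₂ : ℝ} (hω₁ : 0 < ω₁)
    (hω₂ : B.kq / √(n : ℝ) < ω₂) {e : ℝ → NetState n p}
    (he : IsFilippovSolution (observerField GB ω₁ ω₂ q₀) ⊤ e) :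
    ∃ T, 0 ≤ T ∧ ∀ t, T ≤ t → ∀ i, (e t).1 i = q₀ t ∧ (e t).2 i = deriv q₀ t := by
  have hsq : 0 < √(n : ℝ) := Real.sqrt_pos.2 (by exact_mod_cast hn)
  obtain ⟨hac, hae⟩ := he
  have hcd : ContDiff ℝ 1 (deriv q₀) :=
    ((contDiff_succ_iff_deriv (n := 1)).1 (by simpa [one_add_one_eq_two] using hq₀.1)).2.2
  have hq1 : ContDiff ℝ 1 q₀ := hq₀.1.of_le (by norm_num)
  have hac' : ∀ a b, 0 ≤ a → a ≤ b → AbsolutelyContinuousOnInterval e a b := fun a b ha hb =>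
    (hac b (ha.trans hb) (EReal.coe_lt_top b)).mono (by
      rw [Set.uIcc_of_le hb, Set.uIcc_of_le (ha.trans hb)]; exact Set.Icc_subset_Icc_left ha)
  obtain ⟨T₁, hT₁, hv⟩ := consensus_finite_time hn hGB (x := fun t => (e t).2) (a := 0) le_rfl hω₂
    (fun b hb => absolutelyContinuous_lipschitz_comp LipschitzWith.prod_snd.lipschitzOnWith
      (hac' 0 b le_rfl hb)) hcd
    (fun t => ((hcd.differentiable (by norm_num)) t).hasDerivAt) (by
      filter_upwards [hae] with t ht h0
      obtain ⟨y, hy, hder⟩ := ht h0 (EReal.coe_lt_top t)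
      refine ⟨y.2, hder.snd, fun s i k hs hpos => ?_⟩
      have hΦ : (s • velCoord i k) y = -ω₂ := by
        refine filippov_eq hy _ (tendsto_const_nhds.congr' ?_)
        have hcont : Continuous fun z : NetState n p => s *
            (∑ j, (GB t).a i.succ j • (z.2 i - withLeader (deriv q₀ t) z.2 j)) k :=
          continuous_const.mul ((continuous_disagreement (GB t) _ i k).comp continuous_snd)
        filter_upwards [hcont.continuousAt.eventually (lt_mem_nhds hpos)] with z hz
        have := mul_sign_of_pos hs hz
        simp only [observerField, sgn, smul_apply, velCoord_apply, smul_eq_mul,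
          PiLp.neg_apply, PiLp.smul_apply]
        linear_combination ω₂ * this
      have hbd : |deriv (deriv q₀) t k| ≤ B.kq / √(n : ℝ) := by
        rw [le_div_iff₀' hsq]
        refine le_trans ?_ (hq₀.2 t h0.le).2
        gcongr
        exact PiLp.norm_apply_le (deriv (deriv q₀) t) k
      have hΦ' : s * y.2 i k = -ω₂ := by simpa using hΦ
      have := abs_le.1 hbd
      rcases hs with rfl | rfl <;> linarith [this.1, this.2])
  obtain ⟨T₂, hT₂, hr⟩ := consensus_finite_time hn hGB (x := fun t => (e t).1) (a := T₁) hT₁ hω₁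
    (fun b hb => absolutelyContinuous_lipschitz_comp LipschitzWith.prod_fst.lipschitzOnWith
      (hac' T₁ b hT₁ hb)) hq1
    (fun t => ((hq1.differentiable (by norm_num)) t).hasDerivAt) (by
      filter_upwards [hae] with t ht h0
      obtain ⟨y, hy, hder⟩ := ht (hT₁.trans_lt h0) (EReal.coe_lt_top t)
      refine ⟨y.1, hder.fst, fun s i k hs hpos => ?_⟩
      have hΦ : (s • posCoord i k) y = s * deriv q₀ t k - ω₁ := by
        refine filippov_eq hy _ ?_
        have hlim : Tendsto (fun z : NetState n p => s * z.2 i k - ω₁) (𝓝 (e t))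
            (𝓝 (s * deriv q₀ t k - ω₁)) := by
          rw [← hv t h0.le i]
          exact ((velCoord i k).continuous.tendsto (e t) |>.const_mul s).sub_const _
        refine hlim.congr' ?_
        have hcont : Continuous fun z : NetState n p => s *
            (∑ j, (GB t).a i.succ j • (z.1 i - withLeader (q₀ t) z.1 j)) k :=
          continuous_const.mul ((continuous_disagreement (GB t) _ i k).comp continuous_fst)
        filter_upwards [hcont.continuousAt.eventually (lt_mem_nhds hpos)] with z hz
        have := mul_sign_of_pos hs hz
        simp only [observerField, sgn, smul_apply, posCoord_apply, smul_eq_mul,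
          PiLp.sub_apply, PiLp.smul_apply]
        linear_combination ω₁ * this
      have hΦ' : s * y.1 i k = s * deriv q₀ t k - ω₁ := by simpa using hΦ
      rw [mul_sub, hΦ']
      linarith)
  exact ⟨T₂, hT₁.trans hT₂, fun t ht i => ⟨hr t ht i, hv t (hT₂.trans ht) i⟩⟩

/-! ### Extreme eigenvalues of symmetric matrices -/

section Eigenvalues

open Matrix

variable {ι : Type*} [Fintype ι] [DecidableEq ι] {A : Matrix ι ι ℝ}

theorem spectrum_bddBelow (A : Matrix ι ι ℝ) : BddBelow (spectrum ℝ A) :=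
  A.finite_spectrum.bddBelow

theorem spectrum_bddAbove (A : Matrix ι ι ℝ) : BddAbove (spectrum ℝ A) :=
  A.finite_spectrum.bddAbove

theorem spectrum_nonempty_of_isHermitian [Nonempty ι] (hA : A.IsHermitian) :
    (spectrum ℝ A).Nonempty := by
  rw [hA.spectrum_real_eq_range_eigenvalues]
  exact Set.range_nonempty _

theorem posSemidef_sub_algebraMap_iff (hA : A.IsHermitian) (c : ℝ) :
    (∀ x, c * (x ⬝ᵥ x) ≤ x ⬝ᵥ A *ᵥ x) ↔ ∀ r ∈ spectrum ℝ A, c ≤ r := by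
  have hH : (A - algebraMap ℝ (Matrix ι ι ℝ) c).IsHermitian := by
    refine hA.sub ?_
    rw [Algebra.algebraMap_eq_smul_one]
    exact IsHermitian.smul isHermitian_one (IsSelfAdjoint.all c)
  have h1 : (∀ x, c * (x ⬝ᵥ x) ≤ x ⬝ᵥ A *ᵥ x) ↔
      (A - algebraMap ℝ (Matrix ι ι ℝ) c).PosSemidef := by
    rw [posSemidef_iff_dotProduct_mulVec, and_iff_right hH]
    simp only [star_trivial, sub_mulVec, dotProduct_sub, Algebra.algebraMap_eq_smul_one,
      smul_mulVec, one_mulVec, dotProduct_smul, smul_eq_mul, sub_nonneg]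
  rw [h1, posSemidef_iff_isHermitian_and_spectrum_nonneg, ← spectrum.sub_singleton_eq]
  simp only [hH, true_and, Set.sub_singleton, Set.image_subset_iff]
  refine forall₂_congr fun r _ => ?_
  simp

theorem lamMin_mul_le (hA : A.IsHermitian) (x : ι → ℝ) : lamMin A * (x ⬝ᵥ x) ≤ x ⬝ᵥ A *ᵥ x :=
  (posSemidef_sub_algebraMap_iff hA _).2 (fun _ hr => csInf_le (spectrum_bddBelow A) hr) x

theorem le_lamMin [Nonempty ι] (hA : A.IsHermitian) {c : ℝ}
    (h : ∀ x, c * (x ⬝ᵥ x) ≤ x ⬝ᵥ A *ᵥ x) : c ≤ lamMin A :=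
  le_csInf (spectrum_nonempty_of_isHermitian hA) ((posSemidef_sub_algebraMap_iff hA c).1 h)

theorem lamMax_eq_neg_lamMin_neg (A : Matrix ι ι ℝ) : lamMax A = -lamMin (-A) := by
  rw [lamMax, lamMin, ← spectrum.neg_eq, Real.sInf_neg, neg_neg]

theorem le_lamMax_mul (hA : A.IsHermitian) (x : ι → ℝ) : x ⬝ᵥ A *ᵥ x ≤ lamMax A * (x ⬝ᵥ x) := by
  have := lamMin_mul_le hA.neg x
  rw [neg_mulVec, dotProduct_neg] at this
  rw [lamMax_eq_neg_lamMin_neg]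
  linarith

theorem lamMax_le [Nonempty ι] (hA : A.IsHermitian) {c : ℝ}
    (h : ∀ x, x ⬝ᵥ A *ᵥ x ≤ c * (x ⬝ᵥ x)) : lamMax A ≤ c := by
  rw [lamMax_eq_neg_lamMin_neg]
  have := le_lamMin (c := -c) hA.neg fun x => by
    rw [neg_mulVec, dotProduct_neg]; linarith [h x]
  linarith

theorem lamMin_pos [Nonempty ι] (hA : A.PosDef) : 0 < lamMin A := by
  have hmem : lamMin A ∈ spectrum ℝ A :=
    (spectrum_nonempty_of_isHermitian hA.isHermitian).csInf_mem A.finite_spectrum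
  rw [hA.isHermitian.spectrum_real_eq_range_eigenvalues] at hmem
  obtain ⟨i, hi⟩ := hmem
  rw [← hi]
  exact hA.eigenvalues_pos i

theorem lamMin_le_lamMax [Nonempty ι] (hA : A.IsHermitian) : lamMin A ≤ lamMax A :=
  csInf_le_csSup (spectrum_nonempty_of_isHermitian hA) (spectrum_bddBelow A) (spectrum_bddAbove A)

/-- The `2 × 2` block matrix whose blocks are multiples of the identity. -/
def scalarBlocks (ι : Type*) [DecidableEq ι] (a b d : ℝ) : Matrix (ι ⊕ ι) (ι ⊕ ι) ℝ :=
  fromBlocks (a • 1) (b • 1) (b • 1) (d • 1)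

variable {a b d : ℝ}

theorem scalarBlocks_isHermitian {ι : Type*} [DecidableEq ι] {a b d : ℝ} :
    (scalarBlocks ι a b d).IsHermitian := by
  have h : ∀ c : ℝ, (c • (1 : Matrix ι ι ℝ)).IsHermitian := fun c =>
    IsHermitian.smul isHermitian_one (IsSelfAdjoint.all c)
  exact IsHermitian.fromBlocks (h a) (h b) (h d)

theorem dotProduct_scalarBlocks (x y : ι → ℝ) :
    Sum.elim x y ⬝ᵥ scalarBlocks ι a b d *ᵥ Sum.elim x y
      = a * (x ⬝ᵥ x) + 2 * b * (x ⬝ᵥ y) + d * (y ⬝ᵥ y) := by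
  simp only [scalarBlocks, fromBlocks_mulVec, Sum.elim_comp_inl, Sum.elim_comp_inr, smul_mulVec,
    one_mulVec, sumElim_dotProduct_sumElim, dotProduct_add, dotProduct_smul, smul_eq_mul,
    dotProduct_comm y x]
  ring

theorem scalarBlocks_le_lamMax (x y : ι → ℝ) :
    a * (x ⬝ᵥ x) + 2 * b * (x ⬝ᵥ y) + d * (y ⬝ᵥ y)
      ≤ lamMax (scalarBlocks ι a b d) * (x ⬝ᵥ x + y ⬝ᵥ y) := by
  rw [← dotProduct_scalarBlocks, ← sumElim_dotProduct_sumElim]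
  exact le_lamMax_mul scalarBlocks_isHermitian _

theorem lamMin_le_scalarBlocks (x y : ι → ℝ) :
    lamMin (scalarBlocks ι a b d) * (x ⬝ᵥ x + y ⬝ᵥ y)
      ≤ a * (x ⬝ᵥ x) + 2 * b * (x ⬝ᵥ y) + d * (y ⬝ᵥ y) := by
  rw [← dotProduct_scalarBlocks, ← sumElim_dotProduct_sumElim]
  exact lamMin_mul_le scalarBlocks_isHermitian _

theorem le_lamMax_scalarBlocks [Nonempty ι] : a ≤ lamMax (scalarBlocks ι a b d) := by
  obtain ⟨i⟩ := ‹Nonempty ι›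
  simpa using scalarBlocks_le_lamMax (a := a) (b := b) (d := d) (Pi.single i 1) (0 : ι → ℝ)

theorem lamMin_scalarBlocks_le [Nonempty ι] : lamMin (scalarBlocks ι a b d) ≤ d := by
  obtain ⟨i⟩ := ‹Nonempty ι›
  simpa using lamMin_le_scalarBlocks (a := a) (b := b) (d := d) (0 : ι → ℝ) (Pi.single i 1)

theorem dotProduct_self_nonneg_real {ι : Type*} [Fintype ι] (x : ι → ℝ) : 0 ≤ x ⬝ᵥ x :=
  Finset.sum_nonneg fun _ _ => mul_self_nonneg _

theorem lamMax_scalarBlocks_le [Nonempty ι] (ha : 0 ≤ a) (hb : 0 ≤ b) (hd : 0 ≤ d) :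
    lamMax (scalarBlocks ι a b d) ≤ a + b + d := by
  refine lamMax_le scalarBlocks_isHermitian fun z => ?_
  obtain ⟨x, y, rfl⟩ : ∃ x y, z = Sum.elim x y := ⟨z ∘ Sum.inl, z ∘ Sum.inr, by simp⟩
  rw [dotProduct_scalarBlocks, sumElim_dotProduct_sumElim]
  have hx := dotProduct_self_nonneg_real x
  have hy := dotProduct_self_nonneg_real y
  have hxy : 2 * (x ⬝ᵥ y) ≤ x ⬝ᵥ x + y ⬝ᵥ y := by
    have := dotProduct_self_nonneg_real (x - y)
    simp only [sub_dotProduct, dotProduct_sub, dotProduct_comm y x] at this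
    linarith
  nlinarith [mul_nonneg ha hy, mul_nonneg hd hx, mul_le_mul_of_nonneg_left hxy hb]

theorem lamMin_scalarBlocks_pos [Nonempty ι] (ha : 0 < a) (hdet : b ^ 2 < a * d) :
    0 < lamMin (scalarBlocks ι a b d) := by
  refine lamMin_pos (PosDef.of_dotProduct_mulVec_pos scalarBlocks_isHermitian fun z hz => ?_)
  obtain ⟨x, y, rfl⟩ : ∃ x y, z = Sum.elim x y := ⟨z ∘ Sum.inl, z ∘ Sum.inr, by simp⟩
  rw [star_trivial, dotProduct_scalarBlocks]
  refine pos_of_mul_pos_right (a := a) ?_ ha.le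
  have hsq : a * (a * (x ⬝ᵥ x) + 2 * b * (x ⬝ᵥ y) + d * (y ⬝ᵥ y))
      = (a • x + b • y) ⬝ᵥ (a • x + b • y) + (a * d - b ^ 2) * (y ⬝ᵥ y) := by
    simp only [add_dotProduct, dotProduct_add, smul_dotProduct, dotProduct_smul, smul_eq_mul,
      dotProduct_comm y x]
    ring
  rw [hsq]
  have h1 := dotProduct_self_nonneg_real (a • x + b • y)
  rcases (dotProduct_self_nonneg_real y).lt_or_eq with hy | hy
  · have := mul_pos (sub_pos.2 hdet) hy
    linarith
  · have hy0 : y = 0 := dotProduct_self_eq_zero.1 hy.symm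
    have hx0 : x ≠ 0 := by rintro rfl; exact hz (by rw [hy0]; ext i; cases i <;> rfl)
    have hx : 0 < x ⬝ᵥ x :=
      lt_of_le_of_ne (dotProduct_self_nonneg_real x) fun h => hx0 (dotProduct_self_eq_zero.1 h.symm)
    simp only [hy0, smul_zero, add_zero, dotProduct_zero, mul_zero, smul_dotProduct,
      dotProduct_smul, smul_eq_mul]
    positivity

theorem matL_eq {n : ℕ} (p : ℕ) (B : Bounds) (G : WDigraph n) (γ : Fin n → ℝ) (μ η : ℝ) :
    matL p B G γ μ η = scalarBlocks (Fin n × Fin p) (η * lamMax (matX p G γ))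
      (1 / 2 * μ⁻¹ * (B.kM + B.δ)) (1 / 2 * (B.kM + B.δ)) := rfl

theorem matN_eq {n : ℕ} (p : ℕ) (B : Bounds) (G : WDigraph n) (γ : Fin n → ℝ) (μ η : ℝ) :
    matN p B G γ μ η = scalarBlocks (Fin n × Fin p) (1 / 2 * (1 / 2 * η * lamMin (matX p G γ)))
      (1 / 2 * (μ⁻¹ * gamMin γ * (B.km - B.δ))) (1 / 2 * (gamMin γ * (B.km - B.δ))) := by
  simp only [matN, scalarBlocks, fromBlocks_smul, smul_smul]

end Eigenvalues

/-! ### The follower block of the Laplacian and its diagonal scalings -/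

section Laplacian

open Matrix

variable {n : ℕ} {G : WDigraph n}

theorem WDigraph.L22_apply (G : WDigraph n) (i j : Fin n) :
    G.L22 i j = (if i = j then ∑ k, G.a i.succ k else 0) - G.a i.succ j.succ := by
  by_cases h : i = j
  · subst h
    have := Finset.add_sum_erase Finset.univ (fun k => G.a i.succ k) (Finset.mem_univ i.succ)
    simp only [G.diag, zero_add] at this
    simp [WDigraph.L22, WDigraph.laplacian, G.diag, this]
  · simp [WDigraph.L22, WDigraph.laplacian, h]

/-- The follower block acts as the disagreement with the neighbours, the leader being at `0`. -/
theorem WDigraph.sum_L22_smul {E : Type*} [AddCommGroup E] [Module ℝ E] (G : WDigraph n)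
    (x : Fin n → E) (i : Fin n) :
    ∑ j, G.L22 i j • x j
      = ∑ j, G.a i.succ j • (x i - (Fin.cons 0 x : Fin (n + 1) → E) j) := by
  simp only [G.L22_apply, sub_smul, ite_smul, zero_smul, Finset.sum_sub_distrib,
    Finset.sum_ite_eq, Finset.mem_univ, if_true, smul_sub, ← Finset.sum_smul]
  congr 1
  rw [Fin.sum_univ_succ]
  simp

/-- `L₂₂` is inverse-nonnegative: a vector with a negative entry, extended by `0` at the leader,
has its minimum at some follower with a larger in-neighbour, where `L₂₂ x` is negative. -/
theorem WDigraph.HasSpanningTree.nonneg_of_L22_mulVec_nonneg (hG : G.HasSpanningTree)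
    {x : Fin n → ℝ} (hx : ∀ i, 0 ≤ (G.L22 *ᵥ x) i) (i : Fin n) : 0 ≤ x i := by
  by_contra hneg
  push Not at hneg
  obtain ⟨j, -, hj⟩ := hG.exists_max_follower (h := fun k => -(Fin.cons 0 x : Fin (n + 1) → ℝ) k)
    (by simp) (i₀ := i.succ) (by simpa using hneg)
  have h1 := hx j
  have h2 : (G.L22 *ᵥ x) j = ∑ k, G.L22 j k • x k := rfl
  rw [h2, G.sum_L22_smul] at h1
  have h3 : ∑ k, G.a j.succ k * (-(Fin.cons 0 x : Fin (n + 1) → ℝ) j.succ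
      - -(Fin.cons 0 x : Fin (n + 1) → ℝ) k)
      = -∑ k, G.a j.succ k • (x j - (Fin.cons 0 x : Fin (n + 1) → ℝ) k) := by
    rw [← Finset.sum_neg_distrib]
    exact Finset.sum_congr rfl fun k _ => by simp only [Fin.cons_succ, smul_eq_mul]; ring
  linarith

theorem WDigraph.HasSpanningTree.isUnit_L22 (hG : G.HasSpanningTree) : IsUnit G.L22 := by
  rw [← mulVec_injective_iff_isUnit]
  refine (injective_iff_map_eq_zero (Matrix.mulVecLin G.L22)).2 ?_
  intro x hx
  have hx' : G.L22 *ᵥ x = 0 := hx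
  ext i
  refine le_antisymm ?_ (hG.nonneg_of_L22_mulVec_nonneg (x := x) (fun i => by simp [hx']) i)
  have := hG.nonneg_of_L22_mulVec_nonneg (x := -x) (fun i => by simp [mulVec_neg, hx']) i
  simpa using this

theorem WDigraph.HasSpanningTree.inv_L22_nonneg (hG : G.HasSpanningTree) (i j : Fin n) :
    0 ≤ G.L22⁻¹ i j := by
  have hdet := (isUnit_iff_isUnit_det _).1 hG.isUnit_L22
  have := hG.nonneg_of_L22_mulVec_nonneg (x := G.L22⁻¹ *ᵥ Pi.single j 1) (fun k => by
    rw [mulVec_mulVec, mul_nonsing_inv _ hdet, one_mulVec]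
    by_cases h : k = j
    · subst h; simp
    · simp [h]) i
  simpa using this

theorem WDigraph.L22_offDiag_nonpos (G : WDigraph n) {i j : Fin n} (h : i ≠ j) :
    G.L22 i j ≤ 0 := by
  rw [G.L22_apply, if_neg h]
  linarith [G.nonneg i.succ j.succ]

/-- A nonnegative vector that a matrix with nonpositive off-diagonal entries maps to a positive
vector is positive. -/
theorem pos_of_offDiag_nonpos {S : Matrix (Fin n) (Fin n) ℝ} (hS : ∀ i j, i ≠ j → S i j ≤ 0)
    {x : Fin n → ℝ} (hx : ∀ i, 0 ≤ x i) (hSx : ∀ i, 0 < (S *ᵥ x) i) (i : Fin n) : 0 < x i := by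
  refine lt_of_le_of_ne (hx i) fun h => ?_
  have : ∑ j, S i j * x j ≤ 0 := Finset.sum_nonpos fun j _ => by
    by_cases hij : i = j
    · subst hij; rw [← h, mul_zero]
    · exact mul_nonpos_of_nonpos_of_nonneg (hS i j hij) (hx j)
  exact absurd (hSx i) (not_lt.2 this)

/-- A symmetric matrix with nonpositive off-diagonal entries that maps some positive vector to a
positive vector is positive definite. -/
theorem posDef_of_offDiag_nonpos {S : Matrix (Fin n) (Fin n) ℝ} (hsymm : S.IsSymm)
    (hS : ∀ i j, i ≠ j → S i j ≤ 0) {x : Fin n → ℝ} (hx : ∀ i, 0 < x i)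
    (hSx : ∀ i, 0 < (S *ᵥ x) i) : S.PosDef := by
  have hherm : S.IsHermitian := by
    rw [IsHermitian, conjTranspose_eq_transpose_of_trivial]
    exact hsymm
  refine PosDef.of_dotProduct_mulVec_pos hherm fun z hz => ?_
  -- with `z = w x`, the form is `∑ (S x)ᵢ xᵢ wᵢ² - ½ ∑ Sᵢⱼ xᵢ xⱼ (wᵢ - wⱼ)²`
  set w : Fin n → ℝ := fun i => z i / x i with hw
  have hzw : ∀ i, z i = w i * x i := fun i => (div_mul_cancel₀ _ (hx i).ne').symm
  have hform : star z ⬝ᵥ S *ᵥ z = ∑ i, ∑ j, S i j * x i * x j * (w i * w j) := by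
    simp only [star_trivial, dotProduct, mulVec, Finset.mul_sum]
    exact Finset.sum_congr rfl fun i _ => Finset.sum_congr rfl fun j _ => by
      rw [hzw i, hzw j]; ring
  have h1 : ∑ i, ∑ j, S i j * x i * x j * w i ^ 2 = ∑ i, (S *ᵥ x) i * x i * w i ^ 2 := by
    refine Finset.sum_congr rfl fun i _ => ?_
    simp only [mulVec, dotProduct, Finset.sum_mul]
    exact Finset.sum_congr rfl fun j _ => by ring
  have h2 : ∑ i, ∑ j, S i j * x i * x j * w j ^ 2 = ∑ i, ∑ j, S i j * x i * x j * w i ^ 2 := by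
    rw [Finset.sum_comm]
    exact Finset.sum_congr rfl fun i _ => Finset.sum_congr rfl fun j _ => by
      rw [hsymm.apply]; ring
  have h3 : ∑ i, ∑ j, S i j * x i * x j * (w i - w j) ^ 2 ≤ 0 :=
    Finset.sum_nonpos fun i _ => Finset.sum_nonpos fun j _ => by
      by_cases hij : i = j
      · subst hij; simp
      · have := mul_nonneg (mul_nonneg (hx i).le (hx j).le) (sq_nonneg (w i - w j))
        nlinarith [hS i j hij]
  have h4 : ∑ i, ∑ j, S i j * x i * x j * (w i - w j) ^ 2
      = ∑ i, ∑ j, S i j * x i * x j * w i ^ 2 + ∑ i, ∑ j, S i j * x i * x j * w j ^ 2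
        - 2 * ∑ i, ∑ j, S i j * x i * x j * (w i * w j) := by
    simp only [Finset.mul_sum, ← Finset.sum_add_distrib, ← Finset.sum_sub_distrib]
    exact Finset.sum_congr rfl fun i _ => Finset.sum_congr rfl fun j _ => by ring
  have h5 : 0 < ∑ i, (S *ᵥ x) i * x i * w i ^ 2 := by
    obtain ⟨i, hi⟩ := Function.ne_iff.1 hz
    refine Finset.sum_pos' (fun j _ => ?_) ⟨i, Finset.mem_univ i, ?_⟩
    · have := hSx j; have := hx j; positivity
    · have := hSx i; have := hx i
      have : w i ≠ 0 := div_ne_zero hi (hx i).ne'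
      positivity
  rw [hform]
  linarith

theorem lyapMatrix_apply (G : WDigraph n) (γ : Fin n → ℝ) (i j : Fin n) :
    lyapMatrix G γ i j = γ i * G.L22 i j + γ j * G.L22 j i := by
  simp [lyapMatrix, diagonal_mul, mul_diagonal, mul_comm]

theorem lyapMatrix_isSymm (G : WDigraph n) (γ : Fin n → ℝ) : (lyapMatrix G γ).IsSymm :=
  IsSymm.ext fun i j => by rw [lyapMatrix_apply, lyapMatrix_apply, add_comm]

/-- Up to normalisation, the scaling is `γ i = θ i / ζ i` with `L₂₂ ζ = 1` and `L₂₂ᵀ θ = 1`: then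
`(Γ L₂₂ + L₂₂ᵀ Γ) ζ = γ + 1 > 0`. -/
theorem exists_isScaling (hn : 0 < n) (hG : G.HasSpanningTree) : ∃ γ, IsScaling G γ := by
  have : Nonempty (Fin n) := ⟨⟨0, hn⟩⟩
  have hdet := (isUnit_iff_isUnit_det _).1 hG.isUnit_L22
  set ζ : Fin n → ℝ := G.L22⁻¹ *ᵥ 1 with hζdef
  set θ : Fin n → ℝ := (G.L22⁻¹)ᵀ *ᵥ 1 with hθdef
  have hLζ : G.L22 *ᵥ ζ = 1 := by
    rw [hζdef, mulVec_mulVec, mul_nonsing_inv _ hdet, one_mulVec]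
  have hLθ : G.L22ᵀ *ᵥ θ = 1 := by
    rw [hθdef, mulVec_mulVec, ← transpose_mul, nonsing_inv_mul _ hdet, transpose_one, one_mulVec]
  have hζ : ∀ i, 0 < ζ i := pos_of_offDiag_nonpos (S := G.L22)
    (fun i j h => G.L22_offDiag_nonpos h)
    (fun i => by
      simpa [hζdef, mulVec, dotProduct] using Finset.sum_nonneg fun j _ => hG.inv_L22_nonneg i j)
    (fun i => by rw [hLζ]; simp)
  have hθ : ∀ i, 0 < θ i := pos_of_offDiag_nonpos (S := G.L22ᵀ)
    (fun i j h => G.L22_offDiag_nonpos h.symm)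
    (fun i => by
      simpa [hθdef, mulVec, dotProduct] using Finset.sum_nonneg fun j _ => hG.inv_L22_nonneg j i)
    (fun i => by rw [hLθ]; simp)
  set γ₀ : Fin n → ℝ := fun i => θ i / ζ i with hγ₀
  have hγ₀pos : ∀ i, 0 < γ₀ i := fun i => div_pos (hθ i) (hζ i)
  set s : ℝ := ⨆ i, γ₀ i with hs
  have hspos : 0 < s := (hγ₀pos ⟨0, hn⟩).trans_le (le_ciSup (Finite.bddAbove_range γ₀) _)
  refine ⟨fun i => s⁻¹ * γ₀ i, fun i => mul_pos (inv_pos.2 hspos) (hγ₀pos i), ?_, ?_⟩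
  · rw [← Real.mul_iSup_of_nonneg (inv_pos.2 hspos).le, ← hs, inv_mul_cancel₀ hspos.ne']
  · refine posDef_of_offDiag_nonpos (lyapMatrix_isSymm _ _) (fun i j hij => ?_) hζ fun i => ?_
    · rw [lyapMatrix_apply]
      have h1 := mul_pos (inv_pos.2 hspos) (hγ₀pos i)
      have h2 := mul_pos (inv_pos.2 hspos) (hγ₀pos j)
      nlinarith [G.L22_offDiag_nonpos hij, G.L22_offDiag_nonpos hij.symm]
    · have hΓζ : diagonal (fun i => s⁻¹ * γ₀ i) *ᵥ ζ = s⁻¹ • θ := by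
        ext j
        have := (hζ j).ne'
        simp only [mulVec_diagonal, hγ₀, Pi.smul_apply, smul_eq_mul]
        field_simp
      rw [lyapMatrix, add_mulVec, ← mulVec_mulVec, ← mulVec_mulVec, hLζ, hΓζ, mulVec_smul, hLθ]
      have := mul_pos (inv_pos.2 hspos) (hγ₀pos i)
      have := inv_pos.2 hspos
      simp only [Pi.add_apply, mulVec_diagonal, Pi.one_apply, Pi.smul_apply, smul_eq_mul]
      linarith

end Laplacian

/-! ### Stacked vectors and the quadratic form of `X` -/

section Stacked

open Matrix

variable {n p : ℕ}

/-- The stacked vector `(x₁, …, x_n)`. -/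
noncomputable def stack (x : Fin n → Coord p) : EuclideanSpace ℝ (Fin n × Fin p) :=
  WithLp.toLp 2 fun k => x k.1 k.2

@[simp] theorem stack_apply (x : Fin n → Coord p) (k : Fin n × Fin p) :
    stack x k = x k.1 k.2 := rfl

theorem stack_dotProduct (x y : Fin n → Coord p) :
    (stack x).ofLp ⬝ᵥ (stack y).ofLp = ∑ i, inner ℝ (x i) (y i) := by
  simp only [dotProduct, stack_apply, Fintype.sum_prod_type, PiLp.inner_apply, RCLike.inner_apply,
    conj_trivial]
  exact Finset.sum_congr rfl fun i _ => Finset.sum_congr rfl fun k _ => mul_comm _ _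

theorem norm_stack_sq (x : Fin n → Coord p) : ‖stack x‖ ^ 2 = ∑ i, ‖x i‖ ^ 2 := by
  simp only [EuclideanSpace.norm_sq_eq, Fintype.sum_prod_type, stack_apply]

theorem stack_dotProduct_self (x : Fin n → Coord p) :
    (stack x).ofLp ⬝ᵥ (stack x).ofLp = ‖stack x‖ ^ 2 := by
  rw [stack_dotProduct, norm_stack_sq]
  simp

theorem norm_le_norm_stack (x : Fin n → Coord p) (i : Fin n) : ‖x i‖ ≤ ‖stack x‖ := by
  refine le_of_sq_le_sq ?_ (norm_nonneg _)
  rw [norm_stack_sq]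
  exact Finset.single_le_sum (f := fun i => ‖x i‖ ^ 2) (fun _ _ => by positivity)
    (Finset.mem_univ i)

theorem sum_norm_mul_norm_le (x y : Fin n → Coord p) :
    ∑ i, ‖x i‖ * ‖y i‖ ≤ ‖stack x‖ * ‖stack y‖ := by
  refine (Real.sum_mul_le_sqrt_mul_sqrt _ _ _).trans_eq ?_
  rw [← norm_stack_sq, ← norm_stack_sq, Real.sqrt_sq (norm_nonneg _), Real.sqrt_sq (norm_nonneg _)]

/-- The bilinear form of `S ⊗ I_p` on stacked vectors. -/
noncomputable def kronForm (S : Matrix (Fin n) (Fin n) ℝ) (x y : Fin n → Coord p) : ℝ :=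
  ∑ i, ∑ j, S i j * inner ℝ (x i) (y j)

theorem stack_dotProduct_matX (G : WDigraph n) (γ : Fin n → ℝ) (x : Fin n → Coord p) :
    (stack x).ofLp ⬝ᵥ matX p G γ *ᵥ (stack x).ofLp = kronForm (lyapMatrix G γ) x x := by
  simp only [dotProduct, mulVec, matX, kronecker, kroneckerMap_apply, one_apply, stack_apply,
    Fintype.sum_prod_type, kronForm, PiLp.inner_apply, RCLike.inner_apply, conj_trivial, mul_ite,
    mul_one, mul_zero, ite_mul, zero_mul, Finset.sum_ite_eq, Finset.mem_univ, if_true,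
    Finset.mul_sum]
  refine Finset.sum_congr rfl fun i _ => ?_
  rw [Finset.sum_comm]
  exact Finset.sum_congr rfl fun j _ => Finset.sum_congr rfl fun k _ => by ring

theorem matX_posDef {G : WDigraph n} {γ : Fin n → ℝ} (h : IsScaling G γ) :
    (matX p G γ).PosDef := h.2.2.kronecker PosDef.one

theorem lamMin_matX_mul_le {G : WDigraph n} {γ : Fin n → ℝ} (h : IsScaling G γ)
    (x : Fin n → Coord p) :
    lamMin (matX p G γ) * ‖stack x‖ ^ 2 ≤ kronForm (lyapMatrix G γ) x x := by
  rw [← stack_dotProduct_matX, ← stack_dotProduct_self]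
  exact lamMin_mul_le (matX_posDef h).isHermitian _

theorem kronForm_le_lamMax_matX {G : WDigraph n} {γ : Fin n → ℝ} (h : IsScaling G γ)
    (x : Fin n → Coord p) :
    kronForm (lyapMatrix G γ) x x ≤ lamMax (matX p G γ) * ‖stack x‖ ^ 2 := by
  rw [← stack_dotProduct_matX, ← stack_dotProduct_self]
  exact le_lamMax_mul (matX_posDef h).isHermitian _

theorem kronForm_comm {S : Matrix (Fin n) (Fin n) ℝ} (hS : S.IsSymm) (x y : Fin n → Coord p) :
    kronForm S x y = kronForm S y x := by
  rw [kronForm, kronForm, Finset.sum_comm]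
  exact Finset.sum_congr rfl fun i _ => Finset.sum_congr rfl fun j _ => by
    rw [hS.apply, real_inner_comm]

theorem kronForm_add_smul_self {S : Matrix (Fin n) (Fin n) ℝ} (hS : S.IsSymm)
    (x y : Fin n → Coord p) (μ : ℝ) :
    kronForm S (fun i => x i + μ • y i) (fun i => x i + μ • y i)
      = kronForm S x x + 2 * μ * kronForm S x y + μ ^ 2 * kronForm S y y := by
  have : kronForm S (fun i => x i + μ • y i) (fun i => x i + μ • y i)
      = kronForm S x x + μ * kronForm S x y + μ * kronForm S y x + μ ^ 2 * kronForm S y y := by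
    simp only [kronForm, inner_add_left, inner_add_right, inner_smul_left, inner_smul_right,
      conj_trivial, Finset.mul_sum, ← Finset.sum_add_distrib]
    exact Finset.sum_congr rfl fun i _ => Finset.sum_congr rfl fun j _ => by ring
  rw [this, kronForm_comm hS y x]
  ring

/-- `⟨s, Γ L₂₂ s⟩ = ½ ⟨s, (Γ L₂₂ + L₂₂ᵀ Γ) s⟩`. -/
theorem sum_mul_inner_L22 (G : WDigraph n) (γ : Fin n → ℝ) (s : Fin n → Coord p) :
    ∑ i, γ i * inner ℝ (s i) (∑ j, G.L22 i j • s j) = 1 / 2 * kronForm (lyapMatrix G γ) s s := by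
  have h1 : kronForm (lyapMatrix G γ) s s
      = ∑ i, ∑ j, γ i * G.L22 i j * inner ℝ (s i) (s j)
        + ∑ i, ∑ j, γ j * G.L22 j i * inner ℝ (s i) (s j) := by
    simp only [kronForm, lyapMatrix_apply, ← Finset.sum_add_distrib]
    exact Finset.sum_congr rfl fun i _ => Finset.sum_congr rfl fun j _ => by ring
  have h2 : ∑ i, ∑ j, γ j * G.L22 j i * inner ℝ (s i) (s j)
      = ∑ i, ∑ j, γ i * G.L22 i j * inner ℝ (s i) (s j) := by
    rw [Finset.sum_comm]
    exact Finset.sum_congr rfl fun i _ => Finset.sum_congr rfl fun j _ => by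
      rw [real_inner_comm]
  rw [h1, h2, ← two_mul, ← mul_assoc, one_div, inv_mul_cancel₀ two_ne_zero, one_mul]
  simp only [inner_sum, inner_smul_right, Finset.mul_sum]
  exact Finset.sum_congr rfl fun i _ => Finset.sum_congr rfl fun j _ => by ring

end Stacked

/-! ### Quadratic bounds of the Lyapunov function -/

section Lyapunov

variable {n p : ℕ}

theorem gamMin_le {γ : Fin n → ℝ} (i : Fin n) : gamMin γ ≤ γ i :=
  ciInf_le (Set.finite_range γ).bddBelow i

theorem IsScaling.le_one {G : WDigraph n} {γ : Fin n → ℝ} (h : IsScaling G γ) (i : Fin n) :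
    γ i ≤ 1 :=
  (le_ciSup (Finite.bddAbove_range γ) i).trans_eq h.2.1

theorem IsScaling.gamMin_pos {G : WDigraph n} {γ : Fin n → ℝ} (h : IsScaling G γ) (hn : 0 < n) :
    0 < gamMin γ := by
  have : Nonempty (Fin n) := ⟨⟨0, hn⟩⟩
  obtain ⟨i, hi⟩ := exists_eq_ciInf_of_finite (f := γ)
  rw [gamMin, ← hi]
  exact h.1 i

/-- The Lyapunov function
`½ η xᵀ X x + ½ yᵀ Γ M y + μ⁻¹ xᵀ Γ M y` of one topology, for position errors `x` and velocity
errors `y`. -/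
noncomputable def lyapV (G : WDigraph n) (γ : Fin n → ℝ) (μ η : ℝ)
    (M : Fin n → Coord p →L[ℝ] Coord p) (x y : Fin n → Coord p) : ℝ :=
  1 / 2 * η * kronForm (lyapMatrix G γ) x x + 1 / 2 * ∑ i, γ i * inner ℝ (M i (y i)) (y i)
    + μ⁻¹ * ∑ i, γ i * inner ℝ (x i) (M i (y i))

/-- The inertia matrices are symmetric and lie between `k_m I` and `k_M I`. -/
structure InertiaBounds (B : Bounds) (M : Fin n → Coord p →L[ℝ] Coord p) : Prop where
  symm : ∀ i u v, inner ℝ (M i u) v = inner ℝ u (M i v)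
  lower : ∀ i u, B.km * ‖u‖ ^ 2 ≤ inner ℝ (M i u) u
  upper : ∀ i u, inner ℝ (M i u) u ≤ B.kM * ‖u‖ ^ 2

variable {B : Bounds} {G : WDigraph n} {γ : Fin n → ℝ} {μ η : ℝ}
  {M : Fin n → Coord p →L[ℝ] Coord p}

theorem Bounds.kM_pos (B : Bounds) : 0 < B.kM := B.km_pos.trans_le B.km_le_kM

/-- Completing the square in the cross term. -/
theorem lyapV_eq (hM : InertiaBounds B M) (x y : Fin n → Coord p) :
    lyapV G γ μ η M x y = 1 / 2 * η * kronForm (lyapMatrix G γ) x x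
      + 1 / 2 * ∑ i, γ i * inner ℝ (M i (y i + μ⁻¹ • x i)) (y i + μ⁻¹ • x i)
      - 1 / 2 * μ⁻¹ ^ 2 * ∑ i, γ i * inner ℝ (M i (x i)) (x i) := by
  have h : ∑ i, γ i * inner ℝ (M i (y i + μ⁻¹ • x i)) (y i + μ⁻¹ • x i)
      = ∑ i, γ i * inner ℝ (M i (y i)) (y i)
        + 2 * μ⁻¹ * ∑ i, γ i * inner ℝ (x i) (M i (y i))
        + μ⁻¹ ^ 2 * ∑ i, γ i * inner ℝ (M i (x i)) (x i) := by
    simp only [Finset.mul_sum, ← Finset.sum_add_distrib]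
    refine Finset.sum_congr rfl fun i _ => ?_
    rw [map_add, map_smul, inner_add_left, inner_add_right, inner_add_right, inner_smul_left,
      inner_smul_left, inner_smul_right, inner_smul_right, hM.symm i (x i) (y i),
      real_inner_comm (x i) (M i (y i)), conj_trivial]
    ring
  rw [h, lyapV]
  ring

theorem sum_mul_inner_le (hγ : IsScaling G γ) (hM : InertiaBounds B M) (x : Fin n → Coord p) :
    ∑ i, γ i * inner ℝ (M i (x i)) (x i) ≤ B.kM * ‖stack x‖ ^ 2 := by
  rw [norm_stack_sq, Finset.mul_sum]
  refine Finset.sum_le_sum fun i _ => ?_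
  have h0 : 0 ≤ inner ℝ (M i (x i)) (x i) :=
    (mul_nonneg B.km_pos.le (sq_nonneg _)).trans (hM.lower i (x i))
  exact (mul_le_of_le_one_left h0 (hγ.le_one i)).trans (hM.upper i (x i))

theorem le_sum_mul_inner (hγ : IsScaling G γ) (hM : InertiaBounds B M) (x : Fin n → Coord p) :
    gamMin γ * B.km * ‖stack x‖ ^ 2 ≤ ∑ i, γ i * inner ℝ (M i (x i)) (x i) := by
  rw [norm_stack_sq, Finset.mul_sum]
  refine Finset.sum_le_sum fun i _ => ?_
  rw [mul_assoc]
  exact mul_le_mul (gamMin_le i) (hM.lower i (x i)) (mul_nonneg B.km_pos.le (sq_nonneg _))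
    (hγ.1 i).le

theorem sum_inner_nonneg (hγ : IsScaling G γ) (hM : InertiaBounds B M) (x : Fin n → Coord p) :
    0 ≤ ∑ i, γ i * inner ℝ (M i (x i)) (x i) :=
  Finset.sum_nonneg fun i _ => mul_nonneg (hγ.1 i).le
    ((mul_nonneg B.km_pos.le (sq_nonneg _)).trans (hM.lower i (x i)))

theorem norm_stack_add_smul_sq (x y : Fin n → Coord p) (c : ℝ) :
    ‖stack (fun i => y i + c • x i)‖ ^ 2
      = ‖stack y‖ ^ 2 + 2 * c * ∑ i, inner ℝ (x i) (y i) + c ^ 2 * ‖stack x‖ ^ 2 := by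
  simp only [norm_stack_sq, Finset.mul_sum, ← Finset.sum_add_distrib]
  refine Finset.sum_congr rfl fun i _ => ?_
  rw [norm_add_sq_real, norm_smul, inner_smul_right, real_inner_comm, mul_pow, Real.norm_eq_abs,
    sq_abs]
  ring

theorem lyapV_ge (hγ : IsScaling G γ) (hM : InertiaBounds B M) (hη : 1 ≤ η)
    (hl : 0 < lamMin (matX p G γ)) (hμ : 2 * B.kM * μ⁻¹ ^ 2 ≤ lamMin (matX p G γ))
    (x y : Fin n → Coord p) :
    1 / 4 * η * lamMin (matX p G γ) * ‖stack x‖ ^ 2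
      + 1 / 2 * (gamMin γ * B.km) * ‖stack (fun i => y i + μ⁻¹ • x i)‖ ^ 2
      ≤ lyapV G γ μ η M x y := by
  rw [lyapV_eq hM]
  have h1 := lamMin_matX_mul_le hγ x
  have h2 := le_sum_mul_inner hγ hM fun i => y i + μ⁻¹ • x i
  have h3 := sum_mul_inner_le hγ hM x
  have h4 : 1 / 2 * μ⁻¹ ^ 2 * ∑ i, γ i * inner ℝ (M i (x i)) (x i)
      ≤ 1 / 4 * η * lamMin (matX p G γ) * ‖stack x‖ ^ 2 := by
    calc 1 / 2 * μ⁻¹ ^ 2 * ∑ i, γ i * inner ℝ (M i (x i)) (x i)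
        ≤ 1 / 2 * μ⁻¹ ^ 2 * (B.kM * ‖stack x‖ ^ 2) := by gcongr
      _ = 1 / 4 * (2 * B.kM * μ⁻¹ ^ 2) * ‖stack x‖ ^ 2 := by ring
      _ ≤ 1 / 4 * (η * lamMin (matX p G γ)) * ‖stack x‖ ^ 2 :=
          mul_le_mul_of_nonneg_right (mul_le_mul_of_nonneg_left
            (hμ.trans (le_mul_of_one_le_left hl.le hη)) (by norm_num)) (sq_nonneg _)
      _ = _ := by ring
  have h5 := mul_le_mul_of_nonneg_left h1 (show (0 : ℝ) ≤ 1 / 2 * η by linarith)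
  linarith

theorem lyapV_le (hγ : IsScaling G γ) (hM : InertiaBounds B M) (hη : 0 ≤ η)
    (x y : Fin n → Coord p) :
    lyapV G γ μ η M x y ≤ 1 / 2 * η * lamMax (matX p G γ) * ‖stack x‖ ^ 2
      + 1 / 2 * B.kM * ‖stack (fun i => y i + μ⁻¹ • x i)‖ ^ 2 := by
  rw [lyapV_eq hM]
  have h1 := kronForm_le_lamMax_matX hγ x
  have h2 := sum_mul_inner_le hγ hM fun i => y i + μ⁻¹ • x i
  have h3 := mul_nonneg (show (0 : ℝ) ≤ 1 / 2 * μ⁻¹ ^ 2 by positivity) (sum_inner_nonneg hγ hM x)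
  have h5 := mul_le_mul_of_nonneg_left h1 (show (0 : ℝ) ≤ 1 / 2 * η by linarith)
  linarith

/-- The Lyapunov function is at least the quadratic form of `N_μ`. -/
theorem lamMin_matN_mul_le (hn : 0 < n) (hγ : IsScaling G γ) (hM : InertiaBounds B M) (hη : 1 ≤ η)
    (hl : 0 < lamMin (matX p G γ)) (hμ : 2 * B.kM * μ⁻¹ ^ 2 ≤ lamMin (matX p G γ))
    (x y : Fin n → Coord p) :
    lamMin (matN p B G γ μ η) * (‖stack x‖ ^ 2 + ‖stack y‖ ^ 2) ≤ lyapV G γ μ η M x y := by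
  have h1 := lyapV_ge hγ hM hη hl hμ x y
  have h2 := lamMin_le_scalarBlocks (a := 1 / 2 * (1 / 2 * η * lamMin (matX p G γ)))
    (b := 1 / 2 * (μ⁻¹ * gamMin γ * (B.km - B.δ))) (d := 1 / 2 * (gamMin γ * (B.km - B.δ)))
    (stack x).ofLp (stack y).ofLp
  rw [← matN_eq, stack_dotProduct_self, stack_dotProduct_self, stack_dotProduct] at h2
  have h3 := norm_stack_add_smul_sq x y μ⁻¹
  have hc := hγ.gamMin_pos hn
  have h4 : 0 ≤ gamMin γ * B.δ * ‖stack (fun i => y i + μ⁻¹ • x i)‖ ^ 2 := by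
    have := B.δ_pos
    positivity
  have h5 : 0 ≤ gamMin γ * (B.km - B.δ) * (μ⁻¹ ^ 2 * ‖stack x‖ ^ 2) := by
    have := sub_pos.2 B.δ_lt
    positivity
  have h6 : gamMin γ * (B.km - B.δ) * ‖stack (fun i => y i + μ⁻¹ • x i)‖ ^ 2
      = gamMin γ * (B.km - B.δ) * (‖stack y‖ ^ 2 + 2 * μ⁻¹ * ∑ i, inner ℝ (x i) (y i)
        + μ⁻¹ ^ 2 * ‖stack x‖ ^ 2) := by rw [h3]
  linarith

/-- The Lyapunov function is at most the quadratic form of `L_μ`. -/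
theorem lyapV_le_lamMax_matL_mul (hγ : IsScaling G γ) (hM : InertiaBounds B M) (hη : 0 ≤ η)
    (hμ : (B.kM + B.δ) * μ⁻¹ ^ 2 ≤ η * lamMax (matX p G γ)) (x y : Fin n → Coord p) :
    lyapV G γ μ η M x y ≤ lamMax (matL p B G γ μ η) * (‖stack x‖ ^ 2 + ‖stack y‖ ^ 2) := by
  have h1 := lyapV_le (μ := μ) hγ hM hη x y
  have h2 := scalarBlocks_le_lamMax (a := η * lamMax (matX p G γ))
    (b := 1 / 2 * μ⁻¹ * (B.kM + B.δ)) (d := 1 / 2 * (B.kM + B.δ)) (stack x).ofLp (stack y).ofLp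
  rw [← matL_eq, stack_dotProduct_self, stack_dotProduct_self, stack_dotProduct] at h2
  have h3 := norm_stack_add_smul_sq x y μ⁻¹
  have h4 : 0 ≤ B.δ * ‖stack (fun i => y i + μ⁻¹ • x i)‖ ^ 2 := by
    have := B.δ_pos
    positivity
  have h5 := mul_le_mul_of_nonneg_right hμ (sq_nonneg ‖stack x‖)
  have h6 : (B.kM + B.δ) * ‖stack (fun i => y i + μ⁻¹ • x i)‖ ^ 2
      = (B.kM + B.δ) * (‖stack y‖ ^ 2 + 2 * μ⁻¹ * ∑ i, inner ℝ (x i) (y i)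
        + μ⁻¹ ^ 2 * ‖stack x‖ ^ 2) := by rw [h3]
  linarith

/-! ### The derivative of the Lyapunov function -/

/-- The derivative of `lyapV` along curves with velocity errors `y`, acceleration errors `a` and
`M' = C + Cᵀ`, after the terms `½ yᵀ Γ (C + Cᵀ) y = yᵀ Γ C y` have been combined. -/
noncomputable def lyapDeriv (G : WDigraph n) (γ : Fin n → ℝ) (μ η : ℝ)
    (M C : Fin n → Coord p →L[ℝ] Coord p) (x y a : Fin n → Coord p) : ℝ :=
  η * kronForm (lyapMatrix G γ) x y + ∑ i, γ i * inner ℝ (C i (y i)) (y i)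
    + μ⁻¹ * ∑ i, γ i * (inner ℝ (y i) (M i (y i)) + inner ℝ (x i) (C i (y i))
        + inner ℝ (C i (x i)) (y i))
    + μ⁻¹ * ∑ i, γ i * inner ℝ (x i + μ • y i) (M i (a i))

theorem hasDerivAt_lyapV {M : ℝ → Fin n → Coord p →L[ℝ] Coord p}
    {C : Fin n → Coord p →L[ℝ] Coord p} {x y : ℝ → Fin n → Coord p} {a : Fin n → Coord p} {t : ℝ}
    (hμ : μ ≠ 0) (hsymm : ∀ i u v, inner ℝ (M t i u) v = inner ℝ u (M t i v))
    (hM : ∀ i, HasDerivAt (fun s => M s i) (C i + ContinuousLinearMap.adjoint (C i)) t)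
    (hx : ∀ i, HasDerivAt (fun s => x s i) (y t i) t)
    (hy : ∀ i, HasDerivAt (fun s => y s i) (a i) t) :
    HasDerivAt (fun s => lyapV G γ μ η (M s) (x s) (y s))
      (lyapDeriv G γ μ η (M t) C (x t) (y t) a) t := by
  have hMy : ∀ i, HasDerivAt (fun s => M s i (y s i))
      ((C i + ContinuousLinearMap.adjoint (C i)) (y t i) + M t i (a i)) t := fun i =>
    (hM i).clm_apply (hy i)
  have h1 : HasDerivAt (fun s => kronForm (lyapMatrix G γ) (x s) (x s))
      (∑ i, ∑ j, lyapMatrix G γ i j * (inner ℝ (x t i) (y t j) + inner ℝ (y t i) (x t j))) t :=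
    HasDerivAt.fun_sum fun i _ => HasDerivAt.fun_sum fun j _ =>
      ((hx i).inner ℝ (hx j)).const_mul _
  have h2 : HasDerivAt (fun s => ∑ i, γ i * inner ℝ (M s i (y s i)) (y s i)) _ t :=
    HasDerivAt.fun_sum fun i _ => ((hMy i).inner ℝ (hy i)).const_mul (γ i)
  have h3 : HasDerivAt (fun s => ∑ i, γ i * inner ℝ (x s i) (M s i (y s i))) _ t :=
    HasDerivAt.fun_sum fun i _ => ((hx i).inner ℝ (hMy i)).const_mul (γ i)
  refine (((h1.const_mul (1 / 2 * η)).add (h2.const_mul (1 / 2))).add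
    (h3.const_mul μ⁻¹)).congr_deriv ?_
  have e1 : ∑ i, ∑ j, lyapMatrix G γ i j * (inner ℝ (x t i) (y t j) + inner ℝ (y t i) (x t j))
      = 2 * kronForm (lyapMatrix G γ) (x t) (y t) := by
    have : ∑ i, ∑ j, lyapMatrix G γ i j * (inner ℝ (x t i) (y t j) + inner ℝ (y t i) (x t j))
        = kronForm (lyapMatrix G γ) (x t) (y t) + kronForm (lyapMatrix G γ) (y t) (x t) := by
      simp only [kronForm, mul_add, Finset.sum_add_distrib]
    rw [this, kronForm_comm (lyapMatrix_isSymm G γ) (y t) (x t)]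
    ring
  rw [e1, lyapDeriv]
  have e2 : ∀ i, inner ℝ (M t i (y t i)) (a i)
      + inner ℝ ((C i + ContinuousLinearMap.adjoint (C i)) (y t i) + M t i (a i)) (y t i)
      = 2 * inner ℝ (C i (y t i)) (y t i) + 2 * inner ℝ (y t i) (M t i (a i)) := by
    intro i
    rw [add_apply, inner_add_left, inner_add_left, ContinuousLinearMap.adjoint_inner_left, hsymm,
      real_inner_comm (y t i) (M t i (a i)), real_inner_comm (C i (y t i)) (y t i)]
    ring
  have e3 : ∀ i, inner ℝ (x t i)
        ((C i + ContinuousLinearMap.adjoint (C i)) (y t i) + M t i (a i))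
      + inner ℝ (y t i) (M t i (y t i))
      = inner ℝ (y t i) (M t i (y t i)) + inner ℝ (x t i) (C i (y t i))
        + inner ℝ (C i (x t i)) (y t i) + inner ℝ (x t i) (M t i (a i)) := by
    intro i
    rw [add_apply, inner_add_right, inner_add_right, ContinuousLinearMap.adjoint_inner_right]
    ring
  simp only [e2, e3]
  simp only [inner_add_left, inner_smul_left, conj_trivial, Finset.mul_sum, ← mul_assoc,
    add_assoc, ← Finset.sum_add_distrib]
  rw [show 1 / 2 * η * 2 = η by ring]
  refine congrArg _ (Finset.sum_congr rfl fun i _ => ?_)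
  field_simp
  ring

/-- Upper bound of the derivative of the Lyapunov function. The hypothesis `ha` is the equation of
motion, tested with `x + μ y`; everything but the consensus and the Coriolis terms is in `θ`. -/
theorem lyapDeriv_le (hγ : IsScaling G γ) (hM : InertiaBounds B M) (hμ : 0 < μ) (hη : 0 ≤ η)
    {C : Fin n → Coord p →L[ℝ] Coord p} {x y a : Fin n → Coord p} {v₀ : Coord p} {θ : Fin n → ℝ}
    (hv₀ : ‖v₀‖ ≤ B.kp) (hC : ∀ i, ‖C i‖ ≤ B.kC * ‖y i + v₀‖)
    (ha : ∀ i, inner ℝ (x i + μ • y i) (M i (a i))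
      ≤ -η * inner ℝ (x i + μ • y i) (∑ j, G.L22 i j • (x j + μ • y j))
        - inner ℝ (x i + μ • y i) (C i (y i + v₀)) + θ i) :
    lyapDeriv G γ μ η M C x y a ≤ -(μ⁻¹ * (phi B (lamMin (matX p G γ)) μ η * ‖stack y‖ ^ 2
        + 1 / 2 * η * lamMin (matX p G γ) * ‖stack x‖ ^ 2
        - 2 * B.kC * B.kp * ‖stack x‖ * ‖stack y‖ - B.kC * ‖stack x‖ * ‖stack y‖ ^ 2
        - ∑ i, (B.kC * B.kp ^ 2 * ‖x i + μ • y i‖ + γ i * θ i))) := by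
  have hkC := B.kC_pos
  have hkp := B.kp_pos
  have hCn : ∀ i, ‖C i‖ ≤ B.kC * (‖y i‖ + B.kp) := fun i =>
    (hC i).trans (by gcongr; exact (norm_add_le _ _).trans (by gcongr))
  -- the consensus term cancels the cross term of `½ η xᵀ X x`, the Coriolis terms cancel
  have hsum : μ⁻¹ * ∑ i, γ i * inner ℝ (x i + μ • y i) (M i (a i))
      ≤ μ⁻¹ * (-η * (1 / 2 * (kronForm (lyapMatrix G γ) x x
          + 2 * μ * kronForm (lyapMatrix G γ) x y + μ ^ 2 * kronForm (lyapMatrix G γ) y y))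
        - ∑ i, γ i * inner ℝ (x i + μ • y i) (C i (y i + v₀)) + ∑ i, γ i * θ i) := by
    gcongr
    rw [← kronForm_add_smul_self (lyapMatrix_isSymm G γ), ← sum_mul_inner_L22, Finset.mul_sum,
      ← Finset.sum_sub_distrib, ← Finset.sum_add_distrib]
    refine Finset.sum_le_sum fun i _ => ?_
    have := mul_le_mul_of_nonneg_left (ha i) (hγ.1 i).le
    linarith
  have hcor : ∑ i, γ i * inner ℝ (C i (y i)) (y i)
      + μ⁻¹ * ∑ i, γ i * (inner ℝ (y i) (M i (y i)) + inner ℝ (x i) (C i (y i))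
        + inner ℝ (C i (x i)) (y i))
      = μ⁻¹ * (∑ i, γ i * inner ℝ (M i (y i)) (y i)
        + ∑ i, γ i * (inner ℝ (C i (x i)) (y i) - inner ℝ (x i + μ • y i) (C i v₀))
        + ∑ i, γ i * inner ℝ (x i + μ • y i) (C i (y i + v₀))) := by
    simp only [Finset.mul_sum, ← Finset.sum_add_distrib]
    refine Finset.sum_congr rfl fun i _ => ?_
    rw [map_add, inner_add_right, inner_add_left (x i) (μ • y i) (C i (y i)), inner_smul_left,
      real_inner_comm (y i) (C i (y i)), real_inner_comm (M i (y i)) (y i), conj_trivial]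
    field_simp
    ring
  have hrem : ∑ i, γ i * (inner ℝ (C i (x i)) (y i) - inner ℝ (x i + μ • y i) (C i v₀))
      ≤ 2 * B.kC * B.kp * ‖stack x‖ * ‖stack y‖ + B.kC * ‖stack x‖ * ‖stack y‖ ^ 2
        + μ * B.kC * B.kp * ‖stack y‖ ^ 2 + ∑ i, B.kC * B.kp ^ 2 * ‖x i + μ • y i‖ := by
    have hterm : ∀ i, γ i * (inner ℝ (C i (x i)) (y i) - inner ℝ (x i + μ • y i) (C i v₀))
        ≤ 2 * B.kC * B.kp * (‖x i‖ * ‖y i‖) + B.kC * ‖stack x‖ * ‖y i‖ ^ 2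
          + μ * B.kC * B.kp * ‖y i‖ ^ 2 + B.kC * B.kp ^ 2 * ‖x i + μ • y i‖ := by
      intro i
      have t1 : inner ℝ (C i (x i)) (y i) ≤ B.kC * (‖y i‖ + B.kp) * ‖x i‖ * ‖y i‖ :=
        (real_inner_le_norm _ _).trans (by
          gcongr
          exact (C i).le_of_opNorm_le (hCn i) _)
      have t2 : -inner ℝ (x i + μ • y i) (C i v₀)
          ≤ ‖x i + μ • y i‖ * (B.kC * (‖y i‖ + B.kp) * B.kp) :=
        ((neg_le_abs _).trans (abs_real_inner_le_norm _ _)).trans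
          (mul_le_mul_of_nonneg_left ((C i).le_of_opNorm_le_of_le (hCn i) hv₀) (norm_nonneg _))
      have t3 : ‖x i + μ • y i‖ ≤ ‖x i‖ + μ * ‖y i‖ := by
        refine (norm_add_le _ _).trans ?_
        rw [norm_smul, Real.norm_of_nonneg hμ.le]
      have t4 : ‖x i‖ * ‖y i‖ ^ 2 ≤ ‖stack x‖ * ‖y i‖ ^ 2 := by
        gcongr
        exact norm_le_norm_stack x i
      have t5 : ‖x i + μ • y i‖ * (B.kC * ‖y i‖ * B.kp)
          ≤ (‖x i‖ + μ * ‖y i‖) * (B.kC * ‖y i‖ * B.kp) := by gcongr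
      have t6 := mul_le_mul_of_nonneg_left t4 hkC.le
      have hle : inner ℝ (C i (x i)) (y i) - inner ℝ (x i + μ • y i) (C i v₀)
          ≤ 2 * B.kC * B.kp * (‖x i‖ * ‖y i‖) + B.kC * ‖stack x‖ * ‖y i‖ ^ 2
          + μ * B.kC * B.kp * ‖y i‖ ^ 2 + B.kC * B.kp ^ 2 * ‖x i + μ • y i‖ := by linarith
      have hnn : 0 ≤ 2 * B.kC * B.kp * (‖x i‖ * ‖y i‖) + B.kC * ‖stack x‖ * ‖y i‖ ^ 2
          + μ * B.kC * B.kp * ‖y i‖ ^ 2 + B.kC * B.kp ^ 2 * ‖x i + μ • y i‖ := by positivity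
      exact (mul_le_mul_of_nonneg_left hle (hγ.1 i).le).trans
        (mul_le_of_le_one_left hnn (hγ.le_one i))
    refine (Finset.sum_le_sum fun i _ => hterm i).trans ?_
    simp only [Finset.sum_add_distrib, ← Finset.mul_sum, ← norm_stack_sq]
    have := mul_le_mul_of_nonneg_left (sum_norm_mul_norm_le x y)
      (show 0 ≤ 2 * B.kC * B.kp by positivity)
    linarith
  have hMy := sum_mul_inner_le hγ hM y
  have hXx := mul_le_mul_of_nonneg_left (lamMin_matX_mul_le hγ x) hη
  have hXy := mul_le_mul_of_nonneg_left (lamMin_matX_mul_le hγ y)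
    (show 0 ≤ η * μ ^ 2 by positivity)
  rw [lyapDeriv, add_assoc (η * _), hcor]
  have hcross : μ⁻¹ * (-η * (1 / 2 * (2 * μ * kronForm (lyapMatrix G γ) x y)))
      = -(η * kronForm (lyapMatrix G γ) x y) := by field_simp
  have hfin : μ⁻¹ * (∑ i, γ i * inner ℝ (M i (y i)) (y i)
        + ∑ i, γ i * (inner ℝ (C i (x i)) (y i) - inner ℝ (x i + μ • y i) (C i v₀))
        - η * (1 / 2 * (kronForm (lyapMatrix G γ) x x + μ ^ 2 * kronForm (lyapMatrix G γ) y y))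
        + ∑ i, γ i * θ i)
      ≤ μ⁻¹ * -(phi B (lamMin (matX p G γ)) μ η * ‖stack y‖ ^ 2
        + 1 / 2 * η * lamMin (matX p G γ) * ‖stack x‖ ^ 2
        - 2 * B.kC * B.kp * ‖stack x‖ * ‖stack y‖ - B.kC * ‖stack x‖ * ‖stack y‖ ^ 2
        - ∑ i, (B.kC * B.kp ^ 2 * ‖x i + μ • y i‖ + γ i * θ i)) := by
    gcongr
    rw [phi, Finset.sum_add_distrib]
    linarith
  linarith

end Lyapunov

/-! ### The Lyapunov function along Filippov solutions of the closed loop -/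

section Agents

variable {p : ℕ} {A : Agent p} {B : Bounds}

theorem Agent.IsEulerLagrange.inner_symm (hA : A.IsEulerLagrange B) (q u v : Coord p) :
    inner ℝ (A.M q u) v = inner ℝ u (A.M q v) :=
  (hA.symm_M q).isSymmetric u v

theorem inertiaBounds_of_isEulerLagrange {n : ℕ} {A : Fin n → Agent p}
    (hA : ∀ i, (A i).IsEulerLagrange B) (q : Fin n → Coord p) :
    InertiaBounds B fun i => (A i).M (q i) :=
  ⟨fun i u v => (hA i).inner_symm (q i) u v, fun i u => (hA i).lower_M (q i) u,
    fun i u => (hA i).upper_M (q i) u⟩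

theorem Agent.IsEulerLagrange.km_mul_norm_le (hA : A.IsEulerLagrange B) (q u : Coord p) :
    B.km * ‖u‖ ≤ ‖A.M q u‖ := by
  rcases eq_or_ne u 0 with rfl | hu
  · simp
  · have h1 := (hA.lower_M q u).trans (real_inner_le_norm _ _)
    have hpos := norm_pos_iff.2 hu
    refine le_of_mul_le_mul_right ?_ hpos
    linarith [show B.km * ‖u‖ * ‖u‖ = B.km * ‖u‖ ^ 2 by ring]

/-- A symmetric operator with `0 ≤ M ≤ k_M` has norm at most `k_M`: test positivity on
`u - k_M⁻¹ M u`. -/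
theorem Agent.IsEulerLagrange.norm_M_le (hA : A.IsEulerLagrange B) (q u : Coord p) :
    ‖A.M q u‖ ≤ B.kM * ‖u‖ := by
  have hk := B.kM_pos
  set w := A.M q u with hw
  have h0 : 0 ≤ inner ℝ (A.M q (u - B.kM⁻¹ • w)) (u - B.kM⁻¹ • w) :=
    (mul_nonneg B.km_pos.le (sq_nonneg _)).trans (hA.lower_M q _)
  have h1 : inner ℝ (A.M q (u - B.kM⁻¹ • w)) (u - B.kM⁻¹ • w)
      = inner ℝ (A.M q u) u - 2 * B.kM⁻¹ * ‖w‖ ^ 2 + B.kM⁻¹ ^ 2 * inner ℝ (A.M q w) w := by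
    rw [map_sub, map_smul, inner_sub_left, inner_sub_right, inner_sub_right, inner_smul_left,
      inner_smul_left, inner_smul_right, inner_smul_right, hA.inner_symm q w u, ← hw,
      real_inner_self_eq_norm_sq, conj_trivial]
    ring
  have h2 := hA.upper_M q u
  have h3 := mul_le_mul_of_nonneg_left (hA.upper_M q w) (sq_nonneg B.kM⁻¹)
  have h4 : B.kM⁻¹ ^ 2 * (B.kM * ‖w‖ ^ 2) = B.kM⁻¹ * ‖w‖ ^ 2 := by field_simp
  have h5 : B.kM⁻¹ * ‖w‖ ^ 2 ≤ B.kM * ‖u‖ ^ 2 := by linarith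
  refine le_of_sq_le_sq ?_ (by positivity)
  rw [inv_mul_le_iff₀ hk] at h5
  linarith [show (B.kM * ‖u‖) ^ 2 = B.kM * (B.kM * ‖u‖ ^ 2) by ring]

theorem Agent.IsEulerLagrange.M_inverse_apply (hA : A.IsEulerLagrange B) (q w : Coord p) :
    A.M q ((A.M q).inverse w) = w := by
  have hinj : Function.Injective (A.M q : Coord p →ₗ[ℝ] Coord p) := by
    refine (injective_iff_map_eq_zero _).2 fun u hu => ?_
    have hu' : A.M q u = 0 := hu
    have := hA.km_mul_norm_le q u
    rw [hu', norm_zero] at this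
    exact norm_le_zero_iff.1 (nonpos_of_mul_nonpos_right this B.km_pos)
  set eq : Coord p ≃L[ℝ] Coord p :=
    (LinearEquiv.ofInjectiveEndo (A.M q : Coord p →ₗ[ℝ] Coord p) hinj).toContinuousLinearEquiv
  have heq : A.M q = (eq : Coord p →L[ℝ] Coord p) := by ext u; rfl
  rw [heq, ContinuousLinearMap.inverse_equiv]
  exact eq.apply_symm_apply w

end Agents

section ClosedLoop

variable {n p : ℕ}

/-- The `ℓ¹` norm. -/
def norm1 (s : Coord p) : ℝ := ∑ k, |s k|

theorem norm1_nonneg (s : Coord p) : 0 ≤ norm1 s := Finset.sum_nonneg fun _ _ => abs_nonneg _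

theorem norm_le_norm1 (s : Coord p) : ‖s‖ ≤ norm1 s := by
  refine le_of_sq_le_sq ?_ (norm1_nonneg s)
  rw [EuclideanSpace.norm_sq_eq]
  exact Finset.sum_sq_le_sq_sum_of_nonneg fun k _ => norm_nonneg (s k)

theorem abs_sign_le_one (x : ℝ) : |Real.sign x| ≤ 1 := by
  rcases Real.sign_apply_eq x with h | h | h <;> rw [h] <;> norm_num

theorem norm_sgn_le (s : Coord p) : ‖sgn s‖ ≤ p := by
  refine (norm_le_norm1 _).trans ((Finset.sum_le_sum fun k _ =>
    (abs_sign_le_one (s k) : |sgn s k| ≤ 1)).trans_eq ?_)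
  simp

theorem inner_sgn_eq (s w : Coord p) : inner ℝ s (sgn w) = ∑ k, s k * Real.sign (w k) := by
  simp only [PiLp.inner_apply, RCLike.inner_apply, conj_trivial, sgn]
  exact Finset.sum_congr rfl fun k _ => mul_comm _ _

theorem abs_inner_sgn_le (s w : Coord p) : |inner ℝ s (sgn w)| ≤ norm1 s := by
  rw [inner_sgn_eq]
  refine (Finset.abs_sum_le_sum_abs _ _).trans (Finset.sum_le_sum fun k _ => ?_)
  rw [abs_mul]
  exact mul_le_of_le_one_right (abs_nonneg _) (abs_sign_le_one _)

theorem eventually_inner_sgn_eq (s : Coord p) :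
    ∀ᶠ w in 𝓝 s, inner ℝ s (sgn w) = norm1 s := by
  have : ∀ᶠ w in 𝓝 s, ∀ k, s k * Real.sign (w k) = |s k| := by
    rw [eventually_all]
    intro k
    have hcont : Tendsto (fun w : Coord p => w k) (𝓝 s) (𝓝 (s k)) :=
      (EuclideanSpace.proj (𝕜 := ℝ) k).continuous.tendsto s
    rcases lt_trichotomy (s k) 0 with h | h | h
    · filter_upwards [hcont.eventually (gt_mem_nhds h)] with w hw
      rw [Real.sign_of_neg hw, abs_of_neg h, mul_neg_one]
    · simp [h]
    · filter_upwards [hcont.eventually (lt_mem_nhds h)] with w hw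
      rw [Real.sign_of_pos hw, abs_of_pos h, mul_one]
  filter_upwards [this] with w hw
  rw [inner_sgn_eq, norm1]
  exact Finset.sum_congr rfl fun k _ => hw k

/-- The continuous part of the generalised force on agent `i`. -/
def smoothForce (A : Fin n → Agent p) (G : WDigraph n) (μ η : ℝ) (x₀ v₀ : Coord p) (t : ℝ)
    (i : Fin n) (z : NetState n p) : Coord p :=
  -(η • ∑ j, G.a i.succ j •
      ((z.1 i - withLeader x₀ z.1 j) + μ • (z.2 i - withLeader v₀ z.2 j)))
    - (A i).C (z.1 i) (z.2 i) (z.2 i) - (A i).g (z.1 i) - (A i).ζ t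

variable {B : Bounds} {A : Fin n → Agent p}

theorem continuous_smoothForce (hA : ∀ i, (A i).IsEulerLagrange B) (G : WDigraph n) (μ η : ℝ)
    (x₀ v₀ : Coord p) (t : ℝ) (i : Fin n) : Continuous (smoothForce A G μ η x₀ v₀ t i) := by
  have h1 : Continuous fun z : NetState n p => ∑ j, G.a i.succ j •
      ((z.1 i - withLeader x₀ z.1 j) + μ • (z.2 i - withLeader v₀ z.2 j)) :=
    continuous_finsetSum _ fun j _ => by
      have := (continuous_withLeader (n := n) x₀ j).comp
        (continuous_fst (X := Fin n → Coord p) (Y := Fin n → Coord p))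
      have := (continuous_withLeader (n := n) v₀ j).comp
        (continuous_snd (X := Fin n → Coord p) (Y := Fin n → Coord p))
      simp only [Function.comp_def] at *
      fun_prop
  have h2 : Continuous fun z : NetState n p => (A i).C (z.1 i) (z.2 i) (z.2 i) :=
    ((hA i).continuous_C.comp (show Continuous fun z : NetState n p => (z.1 i, z.2 i) by
      fun_prop)).clm_apply (by fun_prop)
  have h3 : Continuous fun z : NetState n p => (A i).g (z.1 i) :=
    (hA i).continuous_g.comp (by fun_prop)
  unfold smoothForce
  exact (((h1.const_smul η).neg.sub h2).sub h3).sub continuous_const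

variable {Gt : ℝ → WDigraph n} {μ η β : ℝ} {q₀ : ℝ → Coord p} {e : ℝ → NetState n p} {t : ℝ}
  {z w : NetState n p}

theorem networkField_snd (i : Fin n) :
    (networkField A Gt μ η β q₀ e t z).2 i
      = ((A i).M (z.1 i)).inverse (smoothForce A (Gt t) μ η (q₀ t) (deriv q₀ t) t i z
        - β • sgn ((z.1 i - (e t).1 i) + μ • (z.2 i - (e t).2 i))) := by
  simp only [networkField, controlInput, smoothForce]
  congr 1
  abel

theorem filippov_networkField_fst (hw : w ∈ filippov (networkField A Gt μ η β q₀ e t) z)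
    (i : Fin n) : w.1 i = z.2 i := by
  ext k
  exact filippov_eq hw (posCoord i k) ((velCoord i k).continuous.tendsto z)

/-- Filippov's regularisation of the equation of motion, tested with a vector `s`: only the
discontinuous part of the control is affected by it. The inertia matrix at nearby states differs
from the one at `z`, but the difference tends to `0` while the right-hand side stays bounded. -/
theorem filippov_networkField_snd (hA : ∀ i, (A i).IsEulerLagrange B)
    (hw : w ∈ filippov (networkField A Gt μ η β q₀ e t) z) (i : Fin n) (s : Coord p) {c : ℝ}
    (hc : ∀ᶠ z' in 𝓝 z,
      -(β * inner ℝ s (sgn ((z'.1 i - (e t).1 i) + μ • (z'.2 i - (e t).2 i)))) ≤ c) :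
    inner ℝ s ((A i).M (z.1 i) (w.2 i))
      ≤ inner ℝ s (smoothForce A (Gt t) μ η (q₀ t) (deriv q₀ t) t i z) + c := by
  set f := smoothForce A (Gt t) μ η (q₀ t) (deriv q₀ t) t i with hf
  have hfc : Continuous f := continuous_smoothForce hA _ _ _ _ _ _ _
  have hMc : Continuous fun z' : NetState n p => (A i).M (z'.1 i) :=
    (hA i).contDiff_M.continuous.comp (by fun_prop)
  set Φ : NetState n p →L[ℝ] ℝ := (innerSL ℝ s).comp (((A i).M (z.1 i)).comp
    ((ContinuousLinearMap.proj i).comp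
      (ContinuousLinearMap.snd ℝ (Fin n → Coord p) (Fin n → Coord p)))) with hΦ
  refine filippov_le hw Φ fun ε hε => ?_
  set bd : NetState n p → ℝ := fun z' => inner ℝ s (f z') + c
    + ‖s‖ * (‖(A i).M (z.1 i) - (A i).M (z'.1 i)‖ * ((‖f z'‖ + |β| * p) / B.km)) with hbd
  have hbdc : Continuous bd := by
    have : Continuous fun z' => inner ℝ s (f z') := continuous_const.inner hfc
    fun_prop
  have hbdz : bd z = inner ℝ s (f z) + c := by simp [hbd]
  have hev := hbdc.continuousAt.eventually
    (gt_mem_nhds (show bd z < inner ℝ s (f z) + c + ε by rw [hbdz]; linarith))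
  filter_upwards [hc, hev] with z' hc' hz'
  refine le_trans ?_ hz'.le
  set v := f z' - β • sgn ((z'.1 i - (e t).1 i) + μ • (z'.2 i - (e t).2 i)) with hv
  have hval : Φ (networkField A Gt μ η β q₀ e t z')
      = inner ℝ s v + inner ℝ s (((A i).M (z.1 i) - (A i).M (z'.1 i))
        (((A i).M (z'.1 i)).inverse v)) := by
    have h1 : Φ (networkField A Gt μ η β q₀ e t z')
        = inner ℝ s ((A i).M (z.1 i) (((A i).M (z'.1 i)).inverse v)) := by
      rw [hv, hf, ← networkField_snd]
      rfl
    rw [h1, sub_apply, (hA i).M_inverse_apply, ← inner_add_right, add_sub_cancel]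
  have h1 : inner ℝ s v ≤ inner ℝ s (f z') + c := by
    rw [hv, inner_sub_right, inner_smul_right]
    linarith
  have h2 : ‖v‖ ≤ ‖f z'‖ + |β| * p := by
    refine (norm_sub_le _ _).trans ?_
    rw [norm_smul, Real.norm_eq_abs]
    gcongr
    exact norm_sgn_le _
  have h3 : ‖((A i).M (z'.1 i)).inverse v‖ ≤ (‖f z'‖ + |β| * p) / B.km := by
    rw [le_div_iff₀' B.km_pos]
    refine ((hA i).km_mul_norm_le (z'.1 i) _).trans ?_
    rw [(hA i).M_inverse_apply]
    exact h2
  rw [hval]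
  refine add_le_add h1 ((real_inner_le_norm _ _).trans ?_)
  gcongr
  exact ((A i).M (z.1 i) - (A i).M (z'.1 i)).le_opNorm_of_le h3

/-- The tracking errors of the positions. -/
def errPos (q₀ : ℝ → Coord p) (z : ℝ → NetState n p) (t : ℝ) : Fin n → Coord p :=
  fun i => (z t).1 i - q₀ t

/-- The tracking errors of the velocities. -/
noncomputable def errVel (q₀ : ℝ → Coord p) (z : ℝ → NetState n p) (t : ℝ) : Fin n → Coord p :=
  fun i => (z t).2 i - deriv q₀ t

/-- The Lyapunov function of one topology along a curve of states. -/
noncomputable def lyapAlong (A : Fin n → Agent p) (G : WDigraph n) (γ : Fin n → ℝ) (μ η : ℝ)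
    (q₀ : ℝ → Coord p) (z : ℝ → NetState n p) (t : ℝ) : ℝ :=
  lyapV G γ μ η (fun i => (A i).M ((z t).1 i)) (errPos q₀ z t) (errVel q₀ z t)

theorem absolutelyContinuous_lyapAlong (hA : ∀ i, (A i).IsEulerLagrange B) (G : WDigraph n)
    (γ : Fin n → ℝ) (μ η : ℝ) (hq₀ : ContDiff ℝ 2 q₀) {z : ℝ → NetState n p} {a b : ℝ}
    (hz : AbsolutelyContinuousOnInterval z a b) :
    AbsolutelyContinuousOnInterval (lyapAlong A G γ μ η q₀ z) a b := by
  have hcd : ContDiff ℝ 1 (deriv q₀) :=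
    ((contDiff_succ_iff_deriv (n := 1)).1 (by simpa [one_add_one_eq_two] using hq₀)).2.2
  have hq1 : ContDiff ℝ 1 q₀ := hq₀.of_le (by norm_num)
  have hp1 : ∀ i, ContDiff ℝ 1 fun w : ℝ × NetState n p => w.2.1 i := fun i => by fun_prop
  have hp2 : ∀ i, ContDiff ℝ 1 fun w : ℝ × NetState n p => w.2.2 i := fun i => by fun_prop
  have hx : ∀ i, ContDiff ℝ 1 fun w : ℝ × NetState n p => w.2.1 i - q₀ w.1 := fun i =>
    (hp1 i).sub (hq1.comp contDiff_fst)
  have hy : ∀ i, ContDiff ℝ 1 fun w : ℝ × NetState n p => w.2.2 i - deriv q₀ w.1 := fun i =>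
    (hp2 i).sub (hcd.comp contDiff_fst)
  have hMy : ∀ i, ContDiff ℝ 1 fun w : ℝ × NetState n p =>
      (A i).M (w.2.1 i) (w.2.2 i - deriv q₀ w.1) := fun i =>
    ((hA i).contDiff_M.comp (hp1 i)).clm_apply (hy i)
  refine absolutelyContinuous_contDiff_comp
    (W := fun w : ℝ × NetState n p => lyapV G γ μ η (fun i => (A i).M (w.2.1 i))
      (fun i => w.2.1 i - q₀ w.1) (fun i => w.2.2 i - deriv q₀ w.1)) ?_ hz
  unfold lyapV kronForm
  refine ((contDiff_const.mul ?_).add (contDiff_const.mul ?_)).add (contDiff_const.mul ?_)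
  · exact ContDiff.sum fun i _ => ContDiff.sum fun j _ => contDiff_const.mul ((hx i).inner ℝ (hx j))
  · exact ContDiff.sum fun i _ => contDiff_const.mul ((hMy i).inner ℝ (hy i))
  · exact ContDiff.sum fun i _ => contDiff_const.mul ((hx i).inner ℝ (hMy i))

/-- The equation of motion of agent `i` in the form required by `lyapDeriv_le`. -/
theorem inner_motion_le (hA : ∀ i, (A i).IsEulerLagrange B) (hn : 0 < n)
    (hq₀ : IsLeaderTrajectory n B q₀) (ht : 0 ≤ t) {z : ℝ → NetState n p} {i : Fin n}
    {s : Coord p} {c : ℝ} {a : Coord p}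
    (h : inner ℝ s ((A i).M ((z t).1 i) a)
      ≤ inner ℝ s (smoothForce A (Gt t) μ η (q₀ t) (deriv q₀ t) t i (z t)) + c) :
    inner ℝ s ((A i).M ((z t).1 i) (a - deriv (deriv q₀) t))
      ≤ -η * inner ℝ s (∑ j, (Gt t).L22 i j • (errPos q₀ z t j + μ • errVel q₀ z t j))
        - inner ℝ s ((A i).C ((z t).1 i) ((z t).2 i) (errVel q₀ z t i + deriv q₀ t))
        + (B.ξ * ‖s‖ + c) := by
  have hsum : ∑ j, (Gt t).a i.succ j • (((z t).1 i - withLeader (q₀ t) (z t).1 j)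
        + μ • ((z t).2 i - withLeader (deriv q₀ t) (z t).2 j))
      = ∑ j, (Gt t).L22 i j • (errPos q₀ z t j + μ • errVel q₀ z t j) := by
    rw [(Gt t).sum_L22_smul]
    refine Finset.sum_congr rfl fun j _ => ?_
    congr 1
    induction j using Fin.cases with
    | zero => simp [errPos, errVel]
    | succ j => simp only [withLeader_succ, Fin.cons_succ, errPos, errVel]; module
  have hv : errVel q₀ z t i + deriv q₀ t = (z t).2 i := by simp [errVel]
  rw [smoothForce, hsum, inner_sub_right, inner_sub_right, inner_sub_right, inner_neg_right,
    inner_smul_right] at h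
  rw [map_sub, inner_sub_right, hv]
  have hsq : 1 ≤ √(n : ℝ) := Real.one_le_sqrt.2 (by exact_mod_cast hn)
  have hacc : ‖deriv (deriv q₀) t‖ ≤ B.kq :=
    (le_mul_of_one_le_left (norm_nonneg _) hsq).trans (hq₀.2 t ht).2
  have h1 : -inner ℝ s ((A i).g ((z t).1 i)) ≤ ‖s‖ * B.kg :=
    ((neg_le_abs _).trans (abs_real_inner_le_norm _ _)).trans
      (mul_le_mul_of_nonneg_left ((hA i).bound_g _).le (norm_nonneg _))
  have h2 : -inner ℝ s ((A i).ζ t) ≤ ‖s‖ * B.kz :=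
    ((neg_le_abs _).trans (abs_real_inner_le_norm _ _)).trans
      (mul_le_mul_of_nonneg_left ((hA i).bound_ζ t ht) (norm_nonneg _))
  have h3 : -inner ℝ s ((A i).M ((z t).1 i) (deriv (deriv q₀) t)) ≤ ‖s‖ * (B.kM * B.kq) :=
    ((neg_le_abs _).trans (abs_real_inner_le_norm _ _)).trans
      (mul_le_mul_of_nonneg_left (((hA i).norm_M_le _ _).trans
        (mul_le_mul_of_nonneg_left hacc B.kM_pos.le)) (norm_nonneg _))
  rw [Bounds.ξ]
  linarith

/-- At every time at which a closed-loop solution has a derivative in Filippov's set, the derivative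
of the Lyapunov function of the active topology is bounded: before the observer has
converged, the sliding term acts as a disturbance, and afterwards it counteracts the other ones. -/
theorem exists_hasDerivAt_lyapAlong (hn : 0 < n) (hA : ∀ i, (A i).IsEulerLagrange B)
    (hq₀ : IsLeaderTrajectory n B q₀) {γ : Fin n → ℝ} (hγ : IsScaling (Gt t) γ) (hμ : 0 < μ)
    (hη : 0 ≤ η) (hβ : 0 ≤ β) (ht : 0 ≤ t) {z : ℝ → NetState n p}
    (hw : w ∈ filippov (networkField A Gt μ η β q₀ e t) (z t)) (hz : HasDerivAt z w t) :
    ∃ d, HasDerivAt (lyapAlong A (Gt t) γ μ η q₀ z) d t ∧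
      d ≤ -(μ⁻¹ * (phi B (lamMin (matX p (Gt t) γ)) μ η * ‖stack (errVel q₀ z t)‖ ^ 2
        + 1 / 2 * η * lamMin (matX p (Gt t) γ) * ‖stack (errPos q₀ z t)‖ ^ 2
        - 2 * B.kC * B.kp * ‖stack (errPos q₀ z t)‖ * ‖stack (errVel q₀ z t)‖
        - B.kC * ‖stack (errPos q₀ z t)‖ * ‖stack (errVel q₀ z t)‖ ^ 2
        - (β + B.kC * B.kp ^ 2 + B.ξ)
          * ∑ k, |stack (errPos q₀ z t) k + μ * stack (errVel q₀ z t) k|)) ∧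
      ((∀ i, (e t).1 i = q₀ t ∧ (e t).2 i = deriv q₀ t) →
        d ≤ -(μ⁻¹ * (phi B (lamMin (matX p (Gt t) γ)) μ η * ‖stack (errVel q₀ z t)‖ ^ 2
          + 1 / 2 * η * lamMin (matX p (Gt t) γ) * ‖stack (errPos q₀ z t)‖ ^ 2
          - 2 * B.kC * B.kp * ‖stack (errPos q₀ z t)‖ * ‖stack (errVel q₀ z t)‖
          - B.kC * ‖stack (errPos q₀ z t)‖ * ‖stack (errVel q₀ z t)‖ ^ 2
          + (β * gamMin γ - B.kC * B.kp ^ 2 - B.ξ)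
            * ∑ k, |stack (errPos q₀ z t) k + μ * stack (errVel q₀ z t) k|))) := by
  have hcd : ContDiff ℝ 1 (deriv q₀) :=
    ((contDiff_succ_iff_deriv (n := 1)).1 (by simpa [one_add_one_eq_two] using hq₀.1)).2.2
  have hq1 : ContDiff ℝ 1 q₀ := hq₀.1.of_le (by norm_num)
  have hsq : 1 ≤ √(n : ℝ) := Real.one_le_sqrt.2 (by exact_mod_cast hn)
  have hvel : ‖deriv q₀ t‖ ≤ B.kp :=
    (le_mul_of_one_le_left (norm_nonneg _) hsq).trans (hq₀.2 t ht).1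
  have hξ : 0 ≤ B.ξ := by
    have := B.kg_pos; have := B.kz_nonneg; have := B.kM_pos; have := B.kq_pos
    rw [Bounds.ξ]; positivity
  have hkk : 0 ≤ B.kC * B.kp ^ 2 := mul_nonneg B.kC_pos.le (sq_nonneg _)
  have hq : ∀ i, HasDerivAt (fun s => (z s).1 i) ((z t).2 i) t := fun i => by
    have := hasDerivAt_pi.1 hz.fst i
    rwa [filippov_networkField_fst hw i] at this
  have hM : ∀ i, HasDerivAt (fun s => (A i).M ((z s).1 i))
      ((A i).C ((z t).1 i) ((z t).2 i)
        + ContinuousLinearMap.adjoint ((A i).C ((z t).1 i) ((z t).2 i))) t := fun i => by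
    rw [← (hA i).skew]
    exact (((hA i).contDiff_M.differentiable (by norm_num)) _).hasFDerivAt.comp_hasDerivAt t (hq i)
  have hx : ∀ i, HasDerivAt (fun s => errPos q₀ z s i) (errVel q₀ z t i) t := fun i =>
    (hq i).sub ((hq1.differentiable (by norm_num)) t).hasDerivAt
  have hy : ∀ i, HasDerivAt (fun s => errVel q₀ z s i) (w.2 i - deriv (deriv q₀) t) t := fun i =>
    (hasDerivAt_pi.1 hz.snd i).sub ((hcd.differentiable (by norm_num)) t).hasDerivAt
  have hder := hasDerivAt_lyapV (G := Gt t) (γ := γ) (μ := μ) (η := η) hμ.ne'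
    (fun i => (hA i).inner_symm ((z t).1 i)) hM hx hy
  have hC : ∀ i, ‖(A i).C ((z t).1 i) ((z t).2 i)‖ ≤ B.kC * ‖errVel q₀ z t i + deriv q₀ t‖ :=
    fun i => by
      simpa [errVel] using (hA i).bound_C ((z t).1 i) ((z t).2 i)
  set s : Fin n → Coord p := fun i => errPos q₀ z t i + μ • errVel q₀ z t i with hs
  have hbound : ∀ c : Fin n → ℝ, (∀ i, inner ℝ (s i) ((A i).M ((z t).1 i) (w.2 i))
      ≤ inner ℝ (s i) (smoothForce A (Gt t) μ η (q₀ t) (deriv q₀ t) t i (z t)) + c i) → _ :=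
    fun c hc => lyapDeriv_le hγ (inertiaBounds_of_isEulerLagrange hA (z t).1) hμ hη hvel hC
      fun i => inner_motion_le hA hn hq₀ ht (hc i)
  have hnorm1 : ∑ k, |stack (errPos q₀ z t) k + μ * stack (errVel q₀ z t) k|
      = ∑ i, norm1 (s i) := by
    rw [Fintype.sum_prod_type]
    rfl
  refine ⟨_, hder, ?_, fun he => ?_⟩
  · have h := hbound (fun i => β * norm1 (s i)) fun i =>
      filippov_networkField_snd hA hw i (s i) (Eventually.of_forall fun z' => by
        have := mul_le_mul_of_nonneg_left (neg_le_of_abs_le (abs_inner_sgn_le (s i)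
          ((z'.1 i - (e t).1 i) + μ • (z'.2 i - (e t).2 i)))) hβ
        linarith)
    refine h.trans (neg_le_neg (mul_le_mul_of_nonneg_left ?_ (inv_pos.2 hμ).le))
    rw [hnorm1, Finset.mul_sum]
    refine sub_le_sub_left (Finset.sum_le_sum fun i _ => ?_) _
    have h1 := norm_le_norm1 (s i)
    have h2 : 0 ≤ B.ξ * ‖s i‖ + β * norm1 (s i) :=
      add_nonneg (mul_nonneg hξ (norm_nonneg _)) (mul_nonneg hβ (norm1_nonneg _))
    have h3 := mul_le_of_le_one_left h2 (hγ.le_one i)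
    have h4 := mul_le_mul_of_nonneg_left h1 hξ
    have h5 := mul_le_mul_of_nonneg_left h1 hkk
    simp only [hs] at *
    linarith
  · have hsgn : ∀ i, ∀ᶠ z' in 𝓝 (z t), -(β * inner ℝ (s i)
        (sgn ((z'.1 i - (e t).1 i) + μ • (z'.2 i - (e t).2 i)))) ≤ -(β * norm1 (s i)) := by
      intro i
      have hcont : Continuous fun z' : NetState n p =>
          (z'.1 i - (e t).1 i) + μ • (z'.2 i - (e t).2 i) := by fun_prop
      have hval : ((z t).1 i - (e t).1 i) + μ • ((z t).2 i - (e t).2 i) = s i := by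
        rw [(he i).1, (he i).2]
        rfl
      have := hcont.tendsto (z t)
      rw [hval] at this
      filter_upwards [this.eventually (eventually_inner_sgn_eq (s i))] with z' hz'
      rw [hz']
    have h := hbound (fun i => -(β * norm1 (s i))) fun i =>
      filippov_networkField_snd hA hw i (s i) (hsgn i)
    refine h.trans (neg_le_neg (mul_le_mul_of_nonneg_left ?_ (inv_pos.2 hμ).le))
    rw [hnorm1, Finset.mul_sum, sub_eq_add_neg _ (∑ i, (_ + _)), ← Finset.sum_neg_distrib]
    refine add_le_add_right (Finset.sum_le_sum fun i _ => ?_) _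
    have h1 := norm_le_norm1 (s i)
    have h2 := mul_le_of_le_one_left (mul_nonneg hξ (norm_nonneg (s i))) (hγ.le_one i)
    have h3 := mul_le_mul_of_nonneg_right (gamMin_le (γ := γ) i)
      (mul_nonneg hβ (norm1_nonneg (s i)))
    have h4 := mul_le_mul_of_nonneg_left h1 hξ
    have h5 := mul_le_mul_of_nonneg_left h1 hkk
    simp only [hs] at *
    linarith

end ClosedLoop

/-! ### High-gain estimates -/

/-- One topology in the high-gain regime: `l`, `u`, `c` stand for `λ_min(X)`, `λ_max(X)`, `min γ`,
and the gain is `η = Q ^ 102`, where `Q` is a common bound of all other parameters and of the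
inverses of those that could be small. All estimates below then compare powers of `Q`. -/
structure HighGain (B : Bounds) (N l u c μ β Q η : ℝ) : Prop where
  Q_ge : 16 ≤ Q
  eta_eq : η = Q ^ 102
  l_inv : 1 ≤ Q * l
  l_le_u : l ≤ u
  u_le : u ≤ Q
  c_inv : 1 ≤ Q * c
  c_le : c ≤ 1
  mu_le : μ ≤ Q
  mu_inv : 1 ≤ Q * μ
  beta_nonneg : 0 ≤ β
  beta_le : β ≤ Q
  kp_le : B.kp ≤ Q
  ka_le : B.ka ≤ Q
  kb_le : B.kb ≤ Q
  kM_le : B.kM ≤ Q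
  kC_le : B.kC ≤ Q
  xi_le : B.ξ ≤ Q
  ka_inv : 1 ≤ Q * B.ka
  kb_inv : 1 ≤ Q * B.kb
  km_inv : 1 ≤ Q * (B.km - B.δ)
  N_le : N ≤ Q

theorem Bounds.xi_pos (B : Bounds) : 0 < B.ξ := by
  have := B.kg_pos; have := B.kz_nonneg; have := B.kM_pos; have := B.kq_pos
  rw [Bounds.ξ]; positivity

namespace HighGain

variable {B : Bounds} {N l u c μ β Q η : ℝ}

theorem Q_pos (h : HighGain B N l u c μ β Q η) : 0 < Q := by linarith [h.Q_ge]

theorem one_le_Q (h : HighGain B N l u c μ β Q η) : 1 ≤ Q := by linarith [h.Q_ge]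

theorem pos_of_inv (h : HighGain B N l u c μ β Q η) {v : ℝ} (hv : 1 ≤ Q * v) : 0 < v :=
  pos_of_mul_pos_right (zero_lt_one.trans_le hv) h.Q_pos.le

theorem l_pos (h : HighGain B N l u c μ β Q η) : 0 < l := h.pos_of_inv h.l_inv

theorem c_pos (h : HighGain B N l u c μ β Q η) : 0 < c := h.pos_of_inv h.c_inv

theorem mu_pos (h : HighGain B N l u c μ β Q η) : 0 < μ := h.pos_of_inv h.mu_inv

theorem u_pos (h : HighGain B N l u c μ β Q η) : 0 < u := h.l_pos.trans_le h.l_le_u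

theorem eta_pos (h : HighGain B N l u c μ β Q η) : 0 < η := by
  rw [h.eta_eq]; exact pow_pos h.Q_pos _

/-- Comparison of powers, with a numerical factor up to `16`. -/
theorem pow_succ_ge (h : HighGain B N l u c μ β Q η) {i k : ℕ} (hik : i < k) :
    16 * Q ^ i ≤ Q ^ k := by
  obtain ⟨j, rfl⟩ := Nat.exists_eq_add_of_lt hik
  have h1 : Q ^ i ≤ Q ^ (i + j) := pow_le_pow_right₀ h.one_le_Q (Nat.le_add_right i j)
  have h2 : 16 * Q ^ (i + j) ≤ Q * Q ^ (i + j) :=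
    mul_le_mul_of_nonneg_right h.Q_ge (pow_nonneg h.Q_pos.le _)
  rw [pow_succ]
  linarith

theorem one_le_pow (h : HighGain B N l u c μ β Q η) (k : ℕ) : 1 ≤ Q ^ k := one_le_pow₀ h.one_le_Q

/-- A factor `v ≥ Q⁻¹` costs one power of `Q` in a lower bound. -/
theorem pow_le_mul (h : HighGain B N l u c μ β Q η) {k : ℕ} {w v : ℝ} (hw : Q ^ (k + 1) ≤ w)
    (hv : 1 ≤ Q * v) : Q ^ k ≤ w * v := by
  have hv0 := h.pos_of_inv hv
  calc Q ^ k ≤ Q ^ k * (Q * v) := le_mul_of_one_le_right (pow_nonneg h.Q_pos.le _) hv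
    _ = Q ^ (k + 1) * v := by ring
    _ ≤ w * v := mul_le_mul_of_nonneg_right hw hv0.le

theorem pow_le_half (h : HighGain B N l u c μ β Q η) {k : ℕ} {w : ℝ} (hw : Q ^ (k + 1) ≤ w) :
    Q ^ k ≤ 1 / 2 * w := by
  have := h.pow_succ_ge (Nat.lt_succ_self k)
  have := pow_nonneg h.Q_pos.le k
  rw [Nat.succ_eq_add_one] at *
  linarith

theorem eta_mul_l_ge (h : HighGain B N l u c μ β Q η) : Q ^ 101 ≤ η * l :=
  h.pow_le_mul h.eta_eq.ge h.l_inv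

theorem A_ge (h : HighGain B N l u c μ β Q η) : Q ^ 100 ≤ 1 / 2 * η * l := by
  rw [mul_assoc]; exact h.pow_le_half h.eta_mul_l_ge

theorem A_mul_mu_sq_ge (h : HighGain B N l u c μ β Q η) : Q ^ 98 ≤ 1 / 2 * η * l * μ ^ 2 := by
  rw [sq, ← mul_assoc]
  exact h.pow_le_mul (h.pow_le_mul h.A_ge h.mu_inv) h.mu_inv

theorem min_mul_A_ge (h : HighGain B N l u c μ β Q η) :
    Q ^ 98 ≤ 1 / 2 * η * l * min 1 (μ ^ 2) := by
  rcases min_choice 1 (μ ^ 2) with e | e <;> rw [e]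
  · have := h.A_ge
    have := pow_le_pow_right₀ h.one_le_Q (show 98 ≤ 100 by norm_num)
    linarith
  · exact h.A_mul_mu_sq_ge

theorem mul_le_sq (h : HighGain B N l u c μ β Q η) {v w : ℝ} (hw0 : 0 ≤ w) (hv : v ≤ Q)
    (hw : w ≤ Q) : v * w ≤ Q ^ 2 := by
  rw [sq]; exact mul_le_mul hv hw hw0 h.Q_pos.le

theorem kC_mul_kp_le (h : HighGain B N l u c μ β Q η) : B.kC * B.kp ≤ Q ^ 2 :=
  h.mul_le_sq B.kp_pos.le h.kC_le h.kp_le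

theorem mu_mul_kC_mul_kp_le (h : HighGain B N l u c μ β Q η) : μ * B.kC * B.kp ≤ Q ^ 3 := by
  rw [mul_assoc, pow_succ' Q 2]
  exact mul_le_mul h.mu_le h.kC_mul_kp_le (mul_pos B.kC_pos B.kp_pos).le h.Q_pos.le

theorem disturbance_le (h : HighGain B N l u c μ β Q η) :
    β + B.kC * B.kp ^ 2 + B.ξ ≤ Q ^ 4 := by
  have h1 : B.kC * B.kp ^ 2 ≤ Q ^ 3 := by
    rw [sq, ← mul_assoc, pow_succ]
    exact mul_le_mul h.kC_mul_kp_le h.kp_le B.kp_pos.le (by have := h.Q_pos; positivity)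
  have h2 := h.pow_succ_ge (show 3 < 4 by norm_num)
  have h3 := h.pow_succ_ge (show 1 < 3 by norm_num)
  have h4 := h.beta_le
  have h5 := h.xi_le
  have h6 := h.Q_pos
  rw [pow_one] at h3
  linarith

theorem phi_eq : phi B l μ η = 1 / 2 * η * l * μ ^ 2 - μ * B.kC * B.kp - B.kM := by
  rw [phi]; ring

/-- The terms of the derivative of the Lyapunov function that are quadratic up to the cubic
Coriolis term, which is harmless as long as `x` stays below a power of `Q`. -/
theorem quadratic_part_ge (h : HighGain B N l u c μ β Q η) {x y : ℝ} (hx : 0 ≤ x)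
    (hy : 0 ≤ y) (hxR : x ≤ Q ^ 7) :
    3 / 4 * (1 / 2 * η * l) * x ^ 2 + 3 / 4 * (1 / 2 * η * l * μ ^ 2) * y ^ 2
      ≤ phi B l μ η * y ^ 2 + 1 / 2 * η * l * x ^ 2 - 2 * B.kC * B.kp * x * y
        - B.kC * x * y ^ 2 := by
  have hQ := h.Q_pos
  have h1 : 2 * B.kC * B.kp * x * y ≤ Q ^ 2 * (x ^ 2 + y ^ 2) := by
    have h1 : 2 * x * y ≤ x ^ 2 + y ^ 2 := two_mul_le_add_sq x y
    calc 2 * B.kC * B.kp * x * y = (B.kC * B.kp) * (2 * x * y) := by ring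
      _ ≤ Q ^ 2 * (x ^ 2 + y ^ 2) :=
        mul_le_mul h.kC_mul_kp_le h1 (by positivity) (by positivity)
  have h2 : B.kC * x * y ^ 2 ≤ Q ^ 8 * y ^ 2 := by
    refine mul_le_mul_of_nonneg_right ?_ (sq_nonneg y)
    rw [pow_succ' Q 7]
    exact mul_le_mul h.kC_le hxR hx hQ.le
  have h3 := h.mu_mul_kC_mul_kp_le
  have h4 := h.kM_le
  have h5 : Q ^ 2 ≤ 1 / 4 * (1 / 2 * η * l) := by
    have := h.pow_succ_ge (show 2 < 100 by norm_num)
    have := h.A_ge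
    have := pow_pos hQ 2
    linarith
  have h6 : μ * B.kC * B.kp + B.kM + Q ^ 2 + Q ^ 8 ≤ 1 / 4 * (1 / 2 * η * l * μ ^ 2) := by
    have := h.pow_succ_ge (show 8 < 98 by norm_num)
    have := h.A_mul_mu_sq_ge
    have := h.pow_succ_ge (show 1 < 8 by norm_num)
    have := h.pow_succ_ge (show 2 < 8 by norm_num)
    have := h.pow_succ_ge (show 3 < 8 by norm_num)
    have := pow_pos hQ 8
    rw [pow_one] at *
    linarith
  have h7 := mul_le_mul_of_nonneg_right h5 (sq_nonneg x)
  have h8 := mul_le_mul_of_nonneg_right h6 (sq_nonneg y)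
  rw [phi_eq]
  linarith

/-- The guaranteed decay rate of the Lyapunov function in the high-gain regime. -/
noncomputable def rate (l μ η : ℝ) : ℝ := μ⁻¹ * (1 / 2 * η * l * min 1 (μ ^ 2))

/-- The residual of the high-gain decay estimate, which is left when the disturbance, at most
`Q ^ 5 (x + μ y)`, is absorbed into the quadratic terms by Young's inequality. -/
noncomputable def residual (l μ Q η : ℝ) : ℝ := μ⁻¹ * (2 * (Q ^ 5) ^ 2 / (1 / 2 * η * l))

theorem rate_pos (h : HighGain B N l u c μ β Q η) : 0 < rate l μ η :=
  mul_pos (inv_pos.2 h.mu_pos) ((pow_pos h.Q_pos 98).trans_le h.min_mul_A_ge)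

theorem residual_nonneg (h : HighGain B N l u c μ β Q η) : 0 ≤ residual l μ Q η := by
  have := h.mu_pos; have := h.eta_pos; have := h.l_pos
  rw [residual]; positivity

/-- Without any information on the observer, the Lyapunov function decreases up to a small
residual. The variable `s` stands for `‖x + μ y‖₁`, and `N` for the number of coordinates. -/
theorem crude_decay (h : HighGain B N l u c μ β Q η) {x y s : ℝ} (hx : 0 ≤ x) (hy : 0 ≤ y)
    (hxR : x ≤ Q ^ 7) (hs : s ≤ N * (x + μ * y)) (hs0 : 0 ≤ s) :
    -(μ⁻¹ * (phi B l μ η * y ^ 2 + 1 / 2 * η * l * x ^ 2 - 2 * B.kC * B.kp * x * y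
        - B.kC * x * y ^ 2 - (β + B.kC * B.kp ^ 2 + B.ξ) * s))
      ≤ -(1 / 2 * rate l μ η) * (x ^ 2 + y ^ 2) + residual l μ Q η := by
  have hQ := h.Q_pos
  have hμ := h.mu_pos
  have hq := h.quadratic_part_ge hx hy hxR
  have hA0 : 0 < 1 / 2 * η * l := (pow_pos hQ 100).trans_le h.A_ge
  rw [rate, residual]
  set A := 1 / 2 * η * l with hA
  have hd : (β + B.kC * B.kp ^ 2 + B.ξ) * s ≤ Q ^ 5 * (x + μ * y) := by
    have h1 : s ≤ Q * (x + μ * y) :=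
      hs.trans (mul_le_mul_of_nonneg_right h.N_le (by positivity))
    calc (β + B.kC * B.kp ^ 2 + B.ξ) * s ≤ Q ^ 4 * (Q * (x + μ * y)) :=
          mul_le_mul h.disturbance_le h1 hs0 (by positivity)
      _ = Q ^ 5 * (x + μ * y) := by ring
  have young : ∀ v : ℝ, Q ^ 5 * v ≤ A / 4 * v ^ 2 + (Q ^ 5) ^ 2 / A := by
    intro v
    have : A / 4 * v ^ 2 + (Q ^ 5) ^ 2 / A - Q ^ 5 * v = (A * v / 2 - Q ^ 5) ^ 2 / A := by
      field_simp; ring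
    have h2 : 0 ≤ (A * v / 2 - Q ^ 5) ^ 2 / A := by positivity
    linarith
  have y1 := young x
  have y2 := young (μ * y)
  have hm1 : A * min 1 (μ ^ 2) * x ^ 2 ≤ A * x ^ 2 := by
    refine mul_le_mul_of_nonneg_right ?_ (sq_nonneg x)
    exact mul_le_of_le_one_right hA0.le (min_le_left _ _)
  have hm2 : A * min 1 (μ ^ 2) * y ^ 2 ≤ A * μ ^ 2 * y ^ 2 := by
    refine mul_le_mul_of_nonneg_right ?_ (sq_nonneg y)
    exact mul_le_mul_of_nonneg_left (min_le_right _ _) hA0.le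
  have hfin : 1 / 2 * (A * min 1 (μ ^ 2)) * (x ^ 2 + y ^ 2) - 2 * (Q ^ 5) ^ 2 / A
      ≤ phi B l μ η * y ^ 2 + A * x ^ 2 - 2 * B.kC * B.kp * x * y
        - B.kC * x * y ^ 2 - (β + B.kC * B.kp ^ 2 + B.ξ) * s := by
    have : 2 * (Q ^ 5) ^ 2 / A = (Q ^ 5) ^ 2 / A + (Q ^ 5) ^ 2 / A := by ring
    linarith [show (μ * y) ^ 2 = μ ^ 2 * y ^ 2 by ring,
      show A / 4 * (μ * y) ^ 2 = 1 / 4 * (A * μ ^ 2 * y ^ 2) by ring]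
  have := mul_le_mul_of_nonneg_left hfin (inv_pos.2 hμ).le
  linarith

/-- The residual is small against the decay rate. -/
theorem residual_div_le (h : HighGain B N l u c μ β Q η) {L : ℝ} (hL0 : 0 < L)
    (hL : L ≤ η * Q ^ 2) : residual l μ Q η / (1 / 2 * rate l μ η / L) ≤ 1 := by
  have hQ := h.Q_pos
  have hμ := h.mu_pos
  have hη := h.eta_pos
  have hA0 : 0 < 1 / 2 * η * l := (pow_pos hQ 100).trans_le h.A_ge
  have hm := h.min_mul_A_ge
  have hr := h.rate_pos
  rw [div_le_one (by positivity), le_div_iff₀ hL0, residual, rate]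
  have hLA : L ≤ 2 * Q ^ 3 * (1 / 2 * η * l) := by
    refine hL.trans ?_
    calc η * Q ^ 2 ≤ η * Q ^ 2 * (Q * l) := le_mul_of_one_le_right (by positivity) h.l_inv
      _ = _ := by ring
  set A := 1 / 2 * η * l with hA
  have h1 : 2 * (Q ^ 5) ^ 2 / A * L ≤ 1 / 2 * (A * min 1 (μ ^ 2)) := by
    calc 2 * (Q ^ 5) ^ 2 / A * L ≤ 2 * (Q ^ 5) ^ 2 / A * (2 * Q ^ 3 * A) := by gcongr
      _ = 4 * Q ^ 13 := by field_simp; ring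
      _ ≤ 1 / 2 * Q ^ 98 := by
        have := h.pow_succ_ge (show 13 < 98 by norm_num)
        have := pow_pos hQ 13
        linarith
      _ ≤ _ := by linarith
  calc μ⁻¹ * (2 * (Q ^ 5) ^ 2 / A) * L = μ⁻¹ * (2 * (Q ^ 5) ^ 2 / A * L) := by ring
    _ ≤ μ⁻¹ * (1 / 2 * (A * min 1 (μ ^ 2))) := by gcongr
    _ = _ := by ring

/-- A decay constant cannot exceed the guaranteed rate by more than the factor `2`: test it with
position and velocity errors along a coordinate axis. -/
theorem decayConstant_le (h : HighGain B N l u c μ β Q η) {a₃ : ℝ}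
    (h1 : -(μ⁻¹ * (1 / 2 * η * l * B.ka ^ 2 + (β * c - B.kC * B.kp ^ 2 - B.ξ) * B.ka))
      ≤ -(a₃ * B.ka ^ 2))
    (h2 : -(μ⁻¹ * (phi B l μ η * B.kb ^ 2 + (β * c - B.kC * B.kp ^ 2 - B.ξ) * (μ * B.kb)))
      ≤ -(a₃ * B.kb ^ 2)) :
    a₃ ≤ 2 * rate l μ η := by
  have hQ := h.Q_pos
  have hμ := h.mu_pos
  have hka := B.ka_pos
  have hkb := B.kb_pos
  have hA0 : 0 < 1 / 2 * η * l := (pow_pos hQ 100).trans_le h.A_ge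
  have hb : β * c - B.kC * B.kp ^ 2 - B.ξ ≤ Q := by
    have h3 := mul_le_of_le_one_right h.beta_nonneg h.c_le
    have h4 := mul_nonneg B.kC_pos.le (sq_nonneg B.kp)
    linarith [B.xi_pos, h.beta_le]
  have hQk : ∀ k : ℕ, 1 < k → Q ≤ Q ^ k := fun k hk => by
    have := h.pow_succ_ge hk
    rw [pow_one] at this
    linarith
  have hA1 : Q ≤ 1 / 2 * η * l * B.ka :=
    (hQk 99 (by norm_num)).trans (h.pow_le_mul h.A_ge h.ka_inv)
  have hA2 : Q ≤ 1 / 2 * η * l * μ * B.kb :=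
    (hQk 98 (by norm_num)).trans (h.pow_le_mul (h.pow_le_mul h.A_ge h.mu_inv) h.kb_inv)
  rw [rate, phi_eq] at *
  set A := 1 / 2 * η * l with hA
  set b := β * c - B.kC * B.kp ^ 2 - B.ξ with hbdef
  have e1 : a₃ ≤ μ⁻¹ * (2 * A) := by
    refine le_of_mul_le_mul_right ?_ (pow_pos hka 2)
    have : b * B.ka ≤ A * B.ka * B.ka := mul_le_mul_of_nonneg_right (hb.trans hA1) hka.le
    have := mul_le_mul_of_nonneg_left this (inv_pos.2 hμ).le
    linarith
  have e2 : a₃ ≤ μ⁻¹ * (2 * (A * μ ^ 2)) := by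
    refine le_of_mul_le_mul_right ?_ (pow_pos hkb 2)
    have h3 : b * (μ * B.kb) ≤ A * μ * B.kb * (μ * B.kb) :=
      mul_le_mul_of_nonneg_right (hb.trans hA2) (by positivity)
    have h4 : 0 ≤ (μ * B.kC * B.kp + B.kM) * B.kb ^ 2 := by
      have := B.kC_pos; have := B.kp_pos; have := B.kM_pos
      positivity
    have := mul_le_mul_of_nonneg_left (show (A * μ ^ 2 - μ * B.kC * B.kp - B.kM) * B.kb ^ 2
      + b * (μ * B.kb) ≤ 2 * (A * μ ^ 2) * B.kb ^ 2 by linarith) (inv_pos.2 hμ).le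
    linarith
  rcases min_choice 1 (μ ^ 2) with e | e <;> rw [e] <;> linarith

/-! ### The region of the decay condition -/

section Box

variable {ν : ℝ}

theorem rhoPos_le (h : HighGain B N l u c μ β Q η) : rhoPos B l c η ν ≤ 1 / 4 * η * l := by
  have := h.c_pos
  have := sub_pos.2 B.δ_lt
  have : 0 ≤ 1 / 2 * (ν ^ 2)⁻¹ * c * (B.km - B.δ) := by positivity
  rw [rhoPos]
  linarith

theorem inv_nu_sq_mul_le (h : HighGain B N l u c μ β Q η) (hν : 2 * c * (B.km - B.δ) / l < ν ^ 2) :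
    (ν ^ 2)⁻¹ * (c * (B.km - B.δ)) ≤ l / 2 := by
  have hc := h.c_pos
  have hl := h.l_pos
  have hd := sub_pos.2 B.δ_lt
  have hν2 : 0 < ν ^ 2 := lt_of_le_of_lt (by positivity) hν
  rw [inv_mul_le_iff₀ hν2]
  rw [div_lt_iff₀ hl] at hν
  linarith

theorem rhoPos_ge (h : HighGain B N l u c μ β Q η) (hν : 2 * c * (B.km - B.δ) / l < ν ^ 2) :
    1 / 8 * η * l ≤ rhoPos B l c η ν := by
  have h1 := h.inv_nu_sq_mul_le hν
  have h2 : 2 * l ≤ η * l := by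
    refine mul_le_mul_of_nonneg_right ?_ h.l_pos.le
    rw [h.eta_eq]
    linarith [h.pow_succ_ge (show 0 < 102 by norm_num)]
  rw [rhoPos]
  linarith

theorem rhoVel_le (h : HighGain B N l u c μ β Q η) :
    rhoVel B l c η ν ≤ 1 / 2 * c * (B.km - B.δ) := by
  have := h.l_pos
  have := h.eta_pos
  have : 0 ≤ (1 / 2 * ν⁻¹ * c * (B.km - B.δ)) ^ 2 / (η * (1 / 4) * l) := by positivity
  rw [rhoVel]
  linarith

theorem rhoVel_ge (h : HighGain B N l u c μ β Q η) (hν : 2 * c * (B.km - B.δ) / l < ν ^ 2) :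
    1 / 4 * c * (B.km - B.δ) ≤ rhoVel B l c η ν := by
  have h1 := h.inv_nu_sq_mul_le hν
  have hl := h.l_pos
  have hη := h.eta_pos
  have hcd := mul_pos h.c_pos (sub_pos.2 B.δ_lt)
  have h2 : (1 / 2 * ν⁻¹ * c * (B.km - B.δ)) ^ 2 / (η * (1 / 4) * l)
      ≤ 1 / 4 * c * (B.km - B.δ) := by
    rw [div_le_iff₀ (by positivity)]
    have hη2 : (2 : ℝ) ≤ η := by
      rw [h.eta_eq]
      linarith [h.pow_succ_ge (show 0 < 102 by norm_num)]
    calc (1 / 2 * ν⁻¹ * c * (B.km - B.δ)) ^ 2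
        = 1 / 4 * ((ν ^ 2)⁻¹ * (c * (B.km - B.δ))) * (c * (B.km - B.δ)) := by
          rw [← inv_pow]; ring
      _ ≤ 1 / 4 * (l / 2) * (c * (B.km - B.δ)) := by gcongr
      _ ≤ 1 / 16 * η * l * (c * (B.km - B.δ)) := by
          refine mul_le_mul_of_nonneg_right ?_ hcd.le
          nlinarith
      _ = _ := by ring
  rw [rhoVel]
  linarith

theorem rhoVel_pos (h : HighGain B N l u c μ β Q η) (hν : 2 * c * (B.km - B.δ) / l < ν ^ 2) :
    0 < rhoVel B l c η ν := by
  have := h.c_pos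
  have := sub_pos.2 B.δ_lt
  exact lt_of_lt_of_le (by positivity) (h.rhoVel_ge hν)

theorem rhoPos_pos (h : HighGain B N l u c μ β Q η) (hν : 2 * c * (B.km - B.δ) / l < ν ^ 2) :
    0 < rhoPos B l c η ν := by
  have := h.l_pos
  have := h.eta_pos
  exact lt_of_lt_of_le (by positivity) (h.rhoPos_ge hν)

theorem upperV_mono (h : HighGain B N l u c μ β Q η) (hν0 : 0 < ν) {x y x' y' : ℝ} (hx : 0 ≤ x)
    (hy : 0 ≤ y) (hxx : x ≤ x') (hyy : y ≤ y') : upperV B u η ν x y ≤ upperV B u η ν x' y' := by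
  have := h.u_pos; have := h.eta_pos; have := B.kM_pos; have := B.δ_pos
  have := hx.trans hxx
  unfold upperV
  gcongr

theorem upperV_initial_ge (h : HighGain B N l u c μ β Q η) (hν0 : 0 < ν) :
    η * l * B.ka ^ 2 + 1 / 2 * B.kM * B.kb ^ 2 ≤ upperV B u η ν B.ka B.kb := by
  have := h.eta_pos; have hkM := B.kM_pos; have hδ := B.δ_pos
  have := B.ka_pos; have := B.kb_pos
  have h1 : η * l * B.ka ^ 2 ≤ η * u * B.ka ^ 2 := by
    have := h.l_le_u
    gcongr
  have h2 : 0 ≤ ν⁻¹ * (B.kM + B.δ) * B.ka * B.kb := by positivity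
  have h3 : 0 ≤ 1 / 2 * B.δ * B.kb ^ 2 := by positivity
  rw [upperV]
  linarith

theorem ka_le_sqrt (h : HighGain B N l u c μ β Q η) (hν0 : 0 < ν)
    (hν : 2 * c * (B.km - B.δ) / l < ν ^ 2) :
    B.ka ≤ √(upperV B u η ν B.ka B.kb / rhoPos B l c η ν) := by
  refine Real.le_sqrt_of_sq_le ?_
  rw [le_div_iff₀ (h.rhoPos_pos hν)]
  have h1 := h.upperV_initial_ge (ν := ν) hν0
  have h2 := mul_le_mul_of_nonneg_left (h.rhoPos_le (ν := ν)) (sq_nonneg B.ka)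
  have h3 : 0 ≤ η * l * B.ka ^ 2 := by
    have := h.eta_pos; have := h.l_pos; positivity
  have h4 : 0 ≤ 1 / 2 * B.kM * B.kb ^ 2 := by have := B.kM_pos; positivity
  linarith

theorem kb_le_sqrt (h : HighGain B N l u c μ β Q η) (hν0 : 0 < ν)
    (hν : 2 * c * (B.km - B.δ) / l < ν ^ 2) :
    B.kb ≤ √(upperV B u η ν B.ka B.kb / rhoVel B l c η ν) := by
  refine Real.le_sqrt_of_sq_le ?_
  rw [le_div_iff₀ (h.rhoVel_pos hν)]
  have h1 := h.upperV_initial_ge (ν := ν) hν0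
  have h2 := mul_le_mul_of_nonneg_left (h.rhoVel_le (ν := ν)) (sq_nonneg B.kb)
  have h3 : 0 ≤ η * l * B.ka ^ 2 := by
    have := h.eta_pos; have := h.l_pos; positivity
  have hd := sub_pos.2 B.δ_lt
  have h5 : c * (B.km - B.δ) ≤ B.kM :=
    (mul_le_of_le_one_left hd.le h.c_le).trans (by linarith [B.km_le_kM, B.δ_pos])
  have h6 := mul_le_mul_of_nonneg_left h5 (show 0 ≤ 1 / 2 * B.kb ^ 2 by positivity)
  linarith

theorem upperV_le_hatV (h : HighGain B N l u c μ β Q η) (hν0 : 0 < ν)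
    (hν : 2 * c * (B.km - B.δ) / l < ν ^ 2) :
    upperV B u η ν B.ka B.kb ≤ hatV B l u c η ν :=
  h.upperV_mono hν0 B.ka_pos.le B.kb_pos.le (h.ka_le_sqrt hν0 hν) (h.kb_le_sqrt hν0 hν)

theorem ka_le_boxPos (h : HighGain B N l u c μ β Q η) (hν0 : 0 < ν)
    (hν : 2 * c * (B.km - B.δ) / l < ν ^ 2) : B.ka ≤ boxPos B l u c η ν :=
  (h.ka_le_sqrt hν0 hν).trans (Real.sqrt_le_sqrt
    (div_le_div_of_nonneg_right (h.upperV_le_hatV hν0 hν) (h.rhoPos_pos hν).le))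

theorem sqrt_le_boxVel (h : HighGain B N l u c μ β Q η) (hν0 : 0 < ν)
    (hν : 2 * c * (B.km - B.δ) / l < ν ^ 2) :
    √(upperV B u η ν B.ka B.kb / rhoVel B l c η ν) ≤ boxVel B l u c η ν :=
  Real.sqrt_le_sqrt
    (div_le_div_of_nonneg_right (h.upperV_le_hatV hν0 hν) (h.rhoVel_pos hν).le)

theorem kb_le_boxVel (h : HighGain B N l u c μ β Q η) (hν0 : 0 < ν)
    (hν : 2 * c * (B.km - B.δ) / l < ν ^ 2) : B.kb ≤ boxVel B l u c η ν :=
  (h.kb_le_sqrt hν0 hν).trans (h.sqrt_le_boxVel hν0 hν)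

theorem cd_le (h : HighGain B N l u c μ β Q η) : c * (B.km - B.δ) ≤ Q :=
  (mul_le_of_le_one_left (sub_pos.2 B.δ_lt).le h.c_le).trans
    (by linarith [B.km_le_kM, B.δ_pos, h.kM_le])

/-- The admissible velocity errors grow with the square root of `η`: `𝒴₁ ^ 2` is at least
`η l k_a ^ 2` over `½ c (k_m - δ)`. -/
theorem le_boxVel (h : HighGain B N l u c μ β Q η) (hν0 : 0 < ν)
    (hν : 2 * c * (B.km - B.δ) / l < ν ^ 2) {y : ℝ} (hy : y ^ 2 ≤ Q ^ 98) :
    y ≤ boxVel B l u c η ν := by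
  refine le_trans (Real.le_sqrt_of_sq_le ?_) (h.sqrt_le_boxVel hν0 hν)
  refine hy.trans ?_
  rw [le_div_iff₀ (h.rhoVel_pos hν)]
  have hQ := h.Q_pos
  have h1 := h.upperV_initial_ge (ν := ν) hν0
  have h4 : 0 ≤ 1 / 2 * B.kM * B.kb ^ 2 := by have := B.kM_pos; positivity
  have h5 : Q ^ 99 ≤ η * l * B.ka ^ 2 := by
    rw [sq, ← mul_assoc]
    exact h.pow_le_mul (h.pow_le_mul h.eta_mul_l_ge h.ka_inv) h.ka_inv
  have h6 : rhoVel B l c η ν ≤ Q := by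
    have := h.rhoVel_le (ν := ν)
    have := h.cd_le
    linarith
  calc Q ^ 98 * rhoVel B l c η ν ≤ Q ^ 98 * Q := by gcongr
    _ = Q ^ 99 := by ring
    _ ≤ _ := by linarith

/-- The admissible position errors, in contrast, are bounded by a power of `Q` that does not involve
`η`, so that the cubic Coriolis term is dominated in the whole region. -/
theorem boxPos_le (h : HighGain B N l u c μ β Q η) (hν0 : 0 < ν)
    (hν : 2 * c * (B.km - B.δ) / l < ν ^ 2) : boxPos B l u c η ν ≤ Q ^ 7 := by
  have hQ := h.Q_pos
  have hη := h.eta_pos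
  have hl := h.l_pos
  have hu := h.u_pos
  have hc := h.c_pos
  have hd := sub_pos.2 B.δ_lt
  have hka := B.ka_pos
  have hkb := B.kb_pos
  have hh0 : 0 < B.kM + B.δ := add_pos B.kM_pos B.δ_pos
  have hh : B.kM + B.δ ≤ 2 * Q := by linarith [h.kM_le, B.δ_lt, B.km_le_kM]
  have hηQ : Q ^ 8 ≤ η := by
    rw [h.eta_eq]; exact pow_le_pow_right₀ h.one_le_Q (by norm_num)
  have hcd : 1 ≤ Q ^ 2 * (c * (B.km - B.δ)) := by
    calc (1 : ℝ) ≤ (Q * c) * (Q * (B.km - B.δ)) :=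
          one_le_mul_of_one_le_of_one_le h.c_inv h.km_inv
      _ = _ := by ring
  have hνinv : ν⁻¹ ≤ Q ^ 2 := by
    refine le_of_sq_le_sq ?_ (by positivity)
    rw [inv_pow]
    calc (ν ^ 2)⁻¹ ≤ (ν ^ 2)⁻¹ * (Q ^ 2 * (c * (B.km - B.δ))) :=
          le_mul_of_one_le_right (by positivity) hcd
      _ = Q ^ 2 * ((ν ^ 2)⁻¹ * (c * (B.km - B.δ))) := by ring
      _ ≤ Q ^ 2 * (l / 2) := by gcongr; exact h.inv_nu_sq_mul_le hν
      _ ≤ Q ^ 2 * Q ^ 2 := by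
          gcongr
          have := h.l_le_u.trans h.u_le
          have := h.pow_succ_ge (show 1 < 2 by norm_num)
          rw [pow_one] at this
          linarith
      _ = (Q ^ 2) ^ 2 := by ring
  have hcross : ∀ x y : ℝ, 0 ≤ x → 0 ≤ y →
      ν⁻¹ * (B.kM + B.δ) * x * y ≤ Q ^ 3 * (x ^ 2 + y ^ 2) := by
    intro x y hx hy
    calc ν⁻¹ * (B.kM + B.δ) * x * y ≤ Q ^ 2 * (2 * Q) * x * y := by gcongr
      _ = Q ^ 3 * (2 * x * y) := by ring
      _ ≤ Q ^ 3 * (x ^ 2 + y ^ 2) := by gcongr; exact two_mul_le_add_sq x y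
  have hup : ∀ x y : ℝ, 0 ≤ x → 0 ≤ y →
      upperV B u η ν x y ≤ 2 * (η * Q) * x ^ 2 + 2 * Q ^ 3 * y ^ 2 := by
    intro x y hx hy
    have h1 := hcross x y hx hy
    have h2 : η * u * x ^ 2 ≤ η * Q * x ^ 2 := by
      have := h.u_le
      gcongr
    have h3 : 1 / 2 * (B.kM + B.δ) * y ^ 2 ≤ Q ^ 3 * y ^ 2 := by
      refine mul_le_mul_of_nonneg_right ?_ (sq_nonneg y)
      have := h.pow_succ_ge (show 1 < 3 by norm_num)
      rw [pow_one] at this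
      linarith
    have h4 : Q ^ 3 * x ^ 2 ≤ η * Q * x ^ 2 := by
      refine mul_le_mul_of_nonneg_right ?_ (sq_nonneg x)
      have h5 : Q ^ 3 ≤ Q ^ 8 := pow_le_pow_right₀ h.one_le_Q (by norm_num)
      exact (h5.trans hηQ).trans (le_mul_of_one_le_right hη.le h.one_le_Q)
    rw [upperV]
    linarith
  have hV : upperV B u η ν B.ka B.kb ≤ η * Q ^ 4 := by
    refine (hup _ _ hka.le hkb.le).trans ?_
    have h1 : B.ka ^ 2 ≤ Q ^ 2 := pow_le_pow_left₀ hka.le h.ka_le 2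
    have h2 : B.kb ^ 2 ≤ Q ^ 2 := pow_le_pow_left₀ hkb.le h.kb_le 2
    have h3 : 2 * (η * Q) * B.ka ^ 2 ≤ 2 * (η * Q) * Q ^ 2 := by gcongr
    have h4 : 2 * Q ^ 3 * B.kb ^ 2 ≤ 2 * Q ^ 3 * Q ^ 2 := by gcongr
    have h5 : 16 * (η * Q ^ 3) ≤ η * Q ^ 4 := by
      have := mul_le_mul_of_nonneg_left (h.pow_succ_ge (show 3 < 4 by norm_num)) hη.le
      linarith
    have h6 : Q ^ 5 ≤ η * Q ^ 3 := by
      have h7 : Q ^ 5 ≤ Q ^ 8 := pow_le_pow_right₀ h.one_le_Q (by norm_num)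
      exact (h7.trans hηQ).trans (le_mul_of_one_le_right hη.le (h.one_le_pow 3))
    have h7 : 0 < η * Q ^ 3 := by positivity
    nlinarith
  have hx1 : upperV B u η ν B.ka B.kb / rhoPos B l c η ν ≤ Q ^ 6 := by
    rw [div_le_iff₀ (h.rhoPos_pos hν)]
    refine hV.trans ?_
    calc η * Q ^ 4 ≤ η * Q ^ 4 * (Q * l) := le_mul_of_one_le_right (by positivity) h.l_inv
      _ = Q ^ 5 * (η * l) := by ring
      _ ≤ Q ^ 6 / 8 * (η * l) := by
          have := h.pow_succ_ge (show 5 < 6 by norm_num)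
          have := pow_pos hQ 5
          gcongr
          linarith
      _ = Q ^ 6 * (1 / 8 * η * l) := by ring
      _ ≤ _ := by gcongr; exact h.rhoPos_ge hν
  have hy1 : upperV B u η ν B.ka B.kb / rhoVel B l c η ν ≤ η * Q ^ 7 := by
    rw [div_le_iff₀ (h.rhoVel_pos hν)]
    refine hV.trans ?_
    calc η * Q ^ 4 ≤ η * Q ^ 4 * (Q ^ 2 * (c * (B.km - B.δ))) :=
          le_mul_of_one_le_right (by positivity) hcd
      _ = Q ^ 6 * (η * (c * (B.km - B.δ))) := by ring
      _ ≤ Q ^ 7 / 4 * (η * (c * (B.km - B.δ))) := by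
          have := h.pow_succ_ge (show 6 < 7 by norm_num)
          have := pow_pos hQ 6
          gcongr
          linarith
      _ = η * Q ^ 7 * (1 / 4 * c * (B.km - B.δ)) := by ring
      _ ≤ _ := by gcongr; exact h.rhoVel_ge hν
  have hVnn : 0 ≤ upperV B u η ν B.ka B.kb := by
    refine le_trans ?_ (h.upperV_initial_ge hν0)
    have := B.kM_pos
    positivity
  have hhat : hatV B l u c η ν ≤ η * Q ^ 11 := by
    refine (hup _ _ (Real.sqrt_nonneg _) (Real.sqrt_nonneg _)).trans ?_
    rw [Real.sq_sqrt (div_nonneg hVnn (h.rhoPos_pos hν).le),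
      Real.sq_sqrt (div_nonneg hVnn (h.rhoVel_pos hν).le)]
    have h1 := mul_le_mul_of_nonneg_left hx1 (show 0 ≤ 2 * (η * Q) by positivity)
    have h2 := mul_le_mul_of_nonneg_left hy1 (show 0 ≤ 2 * Q ^ 3 by positivity)
    have h3 := mul_le_mul_of_nonneg_left (h.pow_succ_ge (show 10 < 11 by norm_num)) hη.le
    have h4 := mul_le_mul_of_nonneg_left (h.pow_succ_ge (show 7 < 11 by norm_num)) hη.le
    have h5 : 0 < η * Q ^ 10 := by positivity
    have h6 : 0 < η * Q ^ 7 := by positivity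
    linarith [show 2 * (η * Q) * Q ^ 6 = 2 * (η * Q ^ 7) by ring,
      show 2 * Q ^ 3 * (η * Q ^ 7) = 2 * (η * Q ^ 10) by ring]
  rw [boxPos]
  refine Real.sqrt_le_iff.2 ⟨by positivity, ?_⟩
  rw [div_le_iff₀ (h.rhoPos_pos hν)]
  refine hhat.trans ?_
  calc η * Q ^ 11 ≤ η * Q ^ 11 * (Q * l) := le_mul_of_one_le_right (by positivity) h.l_inv
    _ = Q ^ 12 * (η * l) := by ring
    _ ≤ Q ^ 14 / 8 * (η * l) := by
        have := h.pow_succ_ge (show 12 < 14 by norm_num)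
        have := pow_pos hQ 12
        gcongr
        linarith
    _ = (Q ^ 7) ^ 2 * (1 / 8 * η * l) := by ring
    _ ≤ _ := by gcongr; exact h.rhoPos_ge hν

end Box

/-! ### Comparison with `η ‖x‖² + ‖y‖²` -/

theorem le_of_upper_bound (h : HighGain B N l u c μ β Q η) {x y w v : ℝ}
    (hw : w ≤ 2 * y ^ 2 + 2 * μ⁻¹ ^ 2 * x ^ 2)
    (hv : v ≤ 1 / 2 * η * u * x ^ 2 + 1 / 2 * B.kM * w) : v ≤ Q * (η * x ^ 2 + y ^ 2) := by
  have hQ := h.Q_pos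
  have hη := h.eta_pos
  have hinv : μ⁻¹ ≤ Q := by
    rw [inv_le_iff_one_le_mul₀ h.mu_pos]; exact h.mu_inv
  have hinv2 : μ⁻¹ ^ 2 ≤ Q ^ 2 := pow_le_pow_left₀ (inv_pos.2 h.mu_pos).le hinv 2
  have h1 : 1 / 2 * B.kM * w ≤ 1 / 2 * B.kM * (2 * y ^ 2 + 2 * μ⁻¹ ^ 2 * x ^ 2) := by
    have := B.kM_pos
    gcongr
  have h2 : 1 / 2 * B.kM * (2 * y ^ 2 + 2 * μ⁻¹ ^ 2 * x ^ 2)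
      ≤ 1 / 2 * Q * (2 * y ^ 2 + 2 * Q ^ 2 * x ^ 2) := by
    have := h.kM_le
    have := B.kM_pos
    gcongr
  have h3 : 1 / 2 * η * u * x ^ 2 ≤ 1 / 2 * η * Q * x ^ 2 := by
    have := h.u_le
    gcongr
  have h4 : Q ^ 3 * x ^ 2 ≤ 1 / 2 * η * Q * x ^ 2 := by
    refine mul_le_mul_of_nonneg_right ?_ (sq_nonneg x)
    have h5 := h.pow_succ_ge (show 2 < 102 by norm_num)
    rw [← h.eta_eq] at h5
    nlinarith [pow_pos hQ 2]
  linarith [show 1 / 2 * Q * (2 * y ^ 2 + 2 * Q ^ 2 * x ^ 2) = Q * y ^ 2 + Q ^ 3 * x ^ 2 by ring]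

theorem le_of_lower_bound (h : HighGain B N l u c μ β Q η) {x y w v : ℝ} (hw0 : 0 ≤ w)
    (hw : y ^ 2 ≤ 2 * w + 2 * μ⁻¹ ^ 2 * x ^ 2)
    (hv : 1 / 4 * η * l * x ^ 2 + 1 / 2 * (c * B.km) * w ≤ v) :
    η * x ^ 2 + y ^ 2 ≤ Q ^ 3 * v := by
  have hQ := h.Q_pos
  have hη := h.eta_pos
  have hinv : μ⁻¹ ≤ Q := by
    rw [inv_le_iff_one_le_mul₀ h.mu_pos]; exact h.mu_inv
  have hinv2 : μ⁻¹ ^ 2 ≤ Q ^ 2 := pow_le_pow_left₀ (inv_pos.2 h.mu_pos).le hinv 2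
  have hckm : 1 ≤ Q ^ 2 * (c * B.km) := by
    have h1 : 1 ≤ Q * B.km := h.km_inv.trans (by
      have := B.δ_pos
      gcongr
      linarith)
    calc (1 : ℝ) ≤ (Q * c) * (Q * B.km) := one_le_mul_of_one_le_of_one_le h.c_inv h1
      _ = _ := by ring
  have hw' : 2 * μ⁻¹ ^ 2 * x ^ 2 ≤ 2 * Q ^ 2 * x ^ 2 := by gcongr
  have h1 : Q ^ 2 * (η * x ^ 2) ≤ Q ^ 3 * (η * l * x ^ 2) := by
    calc Q ^ 2 * (η * x ^ 2) ≤ Q ^ 2 * (η * x ^ 2) * (Q * l) :=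
          le_mul_of_one_le_right (by positivity) h.l_inv
      _ = _ := by ring
  have hQ2 : 16 * 16 ≤ Q ^ 2 := by
    rw [sq]; exact mul_le_mul h.Q_ge h.Q_ge (by norm_num) hQ.le
  have h2 : 256 * (η * x ^ 2) ≤ Q ^ 2 * (η * x ^ 2) :=
    mul_le_mul_of_nonneg_right (by linarith) (by positivity)
  have h3 : Q ^ 2 * x ^ 2 ≤ η * x ^ 2 := by
    refine mul_le_mul_of_nonneg_right ?_ (sq_nonneg x)
    rw [h.eta_eq]; exact pow_le_pow_right₀ h.one_le_Q (by norm_num)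
  have h4 : 16 * w ≤ Q ^ 3 * (c * B.km) * w := by
    refine mul_le_mul_of_nonneg_right ?_ hw0
    have := mul_le_mul h.Q_ge hckm zero_le_one hQ.le
    linarith [show Q * (Q ^ 2 * (c * B.km)) = Q ^ 3 * (c * B.km) by ring]
  have h5 := mul_le_mul_of_nonneg_left hv (show 0 ≤ Q ^ 3 by positivity)
  have h6 : 0 ≤ η * x ^ 2 := by positivity
  linarith

end HighGain

/-! ### Switching with a dwell time -/

section Switching

variable {m : ℕ} {σ : ℝ → Fin m} {πd : ℝ}

/-- A window no longer than the dwell time contains at most one switching time. -/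
theorem HasDwellTime.window (h : HasDwellTime σ πd) {a b : ℝ} (ha : 0 ≤ a) (hab : a ≤ b)
    (hb : b ≤ a + πd) :
    ∃ s, a ≤ s ∧ s ≤ b ∧ (∀ t, a ≤ t → t < s → σ t = σ a) ∧ ∀ t, s ≤ t → t ≤ b → σ t = σ b := by
  obtain ⟨S, -, hgap, hconst⟩ := h
  by_cases hex : ∃ s ∈ S, a < s ∧ s ≤ b
  · obtain ⟨s, hs, has, hsb⟩ := hex
    refine ⟨s, has.le, hsb, fun t hat hts => ?_, fun t hst htb => ?_⟩
    · refine (hconst a t ha hat fun r hr hart => ?_).symm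
      linarith [hgap r hr s hs (hart.2.trans_lt hts)]
    · refine hconst t b (ha.trans (has.le.trans hst)) htb fun r hr htr => ?_
      linarith [hgap s hs r hr (hst.trans_lt htr.1)]
  · refine ⟨a, le_rfl, hab, fun t h1 h2 => absurd h2 (not_lt.2 h1), fun t hat htb => ?_⟩
    exact hconst t b (ha.trans hat) htb fun r hr htr => hex ⟨r, hr, hat.trans_lt htr.1, htr.2⟩

/-- Uniform bounds for a switched family of functions that are comparable to
`H = Q ^ 102 X ^ 2 + Y ^ 2` and decay, up to a residual, as long as `X ≤ Q ^ 7`. The decay over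
one dwell time is a high power of `Q` and outweighs the loss at the switching times, which also
shows that `X` never reaches `Q ^ 7`. -/
theorem switched_bound (hσ : HasDwellTime σ πd) (hπd : 0 < πd) {T : EReal} {Q lam : ℝ}
    (hQ : 16 ≤ Q) (hlam : 0 ≤ lam) (hdec : Real.exp (-(lam * πd)) * Q ^ 25 ≤ 1) {X Y : ℝ → ℝ}
    {V : Fin m → ℝ → ℝ}
    (hX : ∀ t : ℝ, 0 ≤ t → (t : EReal) < T → ContinuousOn X (Set.Icc 0 t))
    (hinit : Q ^ 102 * X 0 ^ 2 + Y 0 ^ 2 ≤ Q ^ 105)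
    (hup : ∀ j t, V j t ≤ Q * (Q ^ 102 * X t ^ 2 + Y t ^ 2))
    (hlow : ∀ j t, Q ^ 102 * X t ^ 2 + Y t ^ 2 ≤ Q ^ 3 * V j t)
    (hV : ∀ (j : Fin m) (a b : ℝ), 0 ≤ a → a ≤ b → (b : EReal) < T →
      (∀ t, a < t → t < b → σ t = j) →
      (∀ t, a < t → t < b → X t ≤ Q ^ 7) →
      V j b ≤ Real.exp (-(lam * (b - a))) * V j a + 1) {t : ℝ} (ht : 0 ≤ t)
    (htT : (t : EReal) < T) :
    Q ^ 102 * X t ^ 2 + Y t ^ 2 ≤ Q ^ 114 ∧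
      (πd ≤ t → Q ^ 102 * X t ^ 2 + Y t ^ 2 ≤ Q ^ 98) := by
  have hQ0 : 0 < Q := by linarith
  have hQ1 : 1 ≤ Q := by linarith
  have hpow : ∀ i k : ℕ, k = i + 1 → 16 * Q ^ i ≤ Q ^ k := fun i k hk => by
    rw [hk, pow_succ']
    exact mul_le_mul_of_nonneg_right hQ (by positivity)
  set H : ℝ → ℝ := fun t => Q ^ 102 * X t ^ 2 + Y t ^ 2 with hH
  have hH0 : ∀ t, 0 ≤ H t := fun t =>
    add_nonneg (mul_nonneg (pow_nonneg hQ0.le _) (sq_nonneg _)) (sq_nonneg _)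
  have hmono : ∀ {s t : ℝ}, s ≤ t → (t : EReal) < T → (s : EReal) < T := fun hst h =>
    (EReal.coe_le_coe_iff.2 hst).trans_lt h
  -- one interval without switching
  have step : ∀ (j : Fin m) (a b : ℝ), 0 ≤ a → a ≤ b → (b : EReal) < T →
      (∀ t, a < t → t < b → σ t = j) →
      (∀ t, a < t → t < b → X t ≤ Q ^ 7) →
      H b ≤ Q ^ 4 * Real.exp (-(lam * (b - a))) * H a + Q ^ 3 := by
    intro j a b ha hab hbT hσj hXR
    have h1 := hV j a b ha hab hbT hσj hXR
    have h2 := mul_le_mul_of_nonneg_left (hup j a) (Real.exp_pos (-(lam * (b - a)))).le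
    calc H b ≤ Q ^ 3 * V j b := hlow j b
      _ ≤ Q ^ 3 * (Real.exp (-(lam * (b - a))) * (Q * H a) + 1) := by
        gcongr
        exact h1.trans (by linarith)
      _ = _ := by ring
  -- one window, which consists of at most two such intervals
  have window : ∀ a b : ℝ, 0 ≤ a → a ≤ b → b ≤ a + πd → (b : EReal) < T →
      (∀ t, a < t → t < b → X t ≤ Q ^ 7) →
      H b ≤ Q ^ 8 * Real.exp (-(lam * (b - a))) * H a + Q ^ 8 := by
    intro a b ha hab hb hbT hXR
    obtain ⟨s, has, hsb, hs1, hs2⟩ := hσ.window ha hab hb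
    have h1 := step (σ a) a s ha has (hmono hsb hbT) (fun t h1 h2 => hs1 t h1.le h2)
      fun t h1 h2 => hXR t h1 (h2.trans_le hsb)
    have h2 := step (σ b) s b (ha.trans has) hsb hbT (fun t h1 h2 => hs2 t h1.le h2.le)
      fun t h1 h2 => hXR t (has.trans_lt h1) h2
    have he : Real.exp (-(lam * (b - a)))
        = Real.exp (-(lam * (b - s))) * Real.exp (-(lam * (s - a))) := by
      rw [← Real.exp_add]; ring_nf
    have he1 : Real.exp (-(lam * (b - s))) ≤ 1 :=
      Real.exp_le_one_iff.2 (neg_nonpos.2 (mul_nonneg hlam (by linarith)))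
    have h3 := mul_le_mul_of_nonneg_left h1
      (show 0 ≤ Q ^ 4 * Real.exp (-(lam * (b - s))) by positivity)
    have h4 : Q ^ 7 * Real.exp (-(lam * (b - s))) ≤ Q ^ 7 :=
      mul_le_of_le_one_right (by positivity) he1
    have h5 := hpow 7 8 rfl
    have h6 : Q ^ 3 ≤ Q ^ 7 := pow_le_pow_right₀ hQ1 (by norm_num)
    have h7 : 0 ≤ Q ^ 7 := by positivity
    calc H b ≤ Q ^ 4 * Real.exp (-(lam * (b - s))) * H s + Q ^ 3 := h2
      _ ≤ Q ^ 4 * Real.exp (-(lam * (b - s)))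
          * (Q ^ 4 * Real.exp (-(lam * (s - a))) * H a + Q ^ 3) + Q ^ 3 := by gcongr
      _ = Q ^ 8 * (Real.exp (-(lam * (b - s))) * Real.exp (-(lam * (s - a)))) * H a
          + Q ^ 7 * Real.exp (-(lam * (b - s))) + Q ^ 3 := by ring
      _ ≤ _ := by rw [he]; linarith
  -- the bounds hold until `X` reaches `Q ^ 7`
  have main : ∀ τ : ℝ, 0 ≤ τ → (τ : EReal) < T → (∀ t, 0 ≤ t → t < τ → X t ≤ Q ^ 7) →
      H τ ≤ Q ^ 114 ∧ (πd ≤ τ → H τ ≤ Q ^ 98) := by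
    intro τ hτ hτT hXR
    -- at the multiples of the dwell time `H ≤ Q ^ 105` is reproduced: a window multiplies it by at
    -- most `Q ^ 8 Q ^ (-25)`
    have hgrid : ∀ N : ℕ, N * πd ≤ τ → H (N * πd) ≤ Q ^ 105 ∧ (N ≠ 0 → H (N * πd) ≤ Q ^ 89) := by
      intro N
      induction N with
      | zero => intro _; simpa using hinit
      | succ N ih =>
        intro hN
        push_cast at hN ⊢
        have hN' : (N : ℝ) * πd ≤ τ := by linarith
        have hN0 : (0 : ℝ) ≤ N * πd := by positivity
        have h1 := window (N * πd) ((N + 1) * πd) hN0 (by linarith) (by linarith)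
          (hmono hN hτT) fun t h1 h2 => hXR t (hN0.trans h1.le) (h2.trans_le hN)
        rw [show ((N : ℝ) + 1) * πd - N * πd = πd by ring] at h1
        have h2 : Q ^ 8 * Real.exp (-(lam * πd)) * H (N * πd) ≤ Q ^ 88 := by
          calc Q ^ 8 * Real.exp (-(lam * πd)) * H (N * πd)
              ≤ Q ^ 8 * Real.exp (-(lam * πd)) * Q ^ 105 := by gcongr; exact (ih hN').1
            _ = Q ^ 88 * (Real.exp (-(lam * πd)) * Q ^ 25) := by ring
            _ ≤ Q ^ 88 := mul_le_of_le_one_right (by positivity) hdec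
        have h3 : H ((N + 1) * πd) ≤ Q ^ 89 := by
          have h4 : Q ^ 8 ≤ Q ^ 88 := pow_le_pow_right₀ hQ1 (by norm_num)
          have h5 := hpow 88 89 rfl
          have h6 : 0 ≤ Q ^ 88 := by positivity
          linarith
        exact ⟨h3.trans (pow_le_pow_right₀ hQ1 (by norm_num)), fun _ => h3⟩
    set N := ⌊τ / πd⌋₊ with hN
    have hN1 : (N : ℝ) * πd ≤ τ := (le_div_iff₀ hπd).1 (Nat.floor_le (div_nonneg hτ hπd.le))
    have hN2 : τ ≤ N * πd + πd := by
      have := (div_lt_iff₀ hπd).1 (Nat.lt_floor_add_one (τ / πd))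
      rw [← hN] at this
      linarith
    have hN0 : (0 : ℝ) ≤ N * πd := by positivity
    have h1 := window (N * πd) τ hN0 hN1 hN2 hτT fun t h1 h2 => hXR t (hN0.trans h1.le) h2
    have he1 : Real.exp (-(lam * (τ - N * πd))) ≤ 1 :=
      Real.exp_le_one_iff.2 (neg_nonpos.2 (mul_nonneg hlam (by linarith)))
    have h2 : H τ ≤ Q ^ 8 * H (N * πd) + Q ^ 8 := by
      have h2 := mul_le_mul_of_nonneg_left he1 (mul_nonneg (pow_nonneg hQ0.le 8) (hH0 (N * πd)))
      linarith
    refine ⟨?_, fun hτπ => ?_⟩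
    · have h3 := mul_le_mul_of_nonneg_left (hgrid N hN1).1 (show 0 ≤ Q ^ 8 by positivity)
      have h4 := hpow 113 114 rfl
      have h5 : Q ^ 8 ≤ Q ^ 113 := pow_le_pow_right₀ hQ1 (by norm_num)
      have h6 : 0 ≤ Q ^ 113 := by positivity
      linarith [show Q ^ 8 * Q ^ 105 = Q ^ 113 by ring]
    · have hNne : N ≠ 0 := by
        rw [hN]
        exact (Nat.floor_pos.2 ((one_le_div hπd).2 hτπ)).ne'
      have h3 := mul_le_mul_of_nonneg_left ((hgrid N hN1).2 hNne) (show 0 ≤ Q ^ 8 by positivity)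
      have h4 := hpow 97 98 rfl
      have h5 : Q ^ 8 ≤ Q ^ 97 := pow_le_pow_right₀ hQ1 (by norm_num)
      have h6 : 0 ≤ Q ^ 97 := by positivity
      linarith [show Q ^ 8 * Q ^ 89 = Q ^ 97 by ring]
  -- `X` does not reach `Q ^ 7`: consider the first time at which it would
  refine main t ht htT fun r hr hrt => ?_
  by_contra hcon
  push Not at hcon
  have hrT := hmono hrt.le htT
  -- at that time `Q ^ 116 ≤ H`, but `H ≤ Q ^ 114` by the bound up to that time
  have hcomp : IsCompact (Set.Icc 0 r ∩ X ⁻¹' Set.Ici (Q ^ 7)) :=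
    isCompact_Icc.of_isClosed_subset
      ((hX r hr hrT).preimage_isClosed_of_isClosed isClosed_Icc isClosed_Ici) Set.inter_subset_left
  obtain ⟨s, hs, hsmin⟩ := hcomp.exists_isLeast ⟨r, ⟨hr, le_rfl⟩, hcon.le⟩
  have h1 := (main s hs.1.1 (hmono hs.1.2 hrT) fun q hq hqs => by
    by_contra hc
    push Not at hc
    exact absurd (hsmin ⟨⟨hq, hqs.le.trans hs.1.2⟩, hc.le⟩) (not_le.2 hqs)).1
  have h2 : (Q ^ 7) ^ 2 ≤ X s ^ 2 := pow_le_pow_left₀ (by positivity) hs.2 2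
  have h3 := mul_le_mul_of_nonneg_left h2 (show 0 ≤ Q ^ 102 by positivity)
  have h4 : Q ^ 114 < Q ^ 116 := pow_lt_pow_right₀ (by linarith) (by norm_num)
  have h5 := sq_nonneg (Y s)
  simp only [hH] at h1
  linarith [show Q ^ 102 * (Q ^ 7) ^ 2 = Q ^ 116 by ring]

/-- Exponential decay of a switched family that decays with rate `lam` between switching times and
grows at most by the factor `exp ((lam - α) πd)` at each of them. -/
theorem switched_decay (hσ : HasDwellTime σ πd) (hπd : 0 < πd) {T : EReal} {lam α t₀ : ℝ}
    (hlam : 0 ≤ lam) (hα : 0 ≤ α) (ht₀ : 0 ≤ t₀) {V : Fin m → ℝ → ℝ}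
    (hV0 : ∀ j t, 0 ≤ V j t)
    (hjump : ∀ i j t, V j t ≤ Real.exp ((lam - α) * πd) * V i t)
    (hV : ∀ (j : Fin m) (a b : ℝ), t₀ ≤ a → a ≤ b → (b : EReal) < T →
      (∀ t, a < t → t < b → σ t = j) →
      V j b ≤ Real.exp (-(lam * (b - a))) * V j a) {t : ℝ} (ht : t₀ ≤ t) (htT : (t : EReal) < T) :
    V (σ t) t ≤ Real.exp (lam * πd) * Real.exp (-(α * (t - t₀))) * V (σ t₀) t₀ := by
  have hmono : ∀ {s t : ℝ}, s ≤ t → (t : EReal) < T → (s : EReal) < T := fun hst h =>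
    (EReal.coe_le_coe_iff.2 hst).trans_lt h
  have window : ∀ a b : ℝ, t₀ ≤ a → a ≤ b → b ≤ a + πd → (b : EReal) < T →
      V (σ b) b ≤ Real.exp ((lam - α) * πd) * Real.exp (-(lam * (b - a))) * V (σ a) a := by
    intro a b ha hab hb hbT
    obtain ⟨s, has, hsb, hs1, hs2⟩ := hσ.window (ht₀.trans ha) hab hb
    have h1 := hV (σ a) a s ha has (hmono hsb hbT) fun t h1 h2 => hs1 t h1.le h2
    have h2 := hV (σ b) s b (ha.trans has) hsb hbT fun t h1 h2 => hs2 t h1.le h2.le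
    have he : Real.exp (-(lam * (b - a)))
        = Real.exp (-(lam * (b - s))) * Real.exp (-(lam * (s - a))) := by
      rw [← Real.exp_add]; ring_nf
    calc V (σ b) b ≤ Real.exp (-(lam * (b - s))) * V (σ b) s := h2
      _ ≤ Real.exp (-(lam * (b - s))) * (Real.exp ((lam - α) * πd) * V (σ a) s) := by
        gcongr; exact hjump _ _ _
      _ ≤ Real.exp (-(lam * (b - s))) * (Real.exp ((lam - α) * πd)
          * (Real.exp (-(lam * (s - a))) * V (σ a) a)) := by gcongr
      _ = _ := by rw [he]; ring
  have hgrid : ∀ N : ℕ, t₀ + N * πd ≤ t → V (σ (t₀ + N * πd)) (t₀ + N * πd)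
      ≤ Real.exp (-(α * (N * πd))) * V (σ t₀) t₀ := by
    intro N
    induction N with
    | zero => intro _; simp
    | succ N ih =>
      intro hN
      push_cast at hN ⊢
      have hN0 : (0 : ℝ) ≤ N * πd := by positivity
      have h1 := window (t₀ + N * πd) (t₀ + (N + 1) * πd) (by linarith) (by linarith) (by linarith)
        (hmono hN htT)
      refine h1.trans ?_
      rw [← Real.exp_add]
      refine (mul_le_mul_of_nonneg_left (ih (by linarith)) (Real.exp_pos _).le).trans_eq ?_
      rw [← mul_assoc, ← Real.exp_add]
      congr 2
      ring
  set N := ⌊(t - t₀) / πd⌋₊ with hN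
  have hN1 : (N : ℝ) * πd ≤ t - t₀ :=
    (le_div_iff₀ hπd).1 (Nat.floor_le (div_nonneg (by linarith) hπd.le))
  have hN2 : t - t₀ ≤ N * πd + πd := by
    have := (div_lt_iff₀ hπd).1 (Nat.lt_floor_add_one ((t - t₀) / πd))
    rw [← hN] at this
    linarith
  have hN0 : (0 : ℝ) ≤ N * πd := by positivity
  have h1 := window (t₀ + N * πd) t (by linarith) (by linarith) (by linarith) htT
  refine h1.trans ((mul_le_mul_of_nonneg_left (hgrid N (by linarith)) (by positivity)).trans ?_)
  rw [← mul_assoc, ← Real.exp_add, ← Real.exp_add, ← Real.exp_add]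
  refine mul_le_mul_of_nonneg_right (Real.exp_le_exp.2 ?_) (hV0 _ _)
  nlinarith [mul_nonneg hlam (show 0 ≤ t - (t₀ + N * πd) by linarith),
    mul_nonneg hα (show 0 ≤ N * πd + πd - (t - t₀) by linarith)]

end Switching

/-! ### The design quantities in the high-gain regime -/

section Design

variable {n p : ℕ} {B : Bounds} {G : WDigraph n} {γ : Fin n → ℝ} {μ η β Q ν : ℝ}

theorem nonempty_index (hn : 0 < n) (hp : 0 < p) : Nonempty (Fin n × Fin p) :=
  ⟨(⟨0, hn⟩, ⟨0, hp⟩)⟩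

theorem IsScaling.lamMin_pos (hγ : IsScaling G γ) (hn : 0 < n) (hp : 0 < p) :
    0 < lamMin (matX p G γ) := by
  have := nonempty_index hn hp
  exact LeaderTracking.lamMin_pos (matX_posDef hγ)

theorem IsScaling.gamMin_le_one (hγ : IsScaling G γ) (hn : 0 < n) : gamMin γ ≤ 1 :=
  (gamMin_le ⟨0, hn⟩).trans (hγ.le_one _)

/-- A common bound of all parameters of one topology, and of the inverses of those that could be
small. Its power with exponent `102` is the threshold for the gain `η`. -/
noncomputable def gainScale (p : ℕ) (B : Bounds) (G : WDigraph n) (γ : Fin n → ℝ) (μ β : ℝ) : ℝ :=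
  16 + (lamMin (matX p G γ))⁻¹ + lamMax (matX p G γ) + (gamMin γ)⁻¹ + μ + μ⁻¹ + β + B.kp + B.ka
    + B.kb + B.kM + B.kC + B.ξ + B.ka⁻¹ + B.kb⁻¹ + (B.km - B.δ)⁻¹ + n * p

/-- The hypothesis `HighGain` for the quantities that belong to the topology `G`, with `N = n p`
coordinates. -/
abbrev HighGainTopology (p : ℕ) (B : Bounds) (G : WDigraph n) (γ : Fin n → ℝ) (μ β Q η : ℝ) :
    Prop :=
  HighGain B (n * p) (lamMin (matX p G γ)) (lamMax (matX p G γ)) (gamMin γ) μ β Q η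

theorem highGainTopology (hn : 0 < n) (hp : 0 < p) (hγ : IsScaling G γ) (hμ : 0 < μ) (hβ : 0 ≤ β)
    (hQ : gainScale p B G γ μ β ≤ Q) : HighGainTopology p B G γ μ β Q (Q ^ 102) := by
  have := nonempty_index hn hp
  have hl := hγ.lamMin_pos hn hp
  have hlu : lamMin (matX p G γ) ≤ lamMax (matX p G γ) :=
    lamMin_le_lamMax (matX_posDef hγ).isHermitian
  have hu := hl.trans_le hlu
  have hc := hγ.gamMin_pos hn
  have hd : 0 < B.km - B.δ := sub_pos.2 B.δ_lt
  have inv : ∀ {v : ℝ}, 0 < v → v⁻¹ ≤ Q → 1 ≤ Q * v := fun hv h => by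
    rw [← inv_mul_cancel₀ hv.ne']
    exact mul_le_mul_of_nonneg_right h hv.le
  have h1 := inv_pos.2 hl
  have h2 := inv_pos.2 hc
  have h3 := inv_pos.2 hμ
  have h4 := inv_pos.2 B.ka_pos
  have h5 := inv_pos.2 B.kb_pos
  have h6 := inv_pos.2 hd
  have h7 := B.kp_pos
  have h8 := B.ka_pos
  have h9 := B.kb_pos
  have h10 := B.kM_pos
  have h11 := B.kC_pos
  have h12 := B.xi_pos
  have h13 : (0 : ℝ) ≤ n * p := by positivity
  rw [gainScale] at hQ
  exact
    { Q_ge := by linarith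
      eta_eq := rfl
      l_inv := inv hl (by linarith)
      l_le_u := hlu
      u_le := by linarith
      c_inv := inv hc (by linarith)
      c_le := hγ.gamMin_le_one hn
      mu_le := by linarith
      mu_inv := inv hμ (by linarith)
      beta_nonneg := hβ
      beta_le := by linarith
      kp_le := by linarith
      ka_le := by linarith
      kb_le := by linarith
      kM_le := by linarith
      kC_le := by linarith
      xi_le := by linarith
      ka_inv := inv h8 (by linarith)
      kb_inv := inv h9 (by linarith)
      km_inv := inv hd (by linarith)
      N_le := by linarith }

theorem pos_of_muBound_lt (hμ : muBound p B G γ < μ) : 0 < μ :=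
  (Real.sqrt_nonneg _).trans_lt hμ

theorem two_kM_mul_le (hn : 0 < n) (hp : 0 < p) (hγ : IsScaling G γ)
    (hμ : muBound p B G γ < μ) : 2 * B.kM * μ⁻¹ ^ 2 ≤ lamMin (matX p G γ) := by
  have hμ0 := pos_of_muBound_lt hμ
  have h1 := (Real.sqrt_lt' hμ0).1 hμ
  rw [div_lt_iff₀ (hγ.lamMin_pos hn hp)] at h1
  rw [inv_pow, ← div_eq_mul_inv, div_le_iff₀ (by positivity)]
  linarith

theorem kM_add_mul_le (hn : 0 < n) (hp : 0 < p) (hγ : IsScaling G γ)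
    (hμ : muBound p B G γ < μ) (hη : 1 ≤ η) :
    (B.kM + B.δ) * μ⁻¹ ^ 2 ≤ η * lamMax (matX p G γ) := by
  have := nonempty_index hn hp
  have h1 : (B.kM + B.δ) * μ⁻¹ ^ 2 ≤ 2 * B.kM * μ⁻¹ ^ 2 := by
    gcongr
    linarith [B.δ_lt, B.km_le_kM]
  have h2 := lamMin_le_lamMax (matX_posDef (p := p) hγ).isHermitian
  have h3 := hγ.lamMin_pos hn hp
  have h4 := le_mul_of_one_le_left (h3.le.trans h2) hη
  linarith [two_kM_mul_le hn hp hγ hμ]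

theorem betaBound_lt_iff (hn : 0 < n) (hγ : IsScaling G γ) :
    betaBound B γ < β ↔ 0 < β * gamMin γ - B.kC * B.kp ^ 2 - B.ξ := by
  rw [betaBound, div_lt_iff₀ (hγ.gamMin_pos hn)]
  constructor <;> intro h <;> linarith

theorem betaBound_pos (hn : 0 < n) (hγ : IsScaling G γ) : 0 < betaBound B γ := by
  have := B.kC_pos; have := B.kp_pos; have := B.xi_pos; have := hγ.gamMin_pos hn
  rw [betaBound]; positivity

theorem IsMu3.pos (hν : IsMu3 p B G γ μ ν) : 0 < ν := (Real.sqrt_nonneg _).trans_lt hν.1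

theorem IsMu3.lt_sq (hν : IsMu3 p B G γ μ ν) :
    2 * gamMin γ * (B.km - B.δ) / lamMin (matX p G γ) < ν ^ 2 :=
  (Real.sqrt_lt' hν.pos).1 hν.2.1

theorem HighGain.one_le_eta {N l u c : ℝ} (h : HighGain B N l u c μ β Q η) : 1 ≤ η := by
  rw [h.eta_eq]; exact h.one_le_pow _

theorem lamMax_matL_le (hn : 0 < n) (hp : 0 < p) (h : HighGainTopology p B G γ μ β Q η) :
    lamMax (matL p B G γ μ η) ≤ η * Q ^ 2 := by
  have := nonempty_index hn hp
  have hQ := h.Q_pos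
  have hμ := h.mu_pos
  have hη := h.eta_pos
  have hM := B.kM_pos
  have hδ := B.δ_pos
  have hu := h.u_pos
  have hh : B.kM + B.δ ≤ 2 * Q := by linarith [B.δ_lt, B.km_le_kM, h.kM_le]
  have hμi : μ⁻¹ ≤ Q := by
    rw [inv_le_iff_one_le_mul₀ hμ]; exact h.mu_inv
  rw [matL_eq]
  refine (lamMax_scalarBlocks_le (by positivity) (by positivity) (by positivity)).trans ?_
  have h1 : 1 / 2 * μ⁻¹ * (B.kM + B.δ) ≤ 1 / 2 * Q * (2 * Q) := by gcongr
  have h2 : η * lamMax (matX p G γ) ≤ η * Q := by gcongr; exact h.u_le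
  have h3 : Q ^ 2 ≤ η := by
    rw [h.eta_eq]; exact pow_le_pow_right₀ h.one_le_Q (by norm_num)
  have h4 : 16 * (η * Q) ≤ η * Q ^ 2 := by
    nlinarith [mul_le_mul_of_nonneg_left h.Q_ge (mul_pos hη hQ).le]
  have h5 : η ≤ η * Q := le_mul_of_one_le_right hη.le h.one_le_Q
  have h6 : Q ≤ Q ^ 2 := le_self_pow₀ h.one_le_Q (by norm_num)
  nlinarith

theorem pow_le_lamMax_matL (hn : 0 < n) (hp : 0 < p) (h : HighGainTopology p B G γ μ β Q η) :
    Q ^ 101 ≤ lamMax (matL p B G γ μ η) := by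
  have := nonempty_index hn hp
  rw [matL_eq]
  refine le_trans ?_ le_lamMax_scalarBlocks
  exact h.eta_mul_l_ge.trans (mul_le_mul_of_nonneg_left h.l_le_u h.eta_pos.le)

theorem lamMax_matL_pos (hn : 0 < n) (hp : 0 < p) (h : HighGainTopology p B G γ μ β Q η) :
    0 < lamMax (matL p B G γ μ η) :=
  (pow_pos h.Q_pos _).trans_le (pow_le_lamMax_matL hn hp h)

theorem lamMin_matN_pos (hn : 0 < n) (hp : 0 < p) (h : HighGainTopology p B G γ μ β Q η)
    (hγ : IsScaling G γ) (hμ : muBound p B G γ < μ) : 0 < lamMin (matN p B G γ μ η) := by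
  have := nonempty_index hn hp
  have hl := h.l_pos
  have hη := h.eta_pos
  have hc := h.c_pos
  have hd : 0 < B.km - B.δ := sub_pos.2 B.δ_lt
  have hμi := inv_pos.2 h.mu_pos
  rw [matN_eq]
  refine lamMin_scalarBlocks_pos (by positivity) ?_
  have h1 : gamMin γ * (B.km - B.δ) < B.kM :=
    (mul_le_of_le_one_left hd.le h.c_le).trans_lt (by linarith [B.δ_pos, B.km_le_kM])
  have h2 := mul_lt_mul_of_pos_right h1 (pow_pos hμi 2)
  have h3 := two_kM_mul_le hn hp hγ hμ
  have h4 := le_mul_of_one_le_left hl.le h.one_le_eta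
  have h5 : 2 * (gamMin γ * (B.km - B.δ) * μ⁻¹ ^ 2) < η * lamMin (matX p G γ) := by linarith
  have h6 := mul_lt_mul_of_pos_right h5 (show 0 < 1 / 8 * (gamMin γ * (B.km - B.δ)) by positivity)
  calc _ = 2 * (gamMin γ * (B.km - B.δ) * μ⁻¹ ^ 2) * (1 / 8 * (gamMin γ * (B.km - B.δ))) := by ring
    _ < η * lamMin (matX p G γ) * (1 / 8 * (gamMin γ * (B.km - B.δ))) := h6
    _ = _ := by ring

theorem lamMin_matN_le (hn : 0 < n) (hp : 0 < p) (h : HighGainTopology p B G γ μ β Q η) :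
    lamMin (matN p B G γ μ η) ≤ Q := by
  have := nonempty_index hn hp
  rw [matN_eq]
  refine lamMin_scalarBlocks_le.trans ?_
  linarith [h.cd_le, h.Q_pos]

/-- With a high gain, `μ⁻¹` is a decay constant: the quadratic terms dominate, and the term of the
sliding control has the right sign. -/
theorem exists_isDecayConstant (hn : 0 < n) (h : HighGainTopology p B G γ μ β Q η)
    (hγ : IsScaling G γ) (hβ : betaBound B γ < β) (hν : IsMu3 p B G γ μ ν) :
    ∃ a₃, IsDecayConstant p B G γ ν μ η β a₃ := by
  refine ⟨μ⁻¹, inv_pos.2 h.mu_pos, fun x y hx hy => ?_⟩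
  have h1 := h.quadratic_part_ge (norm_nonneg x) (norm_nonneg y)
    (hx.trans (h.boxPos_le hν.pos hν.lt_sq))
  have hb := ((betaBound_lt_iff hn hγ).1 hβ).le
  have h2 : 0 ≤ ∑ k, |x k + μ * y k| := Finset.sum_nonneg fun _ _ => abs_nonneg _
  have h3 := mul_nonneg hb h2
  have h4 : 16 ≤ 1 / 2 * η * lamMin (matX p G γ) := by
    refine h.Q_ge.trans (le_trans ?_ h.A_ge)
    exact le_self_pow₀ h.one_le_Q (by norm_num)
  have h5 : 16 ≤ 1 / 2 * η * lamMin (matX p G γ) * μ ^ 2 := by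
    refine h.Q_ge.trans (le_trans ?_ h.A_mul_mu_sq_ge)
    exact le_self_pow₀ h.one_le_Q (by norm_num)
  have h6 := mul_le_mul_of_nonneg_right h4 (sq_nonneg ‖x‖)
  have h7 := mul_le_mul_of_nonneg_right h5 (sq_nonneg ‖y‖)
  refine neg_le_neg (mul_le_mul_of_nonneg_left ?_ (inv_pos.2 h.mu_pos).le)
  have h8 := sq_nonneg ‖x‖
  have h9 := sq_nonneg ‖y‖
  linarith

/-- A decay constant is at most twice the rate of the crude decay estimate, as one sees from its
defining inequality at the vectors `ka e₁` for the positions and `kb e₁` for the velocities. -/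
theorem IsDecayConstant.le_rate (hn : 0 < n) (hp : 0 < p)
    (h : HighGainTopology p B G γ μ β Q η) (hν : IsMu3 p B G γ μ ν) {a₃ : ℝ}
    (ha₃ : IsDecayConstant p B G γ ν μ η β a₃) :
    a₃ ≤ 2 * HighGain.rate (lamMin (matX p G γ)) μ η := by
  have hμ := h.mu_pos
  let k₀ : Fin n × Fin p := (⟨0, hn⟩, ⟨0, hp⟩)
  have hsum : ∀ r s : ℝ, ∑ k, |EuclideanSpace.single k₀ r k + μ * EuclideanSpace.single k₀ s k|
      = |r + μ * s| := fun r s => by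
    rw [Finset.sum_eq_single k₀]
    · simp
    · intro k _ hk
      simp [hk]
    · simp
  have hX0 := B.ka_pos.le.trans (h.ka_le_boxPos hν.pos hν.lt_sq)
  have hY0 := B.kb_pos.le.trans (h.kb_le_boxVel hν.pos hν.lt_sq)
  have hka := B.ka_pos
  have hkb := B.kb_pos
  refine h.decayConstant_le ?_ ?_
  · have := ha₃.2 (EuclideanSpace.single k₀ B.ka) (EuclideanSpace.single k₀ 0)
      (by simpa [abs_of_pos hka] using h.ka_le_boxPos hν.pos hν.lt_sq) (by simpa using hY0)
    rw [hsum] at this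
    simpa [abs_of_pos hka] using this
  · have := ha₃.2 (EuclideanSpace.single k₀ 0) (EuclideanSpace.single k₀ B.kb)
      (by simpa using hX0) (by simpa [abs_of_pos hkb] using h.kb_le_boxVel hν.pos hν.lt_sq)
    rw [hsum] at this
    simpa [abs_of_pos hkb, abs_of_pos hμ] using this

end Design

section Family

variable {n p m : ℕ} {B : Bounds} {G : Fin m → WDigraph n} {γ : Fin m → Fin n → ℝ}
  {μ η β Q : ℝ} {a₃ : Fin m → ℝ}

theorem lamMax_matL_le_ciSup (j : Fin m) :
    lamMax (matL p B (G j) (γ j) μ η) ≤ ⨆ j, lamMax (matL p B (G j) (γ j) μ η) :=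
  le_ciSup (f := fun j => lamMax (matL p B (G j) (γ j) μ η)) (Set.finite_range _).bddAbove j

theorem ciInf_le_lamMin_matN (j : Fin m) :
    ⨅ j, lamMin (matN p B (G j) (γ j) μ η) ≤ lamMin (matN p B (G j) (γ j) μ η) :=
  ciInf_le (f := fun j => lamMin (matN p B (G j) (γ j) μ η)) (Set.finite_range _).bddBelow j

theorem capLam_le (j : Fin m) :
    capLam p B G γ μ η a₃ ≤ a₃ j / lamMax (matL p B (G j) (γ j) μ η) :=
  ciInf_le (f := fun j => a₃ j / lamMax (matL p B (G j) (γ j) μ η)) (Set.finite_range _).bddBelow j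

theorem capLam_pos (hn : 0 < n) (hp : 0 < p) (hm : 0 < m)
    (h : ∀ j, HighGainTopology p B (G j) (γ j) μ β Q η) (ha₃ : ∀ j, 0 < a₃ j) :
    0 < capLam p B G γ μ η a₃ := by
  have : Nonempty (Fin m) := ⟨⟨0, hm⟩⟩
  obtain ⟨j, hj⟩ := exists_eq_ciInf_of_finite
    (f := fun j => a₃ j / lamMax (matL p B (G j) (γ j) μ η))
  rw [capLam, ← hj]
  exact div_pos (ha₃ j) (lamMax_matL_pos hn hp (h j))

theorem ciInf_lamMin_matN_pos (hn : 0 < n) (hp : 0 < p) (hm : 0 < m)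
    (h : ∀ j, HighGainTopology p B (G j) (γ j) μ β Q η) (hγ : ∀ j, IsScaling (G j) (γ j))
    (hμ : ∀ j, muBound p B (G j) (γ j) < μ) : 0 < ⨅ j, lamMin (matN p B (G j) (γ j) μ η) := by
  have : Nonempty (Fin m) := ⟨⟨0, hm⟩⟩
  obtain ⟨j, hj⟩ := exists_eq_ciInf_of_finite
    (f := fun j => lamMin (matN p B (G j) (γ j) μ η))
  rw [← hj]
  exact lamMin_matN_pos hn hp (h j) (hγ j) (hμ j)

/-- The ratio `κ` grows at least like `η u` over `½ c (k_m - δ)`. It is this lower bound that makes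
a dwell time above `log κ / Λ` long enough for the crude decay estimate as well. -/
theorem pow_le_kappa (hn : 0 < n) (hp : 0 < p) (hm : 0 < m)
    (h : ∀ j, HighGainTopology p B (G j) (γ j) μ β Q η) (hγ : ∀ j, IsScaling (G j) (γ j))
    (hμ : ∀ j, muBound p B (G j) (γ j) < μ) : Q ^ 100 ≤ kappa p B G γ μ η := by
  let j : Fin m := ⟨0, hm⟩
  rw [kappa, le_div_iff₀ (ciInf_lamMin_matN_pos hn hp hm h hγ hμ)]
  calc _ ≤ Q ^ 100 * Q := mul_le_mul_of_nonneg_left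
        ((ciInf_le_lamMin_matN j).trans (lamMin_matN_le hn hp (h j)))
        (pow_nonneg (h j).Q_pos.le _)
    _ = Q ^ 101 := (pow_succ Q 100).symm
    _ ≤ _ := (pow_le_lamMax_matL hn hp (h j)).trans (lamMax_matL_le_ciSup j)

end Family

/-! ### Decay of the Lyapunov function of one topology -/

section Decay

variable {n p : ℕ} {B : Bounds} {A : Fin n → Agent p} {G : WDigraph n} {γ : Fin n → ℝ}
  {Gt : ℝ → WDigraph n} {μ η β Q ν : ℝ} {q₀ : ℝ → Coord p} {e z : ℝ → NetState n p}

theorem sum_abs_add_mul_le (hμ : 0 ≤ μ) (x y : EuclideanSpace ℝ (Fin n × Fin p)) :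
    ∑ k, |x k + μ * y k| ≤ (n * p : ℝ) * (‖x‖ + μ * ‖y‖) := by
  have h : ∀ k, |x k + μ * y k| ≤ ‖x‖ + μ * ‖y‖ := fun k => by
    refine (abs_add_le _ _).trans ?_
    rw [abs_mul, abs_of_nonneg hμ]
    exact add_le_add (PiLp.norm_apply_le x k)
      (mul_le_mul_of_nonneg_left (PiLp.norm_apply_le y k) hμ)
  refine (Finset.sum_le_card_nsmul _ _ _ fun k _ => h k).trans_eq ?_
  simp [mul_add]

/-- Together with `energy_le_lyapAlong`: the Lyapunov functions of all topologies are comparable, up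
to small powers of `Q`, to one energy in which the positions have the weight `η`. -/
theorem lyapAlong_le_energy (hA : ∀ i, (A i).IsEulerLagrange B) (hγ : IsScaling G γ)
    (h : HighGainTopology p B G γ μ β Q η) (t : ℝ) :
    lyapAlong A G γ μ η q₀ z t
      ≤ Q * (η * ‖stack (errPos q₀ z t)‖ ^ 2 + ‖stack (errVel q₀ z t)‖ ^ 2) := by
  refine h.le_of_upper_bound ?_ (lyapV_le hγ (inertiaBounds_of_isEulerLagrange hA _)
    h.eta_pos.le (errPos q₀ z t) (errVel q₀ z t))
  have h1 := norm_stack_add_smul_sq (errPos q₀ z t) (errVel q₀ z t) μ⁻¹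
  have h2 := norm_stack_add_smul_sq (errPos q₀ z t) (errVel q₀ z t) (-μ⁻¹)
  rw [neg_sq] at h2
  linarith [sq_nonneg ‖stack (fun i => errVel q₀ z t i + -μ⁻¹ • errPos q₀ z t i)‖]

theorem energy_le_lyapAlong (hn : 0 < n) (hp : 0 < p) (hA : ∀ i, (A i).IsEulerLagrange B)
    (hγ : IsScaling G γ) (h : HighGainTopology p B G γ μ β Q η) (hμ : muBound p B G γ < μ)
    (t : ℝ) :
    η * ‖stack (errPos q₀ z t)‖ ^ 2 + ‖stack (errVel q₀ z t)‖ ^ 2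
      ≤ Q ^ 3 * lyapAlong A G γ μ η q₀ z t := by
  refine h.le_of_lower_bound (sq_nonneg _) ?_ (lyapV_ge hγ (inertiaBounds_of_isEulerLagrange hA _)
    h.one_le_eta h.l_pos (two_kM_mul_le hn hp hγ hμ) (errPos q₀ z t) (errVel q₀ z t))
  have h1 := norm_stack_add_smul_sq (errPos q₀ z t) (errVel q₀ z t) μ⁻¹
  have h2 := norm_stack_add_smul_sq (errPos q₀ z t) (errVel q₀ z t) (2 * μ⁻¹)
  rw [mul_pow] at h2
  linarith [sq_nonneg ‖stack (fun i => errVel q₀ z t i + (2 * μ⁻¹) • errPos q₀ z t i)‖]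

theorem lyapAlong_nonneg (hn : 0 < n) (hp : 0 < p) (hA : ∀ i, (A i).IsEulerLagrange B)
    (hγ : IsScaling G γ) (h : HighGainTopology p B G γ μ β Q η) (hμ : muBound p B G γ < μ)
    (t : ℝ) : 0 ≤ lyapAlong A G γ μ η q₀ z t := by
  have h1 := energy_le_lyapAlong (q₀ := q₀) (z := z) hn hp hA hγ h hμ t
  have h2 := h.eta_pos
  exact nonneg_of_mul_nonneg_right ((by positivity : (0 : ℝ) ≤ _).trans h1) (pow_pos h.Q_pos 3)

theorem lamMin_mul_le_lyapAlong (hn : 0 < n) (hp : 0 < p) (hA : ∀ i, (A i).IsEulerLagrange B)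
    (hγ : IsScaling G γ) (h : HighGainTopology p B G γ μ β Q η) (hμ : muBound p B G γ < μ)
    (t : ℝ) :
    lamMin (matN p B G γ μ η) * (‖stack (errPos q₀ z t)‖ ^ 2 + ‖stack (errVel q₀ z t)‖ ^ 2)
      ≤ lyapAlong A G γ μ η q₀ z t :=
  lamMin_matN_mul_le hn hγ (inertiaBounds_of_isEulerLagrange hA _) h.one_le_eta h.l_pos
    (two_kM_mul_le hn hp hγ hμ) _ _

theorem lyapAlong_le_lamMax_mul (hn : 0 < n) (hp : 0 < p) (hA : ∀ i, (A i).IsEulerLagrange B)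
    (hγ : IsScaling G γ) (h : HighGainTopology p B G γ μ β Q η) (hμ : muBound p B G γ < μ)
    (t : ℝ) :
    lyapAlong A G γ μ η q₀ z t ≤ lamMax (matL p B G γ μ η)
      * (‖stack (errPos q₀ z t)‖ ^ 2 + ‖stack (errVel q₀ z t)‖ ^ 2) :=
  lyapV_le_lamMax_matL_mul hγ (inertiaBounds_of_isEulerLagrange hA _) h.eta_pos.le
    (kM_add_mul_le hn hp hγ hμ h.one_le_eta) _ _

/-- Before the observer has converged, the Lyapunov function decays up to a residual, as long as
the position errors are not too large. -/
theorem lyapAlong_le_of_crude (hn : 0 < n) (hp : 0 < p) (hA : ∀ i, (A i).IsEulerLagrange B)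
    (hq₀ : IsLeaderTrajectory n B q₀) (hγ : IsScaling G γ)
    (h : HighGainTopology p B G γ μ β Q η) (hμ : muBound p B G γ < μ) {a b lam : ℝ} (ha : 0 ≤ a)
    (hab : a ≤ b) (hz : AbsolutelyContinuousOnInterval z a b)
    (hder : ∀ᵐ t : ℝ, a < t → t < b → Gt t = G ∧
      ∃ w ∈ filippov (networkField A Gt μ η β q₀ e t) (z t), HasDerivAt z w t)
    (hX : ∀ t, a < t → t < b → ‖stack (errPos q₀ z t)‖ ≤ Q ^ 7)
    (hlam : lam ≤ 1 / 2 * HighGain.rate (lamMin (matX p G γ)) μ η / lamMax (matL p B G γ μ η)) :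
    lyapAlong A G γ μ η q₀ z b
      ≤ Real.exp (-(lam * (b - a))) * lyapAlong A G γ μ η q₀ z a + 1 := by
  set L := lamMax (matL p B G γ μ η) with hL
  set r := HighGain.rate (lamMin (matX p G γ)) μ η with hr
  have hL0 : 0 < L := lamMax_matL_pos hn hp h
  have hr0 : 0 < r := h.rate_pos
  have hρ : 0 < 1 / 2 * r / L := by positivity
  have hres := h.residual_div_le hL0 (lamMax_matL_le hn hp h)
  have hres0 : 0 ≤ HighGain.residual (lamMin (matX p G γ)) μ Q η / (1 / 2 * r / L) :=
    div_nonneg h.residual_nonneg hρ.le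
  have hgr := gronwall_of_ae_hasDerivAt (E := HighGain.residual (lamMin (matX p G γ)) μ Q η) hab
    hρ (absolutelyContinuous_lyapAlong hA G γ μ η hq₀.1 hz) <| by
      filter_upwards [hder] with t ht hat htb
      obtain ⟨rfl, w, hw, hzw⟩ := ht hat htb
      obtain ⟨d, hd, hd1, -⟩ := exists_hasDerivAt_lyapAlong hn hA hq₀ hγ h.mu_pos h.eta_pos.le
        h.beta_nonneg (ha.trans hat.le) hw hzw
      refine ⟨d, hd1.trans ((h.crude_decay (norm_nonneg _) (norm_nonneg _) (hX t hat htb)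
        (sum_abs_add_mul_le h.mu_pos.le _ _)
        (Finset.sum_nonneg fun _ _ => abs_nonneg _)).trans ?_), hd⟩
      have h1 := lyapAlong_le_lamMax_mul (q₀ := q₀) (z := z) hn hp hA hγ h hμ t
      have h2 := mul_le_mul_of_nonneg_left h1 hρ.le
      have h3 : 1 / 2 * r / L * (L * (‖stack (errPos q₀ z t)‖ ^ 2 + ‖stack (errVel q₀ z t)‖ ^ 2))
          = 1 / 2 * r * (‖stack (errPos q₀ z t)‖ ^ 2 + ‖stack (errVel q₀ z t)‖ ^ 2) := by
        field_simp
      rw [← hr]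
      linarith
  have hV := lyapAlong_nonneg (q₀ := q₀) (z := z) hn hp hA hγ h hμ a
  have h1 : Real.exp (-(1 / 2 * r / L * (b - a))) ≤ Real.exp (-(lam * (b - a))) :=
    Real.exp_le_exp.2 (neg_le_neg (mul_le_mul_of_nonneg_right hlam (by linarith)))
  have h2 := mul_le_mul_of_nonneg_right h1 hV
  have h3 := mul_nonneg (Real.exp_pos (-(1 / 2 * r / L * (b - a)))).le hres0
  linarith

/-- Once the observer has converged, the Lyapunov function decays in the region to which the decay
constant refers. -/
theorem lyapAlong_le_of_sharp (hn : 0 < n) (hp : 0 < p) (hA : ∀ i, (A i).IsEulerLagrange B)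
    (hq₀ : IsLeaderTrajectory n B q₀) (hγ : IsScaling G γ)
    (h : HighGainTopology p B G γ μ β Q η) (hμ : muBound p B G γ < μ) {a₃ : ℝ}
    (ha₃ : IsDecayConstant p B G γ ν μ η β a₃) {a b lam : ℝ} (ha : 0 ≤ a)
    (hab : a ≤ b) (hz : AbsolutelyContinuousOnInterval z a b)
    (hder : ∀ᵐ t : ℝ, a < t → t < b → Gt t = G ∧
      ∃ w ∈ filippov (networkField A Gt μ η β q₀ e t) (z t), HasDerivAt z w t)
    (hX : ∀ t, a < t → t < b → ‖stack (errPos q₀ z t)‖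
      ≤ boxPos B (lamMin (matX p G γ)) (lamMax (matX p G γ)) (gamMin γ) η ν)
    (hY : ∀ t, a < t → t < b → ‖stack (errVel q₀ z t)‖
      ≤ boxVel B (lamMin (matX p G γ)) (lamMax (matX p G γ)) (gamMin γ) η ν)
    (he : ∀ t, a < t → t < b → ∀ i, (e t).1 i = q₀ t ∧ (e t).2 i = deriv q₀ t)
    (hlam : lam ≤ a₃ / lamMax (matL p B G γ μ η)) :
    lyapAlong A G γ μ η q₀ z b
      ≤ Real.exp (-(lam * (b - a))) * lyapAlong A G γ μ η q₀ z a := by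
  set L := lamMax (matL p B G γ μ η) with hL
  have hL0 : 0 < L := lamMax_matL_pos hn hp h
  have hρ : 0 < a₃ / L := div_pos ha₃.1 hL0
  have hgr := gronwall_of_ae_hasDerivAt (E := 0) hab
    hρ (absolutelyContinuous_lyapAlong hA G γ μ η hq₀.1 hz) <| by
      filter_upwards [hder] with t ht hat htb
      obtain ⟨rfl, w, hw, hzw⟩ := ht hat htb
      obtain ⟨d, hd, -, hd1⟩ := exists_hasDerivAt_lyapAlong hn hA hq₀ hγ h.mu_pos h.eta_pos.le
        h.beta_nonneg (ha.trans hat.le) hw hzw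
      refine ⟨d, (hd1 (he t hat htb)).trans
        ((ha₃.2 _ _ (hX t hat htb) (hY t hat htb)).trans ?_), hd⟩
      have h1 := lyapAlong_le_lamMax_mul (q₀ := q₀) (z := z) hn hp hA hγ h hμ t
      have h2 := mul_le_mul_of_nonneg_left h1 hρ.le
      have h3 : a₃ / L * (L * (‖stack (errPos q₀ z t)‖ ^ 2 + ‖stack (errVel q₀ z t)‖ ^ 2))
          = a₃ * (‖stack (errPos q₀ z t)‖ ^ 2 + ‖stack (errVel q₀ z t)‖ ^ 2) := by
        field_simp
      linarith
  have hV := lyapAlong_nonneg (q₀ := q₀) (z := z) hn hp hA hγ h hμ a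
  have h1 : Real.exp (-(a₃ / L * (b - a))) ≤ Real.exp (-(lam * (b - a))) :=
    Real.exp_le_exp.2 (neg_le_neg (mul_le_mul_of_nonneg_right hlam (by linarith)))
  have h2 := mul_le_mul_of_nonneg_right h1 hV
  simp only [zero_div, sub_zero, add_zero] at hgr
  exact hgr.trans h2

theorem norm_stack_le_of_forall_le {x : Fin n → Coord p} {k : ℝ} (hk : 0 ≤ k)
    (h : ∀ i, ‖x i‖ ≤ k / √(n : ℝ)) : ‖stack x‖ ≤ k := by
  rw [← pow_le_pow_iff_left₀ (norm_nonneg _) hk two_ne_zero, norm_stack_sq]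
  calc ∑ i, ‖x i‖ ^ 2 ≤ ∑ _i : Fin n, (k / √(n : ℝ)) ^ 2 :=
        Finset.sum_le_sum fun i _ => pow_le_pow_left₀ (norm_nonneg _) (h i) 2
    _ = n * (k ^ 2 / n) := by simp [div_pow]
    _ ≤ k ^ 2 := by
      rw [mul_div_left_comm]
      exact mul_le_of_le_one_right (sq_nonneg k) (div_self_le_one _)

theorem energy_initial_le {N l u c : ℝ} (h : HighGain B N l u c μ β Q η)
    {x y : Fin n → Coord p} (hx : ∀ i, ‖x i‖ ≤ B.ka / √(n : ℝ))
    (hy : ∀ i, ‖y i‖ ≤ B.kb / √(n : ℝ)) :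
    Q ^ 102 * ‖stack x‖ ^ 2 + ‖stack y‖ ^ 2 ≤ Q ^ 105 := by
  have hX := (norm_stack_le_of_forall_le B.ka_pos.le hx).trans h.ka_le
  have hY := (norm_stack_le_of_forall_le B.kb_pos.le hy).trans h.kb_le
  have h1 := mul_le_mul_of_nonneg_left (pow_le_pow_left₀ (norm_nonneg _) hX 2)
    (pow_nonneg h.Q_pos.le 102)
  have h2 := pow_le_pow_left₀ (norm_nonneg _) hY 2
  have h3 := h.pow_succ_ge (show 104 < 105 by norm_num)
  have h4 := h.pow_succ_ge (show 2 < 105 by norm_num)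
  have h5 := pow_nonneg h.Q_pos.le 104
  have h6 := pow_nonneg h.Q_pos.le 2
  have h7 : Q ^ 102 * Q ^ 2 = Q ^ 104 := by ring
  exact (add_le_add (h1.trans_eq h7) h2).trans (by linarith)

theorem continuousOn_norm_errPos (hq₀ : Continuous q₀) {b : ℝ} (hb : 0 ≤ b)
    (hz : AbsolutelyContinuousOnInterval z 0 b) :
    ContinuousOn (fun t => ‖stack (errPos q₀ z t)‖) (Set.Icc 0 b) := by
  have h1 : ContinuousOn z (Set.Icc 0 b) := by
    rw [← Set.uIcc_of_le hb]; exact hz.continuousOn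
  have h2 : ContinuousOn (errPos q₀ z) (Set.Icc 0 b) := continuousOn_pi.2 fun i =>
    ((continuous_apply i).comp_continuousOn (continuous_fst.comp_continuousOn h1)).sub
      hq₀.continuousOn
  have h3 : Continuous (stack : (Fin n → Coord p) → EuclideanSpace ℝ (Fin n × Fin p)) := by
    unfold stack
    refine (PiLp.continuous_toLp 2 _).comp (continuous_pi fun k => ?_)
    exact (PiLp.continuous_apply 2 _ k.2).comp (continuous_apply k.1)
  exact (h3.comp_continuousOn h2).norm

end Decay

/-! ### The switched closed loop -/

section Network

variable {n p m : ℕ} {B : Bounds} {G : Fin m → WDigraph n} {γ : Fin m → Fin n → ℝ}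
  {μ η β Q : ℝ} {ν a₃ : Fin m → ℝ}

/-- After one dwell time the position errors are below their initial bound, hence in the region to
which the decay constants refer. -/
theorem HighGain.le_ka {N l u c x y : ℝ} (h : HighGain B N l u c μ β Q η)
    (hx : Q ^ 102 * x ^ 2 + y ^ 2 ≤ Q ^ 98) : x ≤ B.ka := by
  have h1 : 1 ≤ (Q * B.ka) ^ 2 := one_le_pow₀ h.ka_inv
  have h2 := mul_le_mul_of_nonneg_left h1 (pow_nonneg h.Q_pos.le 100)
  have h3 := pow_le_pow_right₀ h.one_le_Q (show 98 ≤ 100 by norm_num)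
  have h4 : Q ^ 100 * (Q * B.ka) ^ 2 = Q ^ 102 * B.ka ^ 2 := by ring
  have h5 := sq_nonneg y
  have h6 : x ^ 2 ≤ B.ka ^ 2 :=
    le_of_mul_le_mul_left (by linarith) (pow_pos h.Q_pos 102)
  exact le_of_sq_le_sq h6 B.ka_pos.le

/-- The Lyapunov functions of any two topologies differ at most by the factor `κ`. -/
theorem lyapAlong_le_kappa_mul {A : Fin n → Agent p} {q₀ : ℝ → Coord p} {z : ℝ → NetState n p}
    (hn : 0 < n) (hp : 0 < p) (hm : 0 < m)
    (h : ∀ j, HighGainTopology p B (G j) (γ j) μ β Q η) (hγ : ∀ j, IsScaling (G j) (γ j))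
    (hμ : ∀ j, muBound p B (G j) (γ j) < μ) (hA : ∀ i, (A i).IsEulerLagrange B)
    (i j : Fin m) (t : ℝ) :
    lyapAlong A (G j) (γ j) μ η q₀ z t
      ≤ kappa p B G γ μ η * lyapAlong A (G i) (γ i) μ η q₀ z t := by
  have hN := ciInf_lamMin_matN_pos hn hp hm h hγ hμ
  set Z := ‖stack (errPos q₀ z t)‖ ^ 2 + ‖stack (errVel q₀ z t)‖ ^ 2 with hZ
  have hZ0 : 0 ≤ Z := by positivity
  have hi := lamMin_mul_le_lyapAlong (q₀ := q₀) (z := z) hn hp hA (hγ i) (h i) (hμ i) t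
  have hj := lyapAlong_le_lamMax_mul (q₀ := q₀) (z := z) hn hp hA (hγ j) (h j) (hμ j) t
  have hi' := (mul_le_mul_of_nonneg_right (ciInf_le_lamMin_matN i) hZ0).trans hi
  have hj' := hj.trans (mul_le_mul_of_nonneg_right (lamMax_matL_le_ciSup j) hZ0)
  have hκ : 0 ≤ kappa p B G γ μ η :=
    (pow_nonneg (h i).Q_pos.le _).trans (pow_le_kappa hn hp hm h hγ hμ)
  refine hj'.trans (le_trans (le_of_eq ?_) (mul_le_mul_of_nonneg_left hi' hκ))
  rw [kappa, ← mul_assoc, div_mul_cancel₀ _ hN.ne']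

/-- The dwell time outweighs the loss `Q ^ 25` at a quarter of the rate `Λ`. -/
theorem exp_mul_pow_le_one {Λ πd κ : ℝ} (hQ : 0 < Q) (hκ : Q ^ 100 ≤ κ)
    (hπ : Real.log κ ≤ Λ * πd) : Real.exp (-(Λ / 4 * πd)) * Q ^ 25 ≤ 1 := by
  have hκ0 : 0 < κ := (pow_pos hQ 100).trans_le hκ
  have h1 : κ ≤ Real.exp (Λ * πd) := by
    rw [← Real.exp_log hκ0]; exact Real.exp_le_exp.2 hπ
  have h2 : (Real.exp (-(Λ / 4 * πd)) * Q ^ 25) ^ 4 = Real.exp (-(Λ * πd)) * Q ^ 100 := by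
    rw [mul_pow, ← Real.exp_nat_mul, ← pow_mul]
    congr 2
    push_cast
    ring
  refine (pow_le_one_iff_of_nonneg (by positivity) four_ne_zero).1 ?_
  rw [h2, Real.exp_neg, inv_mul_le_one₀ (Real.exp_pos _)]
  exact hκ.trans h1

/-- The position and velocity errors of a closed-loop solution decay exponentially, with a constant
that does not depend on the solution or on `T`. The number `t₀` is a time
after which the observer has converged and one dwell time has passed. -/
theorem energy_le_of_isFilippovSolution {A : Fin n → Agent p} {q₀ : ℝ → Coord p}
    {e z : ℝ → NetState n p} {σ : ℝ → Fin m} {πd t₀ α : ℝ} {T : EReal}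
    (hn : 0 < n) (hp : 0 < p) (hm : 0 < m)
    (h : ∀ j, HighGainTopology p B (G j) (γ j) μ β Q η) (hγ : ∀ j, IsScaling (G j) (γ j))
    (hμ : ∀ j, muBound p B (G j) (γ j) < μ) (hν : ∀ j, IsMu3 p B (G j) (γ j) μ (ν j))
    (ha₃ : ∀ j, IsDecayConstant p B (G j) (γ j) (ν j) μ η β (a₃ j)) (hπd : 0 < πd)
    (hσ : HasDwellTime σ πd) (hA : ∀ i, (A i).IsEulerLagrange B)
    (hq₀ : IsLeaderTrajectory n B q₀)
    (hκ : kappa p B G γ μ η = Real.exp ((capLam p B G γ μ η a₃ - α) * πd)) (hα : 0 ≤ α)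
    (ht₀ : πd ≤ t₀) (he : ∀ t, t₀ ≤ t → ∀ i, (e t).1 i = q₀ t ∧ (e t).2 i = deriv q₀ t)
    (hz : IsFilippovSolution (networkField A (fun t => G (σ t)) μ η β q₀ e) T z)
    (hz0 : ∀ i, ‖(z 0).1 i - q₀ 0‖ ≤ B.ka / √(n : ℝ) ∧
      ‖(z 0).2 i - deriv q₀ 0‖ ≤ B.kb / √(n : ℝ)) {t : ℝ} (ht : 0 ≤ t) (htT : (t : EReal) < T) :
    ‖stack (errPos q₀ z t)‖ ^ 2 + ‖stack (errVel q₀ z t)‖ ^ 2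
      ≤ (Q ^ 114 + Real.exp (capLam p B G γ μ η a₃ * πd) * (Q * Q ^ 114)
          / ⨅ j, lamMin (matN p B (G j) (γ j) μ η)) * Real.exp (-(α * (t - t₀))) := by
  set Λ := capLam p B G γ μ η a₃ with hΛ
  set N₀ := ⨅ j, lamMin (matN p B (G j) (γ j) μ η) with hN₀
  have hN₀pos : 0 < N₀ := ciInf_lamMin_matN_pos hn hp hm h hγ hμ
  have hΛpos : 0 < Λ := capLam_pos hn hp hm h fun j => (ha₃ j).1
  have ht₀' : 0 ≤ t₀ := hπd.le.trans ht₀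
  let j₀ : Fin m := ⟨0, hm⟩
  have hη : η = Q ^ 102 := (h j₀).eta_eq
  have hQ0 := (h j₀).Q_pos
  have hmono : ∀ {s t : ℝ}, s ≤ t → (t : EReal) < T → (s : EReal) < T := fun hst h =>
    (EReal.coe_le_coe_iff.2 hst).trans_lt h
  set X : ℝ → ℝ := fun t => ‖stack (errPos q₀ z t)‖ with hX
  set Y : ℝ → ℝ := fun t => ‖stack (errVel q₀ z t)‖ with hY
  set V : Fin m → ℝ → ℝ := fun j => lyapAlong A (G j) (γ j) μ η q₀ z with hV
  have hac : ∀ a b : ℝ, 0 ≤ a → a ≤ b → (b : EReal) < T → AbsolutelyContinuousOnInterval z a b :=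
    fun a b ha hab hbT => (hz.1 b (ha.trans hab) hbT).mono (by
      rw [Set.uIcc_of_le hab, Set.uIcc_of_le (ha.trans hab)]
      exact Set.Icc_subset_Icc_left ha)
  have hder : ∀ (j : Fin m) (a b : ℝ), 0 ≤ a → (b : EReal) < T →
      (∀ t, a < t → t < b → σ t = j) → ∀ᵐ t : ℝ, a < t → t < b → G (σ t) = G j ∧
        ∃ w ∈ filippov (networkField A (fun t => G (σ t)) μ η β q₀ e t) (z t),
          HasDerivAt z w t := by
    intro j a b ha hbT hσj
    filter_upwards [hz.2] with t ht hat htb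
    exact ⟨by rw [hσj t hat htb], ht (ha.trans_lt hat) (hmono htb.le hbT)⟩
  -- a quarter of `Λ` is a decay rate for the whole evolution
  have hrate : ∀ j, Λ / 4 ≤ 1 / 2 * HighGain.rate (lamMin (matX p (G j) (γ j))) μ η
      / lamMax (matL p B (G j) (γ j) μ η) := fun j => by
    have h1 : Λ ≤ 2 * HighGain.rate (lamMin (matX p (G j) (γ j))) μ η
        / lamMax (matL p B (G j) (γ j) μ η) := (capLam_le j).trans
      (div_le_div_of_nonneg_right ((ha₃ j).le_rate hn hp (h j) (hν j))
        (lamMax_matL_pos hn hp (h j)).le)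
    calc Λ / 4 ≤ 2 * HighGain.rate (lamMin (matX p (G j) (γ j))) μ η
        / lamMax (matL p B (G j) (γ j) μ η) / 4 := by linarith
      _ = _ := by ring
  have hbound : ∀ {t : ℝ}, 0 ≤ t → (t : EReal) < T →
      Q ^ 102 * X t ^ 2 + Y t ^ 2 ≤ Q ^ 114 ∧
        (πd ≤ t → Q ^ 102 * X t ^ 2 + Y t ^ 2 ≤ Q ^ 98) := by
    intro t ht htT
    refine switched_bound (V := V) (lam := Λ / 4) hσ hπd (h j₀).Q_ge (by positivity)
      (exp_mul_pow_le_one hQ0 (pow_le_kappa hn hp hm h hγ hμ) ?_)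
      (fun b hb hbT => continuousOn_norm_errPos hq₀.1.continuous hb (hz.1 b hb hbT))
      (energy_initial_le (h j₀) (fun i => (hz0 i).1) fun i => (hz0 i).2)
      (fun j t => ?_) (fun j t => ?_) (fun j a b ha hab hbT hσj hXQ => ?_) ht htT
    · rw [hκ, Real.log_exp]
      exact mul_le_mul_of_nonneg_right (by linarith) hπd.le
    · rw [← hη]
      exact lyapAlong_le_energy hA (hγ j) (h j) t
    · rw [← hη]
      exact energy_le_lyapAlong hn hp hA (hγ j) (h j) (hμ j) t
    · exact lyapAlong_le_of_crude hn hp hA hq₀ (hγ j) (h j) (hμ j) ha hab (hac a b ha hab hbT)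
        (hder j a b ha hbT hσj) hXQ (hrate j)
  have hZ : ∀ {t : ℝ}, 0 ≤ t → (t : EReal) < T → X t ^ 2 + Y t ^ 2 ≤ Q ^ 114 := by
    intro t ht htT
    have h1 := (hbound ht htT).1
    have h2 := le_mul_of_one_le_left (sq_nonneg (X t)) ((h j₀).one_le_pow 102)
    linarith
  have hD : 0 ≤ Real.exp (Λ * πd) * (Q * Q ^ 114) / N₀ :=
    div_nonneg (mul_nonneg (Real.exp_pos _).le (mul_nonneg hQ0.le (pow_nonneg hQ0.le _)))
      hN₀pos.le
  have hQ114 : 0 ≤ Q ^ 114 := pow_nonneg hQ0.le _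
  rcases le_total t t₀ with htt | htt
  · have h1 : 1 ≤ Real.exp (-(α * (t - t₀))) :=
      Real.one_le_exp (by nlinarith [mul_nonneg hα (sub_nonneg.2 htt)])
    have h2 := le_mul_of_one_le_right (add_nonneg hQ114 hD) h1
    exact (hZ ht htT).trans ((le_add_of_nonneg_right hD).trans h2)
  -- after the time `t₀` the errors stay in the region to which the decay constants refer
  have hdecay := switched_decay (V := V) hσ hπd hΛpos.le hα ht₀'
    (fun j t => lyapAlong_nonneg hn hp hA (hγ j) (h j) (hμ j) t)
    (fun i j t => by rw [← hκ]; exact lyapAlong_le_kappa_mul hn hp hm h hγ hμ hA i j t)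
    (fun j a b ha hab hbT hσj => by
      have ha0 := ht₀'.trans ha
      refine lyapAlong_le_of_sharp hn hp hA hq₀ (hγ j) (h j) (hμ j) (ha₃ j) ha0 hab
        (hac a b ha0 hab hbT) (hder j a b ha0 hbT hσj) (fun t hat htb => ?_) (fun t hat htb => ?_)
        (fun t hat _ => he t (ha.trans hat.le)) (capLam_le j)
      · exact ((h j).le_ka ((hbound (ha0.trans hat.le) (hmono htb.le hbT)).2
          (ht₀.trans (ha.trans hat.le)))).trans ((h j).ka_le_boxPos (hν j).pos (hν j).lt_sq)
      · refine (h j).le_boxVel (hν j).pos (hν j).lt_sq ?_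
        refine le_trans ?_ ((hbound (ha0.trans hat.le) (hmono htb.le hbT)).2
          (ht₀.trans (ha.trans hat.le)))
        exact le_add_of_nonneg_left (mul_nonneg (pow_nonneg hQ0.le _) (sq_nonneg _)))
    htt htT
  have hV₀ : V (σ t₀) t₀ ≤ Q * Q ^ 114 := by
    refine (lyapAlong_le_energy hA (hγ _) (h _) t₀).trans (mul_le_mul_of_nonneg_left ?_ hQ0.le)
    rw [hη]
    exact (hbound ht₀' (hmono htt htT)).1
  have h1 : N₀ * (X t ^ 2 + Y t ^ 2) ≤ V (σ t) t :=
    (mul_le_mul_of_nonneg_right (ciInf_le_lamMin_matN (σ t)) (by positivity)).trans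
      (lamMin_mul_le_lyapAlong hn hp hA (hγ _) (h _) (hμ _) t)
  have h2 := h1.trans (hdecay.trans (mul_le_mul_of_nonneg_left hV₀ (by positivity)))
  have h3 : X t ^ 2 + Y t ^ 2
      ≤ Real.exp (Λ * πd) * Real.exp (-(α * (t - t₀))) * (Q * Q ^ 114) / N₀ := by
    rw [le_div_iff₀' hN₀pos]; exact h2
  have h4 : Real.exp (Λ * πd) * Real.exp (-(α * (t - t₀))) * (Q * Q ^ 114) / N₀
      = Real.exp (Λ * πd) * (Q * Q ^ 114) / N₀ * Real.exp (-(α * (t - t₀))) := by ring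
  exact (h3.trans_eq h4).trans
    (mul_le_mul_of_nonneg_right (le_add_of_nonneg_left hQ114) (Real.exp_pos _).le)

end Network

end LeaderTracking

/-! ### Leader tracking under switching -/

open LeaderTracking

theorem mainTheorem2 (n p : ℕ) (hn : 0 < n) (hp : 0 < p) (B : LeaderTracking.Bounds) :
    ∃ ηthr : LeaderTracking.WDigraph n → (Fin n → ℝ) → ℝ → ℝ → ℝ,
    ∀ (m : ℕ), 0 < m → ∀ (G : Fin m → LeaderTracking.WDigraph n),
    (∀ j, (G j).HasSpanningTree ∧ (G j).NoEdgeIntoLeader) →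
    (∀ j, ∃ γ, LeaderTracking.IsScaling (G j) γ) ∧
    ∀ (γ : Fin m → Fin n → ℝ), (∀ j, LeaderTracking.IsScaling (G j) (γ j)) →
    ∀ (μ η β : ℝ),
    (∀ j, LeaderTracking.betaBound B (γ j) < β) →
    (∀ j, LeaderTracking.muBound p B (G j) (γ j) < μ) →
    1 < η → (∀ j, ηthr (G j) (γ j) μ β ≤ η) →
    ∀ (ν : Fin m → ℝ), (∀ j, LeaderTracking.IsMu3 p B (G j) (γ j) μ (ν j)) →
    (∀ j, ∃ a₃, LeaderTracking.IsDecayConstant p B (G j) (γ j) (ν j) μ η β a₃) ∧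
    ∀ (a₃ : Fin m → ℝ),
    (∀ j, LeaderTracking.IsDecayConstant p B (G j) (γ j) (ν j) μ η β (a₃ j)) →
    ∀ (πd : ℝ), 0 < πd →
    Real.log (LeaderTracking.kappa p B G γ μ η) / LeaderTracking.capLam p B G γ μ η a₃ < πd →
    ∃ rate : ℝ, 0 < rate ∧
    ∀ (σ : ℝ → Fin m), LeaderTracking.HasDwellTime σ πd →
    ∀ (A : Fin n → LeaderTracking.Agent p), (∀ i, (A i).IsEulerLagrange B) →
    ∀ (q₀ : ℝ → LeaderTracking.Coord p), LeaderTracking.IsLeaderTrajectory n B q₀ →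
    ∀ (GB : ℝ → LeaderTracking.WDigraph n), (∀ t, 0 ≤ t → (GB t).HasSpanningTree) →
    ∀ (ω₁ ω₂ : ℝ), 0 < ω₁ → B.kq / √(n : ℝ) < ω₂ →
    ∀ (e : ℝ → LeaderTracking.NetState n p),
    LeaderTracking.IsFilippovSolution (LeaderTracking.observerField GB ω₁ ω₂ q₀) ⊤ e →
    ∃ K : ℝ, ∀ (T : EReal) (z : ℝ → LeaderTracking.NetState n p),
    LeaderTracking.IsFilippovSolution
      (LeaderTracking.networkField A (fun t => G (σ t)) μ η β q₀ e) T z →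
    (∀ i, ‖(z 0).1 i - q₀ 0‖ ≤ B.ka / √(n : ℝ) ∧
      ‖(z 0).2 i - deriv q₀ 0‖ ≤ B.kb / √(n : ℝ)) →
    (∀ t : ℝ, 0 ≤ t → (t : EReal) < T → ∀ i,
      ‖(z t).1 i - q₀ t‖ ≤ K * Real.exp (-(rate * t)) ∧
      ‖(z t).2 i - deriv q₀ t‖ ≤ K * Real.exp (-(rate * t))) ∧
    (T = ⊤ → ∀ i,
      Filter.Tendsto (fun t => ‖(z t).1 i - q₀ t‖) Filter.atTop (nhds 0) ∧
      Filter.Tendsto (fun t => ‖(z t).2 i - deriv q₀ t‖) Filter.atTop (nhds 0)) := by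

  refine ⟨fun G γ μ β => gainScale p B G γ μ β ^ 102, fun m hm G hG =>
    ⟨fun j => exists_isScaling hn (hG j).1, ?_⟩⟩
  intro γ hγ μ η β hβ hμ hη1 hη ν hν
  have hμ0 : 0 < μ := pos_of_muBound_lt (hμ ⟨0, hm⟩)
  have hβ0 : 0 < β := (betaBound_pos hn (hγ ⟨0, hm⟩)).trans (hβ ⟨0, hm⟩)
  have hη0 : 0 ≤ η := by linarith
  -- the common bound `Q` of the parameters of all topologies is determined by the gain `η`
  obtain ⟨Q, hQ0, hQη⟩ : ∃ Q : ℝ, 0 ≤ Q ∧ Q ^ 102 = η :=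
    ⟨η ^ ((102 : ℕ) : ℝ)⁻¹, Real.rpow_nonneg hη0 _, Real.rpow_inv_natCast_pow hη0 (by norm_num)⟩
  have h : ∀ j, HighGainTopology p B (G j) (γ j) μ β Q η := fun j => by
    rw [← hQη]
    refine highGainTopology hn hp (hγ j) hμ0 hβ0.le
      (le_of_pow_le_pow_left₀ (n := 102) (by norm_num) hQ0 ?_)
    rw [hQη]; exact hη j
  refine ⟨fun j => exists_isDecayConstant hn (h j) (hγ j) (hβ j) (hν j), ?_⟩
  intro a₃ ha₃ πd hπd hlog
  have hΛ : 0 < capLam p B G γ μ η a₃ := capLam_pos hn hp hm h fun j => (ha₃ j).1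
  have hκ : 0 < kappa p B G γ μ η :=
    (pow_pos (h ⟨0, hm⟩).Q_pos 100).trans_le (pow_le_kappa hn hp hm h hγ hμ)
  set Λ := capLam p B G γ μ η a₃ with hΛdef
  -- `α` is what the dwell time leaves of the rate `Λ` after the loss `κ` at the switching times
  obtain ⟨α, hα, hακ⟩ : ∃ α, 0 < α ∧ kappa p B G γ μ η = Real.exp ((Λ - α) * πd) := by
    refine ⟨Λ - Real.log (kappa p B G γ μ η) / πd, ?_, ?_⟩
    · rw [div_lt_iff₀ hΛ] at hlog
      rw [sub_pos, div_lt_iff₀ hπd]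
      linarith
    · rw [sub_sub_cancel, div_mul_cancel₀ _ hπd.ne', Real.exp_log hκ]
  refine ⟨α / 2, by positivity, ?_⟩
  intro σ hσ A hA q₀ hq₀ GB hGB ω₁ ω₂ hω₁ hω₂ e he
  obtain ⟨Tobs, -, hTobs⟩ := observer_finite_time hn hq₀ hGB hω₁ hω₂ he
  set t₀ := max Tobs πd with ht₀
  set D := Q ^ 114 + Real.exp (Λ * πd) * (Q * Q ^ 114)
    / ⨅ j, lamMin (matN p B (G j) (γ j) μ η) with hD
  have hD0 : 0 ≤ D := add_nonneg (pow_nonneg hQ0 _) <| div_nonneg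
    (mul_nonneg (Real.exp_pos _).le (mul_nonneg hQ0 (pow_nonneg hQ0 _)))
    (ciInf_lamMin_matN_pos hn hp hm h hγ hμ).le
  clear_value D
  refine ⟨√(D * Real.exp (α * t₀)), fun T z hz hz0 => ?_⟩
  have hmain : ∀ t : ℝ, 0 ≤ t → (t : EReal) < T → ∀ i,
      ‖(z t).1 i - q₀ t‖ ≤ √(D * Real.exp (α * t₀)) * Real.exp (-(α / 2 * t)) ∧
      ‖(z t).2 i - deriv q₀ t‖ ≤ √(D * Real.exp (α * t₀)) * Real.exp (-(α / 2 * t)) := by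
    intro t ht htT i
    have h1 := energy_le_of_isFilippovSolution hn hp hm h hγ hμ hν ha₃ hπd hσ hA hq₀ hακ hα.le
      (le_max_right Tobs πd) (fun t ht => hTobs t ((le_max_left _ _).trans ht)) hz hz0 ht htT
    have h2 : D * Real.exp (-(α * (t - t₀)))
        = (√(D * Real.exp (α * t₀)) * Real.exp (-(α / 2 * t))) ^ 2 := by
      rw [mul_pow, Real.sq_sqrt (by positivity), ← Real.exp_nat_mul, mul_assoc, ← Real.exp_add]
      congr 2
      push_cast
      ring
    rw [← hΛdef, ← ht₀, ← hD, h2] at h1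
    have h3 := sq_nonneg ‖stack (errPos q₀ z t)‖
    have h4 := sq_nonneg ‖stack (errVel q₀ z t)‖
    exact ⟨(norm_le_norm_stack (errPos q₀ z t) i).trans
        (le_of_sq_le_sq (by linarith) (by positivity)),
      (norm_le_norm_stack (errVel q₀ z t) i).trans
        (le_of_sq_le_sq (by linarith) (by positivity))⟩
  refine ⟨hmain, fun hT i => ?_⟩
  have hlim : Tendsto (fun t => √(D * Real.exp (α * t₀)) * Real.exp (-(α / 2 * t))) atTop
      (𝓝 0) := by
    rw [← mul_zero √(D * Real.exp (α * t₀))]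
    exact (Real.tendsto_exp_neg_atTop_nhds_zero.comp
      (tendsto_id.const_mul_atTop (half_pos hα))).const_mul _
  constructor
  · refine squeeze_zero' (Eventually.of_forall fun t => norm_nonneg _) ?_ hlim
    filter_upwards [eventually_ge_atTop 0] with t ht
    exact (hmain t ht (hT ▸ EReal.coe_lt_top t) i).1
  · refine squeeze_zero' (Eventually.of_forall fun t => norm_nonneg _) ?_ hlim
    filter_upwards [eventually_ge_atTop 0] with t ht
    exact (hmain t ht (hT ▸ EReal.coe_lt_top t) i).2
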